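/- Let $H\in\mathbb R$ and let $A=\{a_n\}\subset\{z\in\mathbb C:|\operatorname{Im}z|\le H\}$ be the multiset of zeros (counted with multiplicities, each finite) of a Dirichlet series $$Q(z)=\sum_{\omega\in\Omega}q_\omega e^{2\pi i\omega z},\qquad q_\omega\in\mathbb C,\quad \sum_{\omega\in\Omega}|q_\omega|<\infty,\quad \Omega\subset\mathbb R\text{ bounded},$$ and put $\mu_A=\sum_n\delta_{a_n}$. Then: (i) $A$ is almost periodic: $A$ is locally finite, and for every continuous compactly supported $\varphi:\mathbb C\to\mathbb C$ the function $g(z)=\int\varphi(z-w)\,\mu_A(dw)$ is almost periodic on $\mathbb C$, i.e. $g$ is continuous and for all $\alpha<\beta$ and $\varepsilon>0$ there is $L$ such that every interval $(t,t+L)$, $t\in\mathbb R$, contains a $\tau$ with $\sup_{\alpha\le\operatorname{Im}z\le\beta}|g(z+\tau)-g(z)|<\varepsilon$. (ii) $\log\mu_A(\{|z|\le r\})=O(\log r)$ as $r\to\infty$ (with $\log 0:=0$; all these numbers are finite), and the c-Fourier transform $\hat\mu_A^c$ of $\mu_A$, defined by $(\hat\mu_A^c,\phi)=\int\hat\phi^c\,d\mu_A$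 with $\hat\phi^c(z)=\int_{\mathbb R}\phi(t)e^{-2\pi izt}\,dt$ for all $C^\infty$ functions $\phi:\mathbb R\to\mathbb C$ with compact support (the integral converging absolutely), is a pure point measure: there are $b_\gamma\in\mathbb C$, $\gamma\in\mathbb R$, such that the set $\Gamma=\{\gamma:b_\gamma\ne0\}$ is countable, $\sum_{|\gamma|<r}|b_\gamma|<\infty$ for every $r$, and $\hat\mu_A^c=\sum_{\gamma\in\Gamma}b_\gamma\delta_\gamma$. (iii) The coefficients satisfy $$\log\sum_{|\gamma|<r}|b_\gamma|=O(r)\quad(r\to\infty,\ \log 0:=0)\qquad\text{and}\qquad\sum_{0<|\gamma|<1}|b_\gamma/\gamma|<\infty.$$ (iv) If $A$ is the multiset of zeros of an exponential polynomial $\sum_{1\le j\le N}q_je^{2\pi i\omega_jz}$ with $q_j\in\mathbb C$, $\omega_j\in\mathbb R$, then $\Gamma$ is locally finite, i.e. $\Gamma\cap K$ is finite for every compact $K\subset\mathbb R$. -/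

import Mathlib

open Filter MeasureTheory
open scoped Topology ContDiff

noncomputable section

/-- `Q` is the sum of an absolutely convergent Dirichlet series
`∑_{ω ∈ Ω} q_ω e^{2πiωz}`, `∑_{ω ∈ Ω} |q_ω| < ∞`, with `Ω ⊂ ℝ` bounded. -/
def IsDirichletSeries (Q : ℂ → ℂ) : Prop :=
  ∃ (Ω : Set ℝ) (q : Ω → ℂ), Bornology.IsBounded Ω ∧ Summable (fun w : Ω => ‖q w‖) ∧
    ∀ z : ℂ, HasSum
      (fun w : Ω => q w * Complex.exp (2 * Real.pi * Complex.I * ((w : ℝ) : ℂ) * z)) (Q z)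

/-- `P` is an exponential polynomial `∑_{1 ≤ j ≤ N} q_j e^{2πiω_j z}` with `ω_j ∈ ℝ`. -/
def IsExponentialPolynomial (P : ℂ → ℂ) : Prop :=
  ∃ (N : ℕ) (q : Fin N → ℂ) (w : Fin N → ℝ),
    ∀ z : ℂ, P z = ∑ j, q j * Complex.exp (2 * Real.pi * Complex.I * (w j : ℂ) * z)

/-- The multiset `A = {a_n}` is the zero set of `Q`, counted with multiplicities: every point
occurs in `A` a finite number of times, namely as many times as its order as a zero of `Q`. -/
def IsZeroMultiset {ι : Type*} (a : ι → ℂ) (Q : ℂ → ℂ) : Prop :=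
  ∀ z : ℂ, {n | a n = z}.Finite ∧ ({n | a n = z}.encard : ℕ∞) = analyticOrderAt Q z

/-- The closed horizontal strip `|Im z| ≤ H`. -/
def closedStrip (H : ℝ) : Set ℂ := {z | |z.im| ≤ H}

/-- The measure `μ_A = ∑_n δ_{a_n}`. -/
def pointMeasure {ι : Type*} (a : ι → ℂ) : Measure ℂ :=
  Measure.sum fun n => Measure.dirac (a n)

/-- A set of real numbers that meets every interval `(t, t + L)` for some fixed `L`. -/
def IsRelativelyDense (E : Set ℝ) : Prop :=
  ∃ L : ℝ, ∀ t : ℝ, (E ∩ Set.Ioo t (t + L)).Nonempty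

/-- The real `ε`-almost periods of `g` on `α ≤ Im z ≤ β`: those `τ` for which the supremum of
`|g(z + τ) - g(z)|` over this strip is (finite and) less than `ε`. -/
def almostPeriods (g : ℂ → ℂ) (α β ε : ℝ) : Set ℝ :=
  {τ | ∃ δ < ε, ∀ z : ℂ, α ≤ z.im → z.im ≤ β → ‖g (z + τ) - g z‖ ≤ δ}

/-- Almost periodic functions on `ℂ`, the open strip `-∞ < Im z < ∞`. -/
def IsAlmostPeriodicFun (g : ℂ → ℂ) : Prop :=
  Continuous g ∧ ∀ α β : ℝ, α < β → ∀ ε > 0, IsRelativelyDense (almostPeriods g α β ε)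

/-- Almost periodicity of a measure supported in a closed horizontal strip of finite width:
for every continuous compactly supported `φ` on `ℂ` the convolution
`z ↦ ∫ φ(z - w) μ(dw)` is almost periodic on `ℂ`. -/
def IsAlmostPeriodicMeasure (μ : Measure ℂ) : Prop :=
  ∀ φ : ℂ → ℂ, Continuous φ → HasCompactSupport φ →
    IsAlmostPeriodicFun fun z => ∫ w, φ (z - w) ∂μ

/-- Almost periodicity of a multiset `A = {a_n}` contained in a closed horizontal strip of finite
width: `A` is locally finite and `μ_A` is almost periodic. -/
def IsAlmostPeriodicMultiset {ι : Type*} (a : ι → ℂ) : Prop :=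
  (∀ K : Set ℂ, IsCompact K → {n | a n ∈ K}.Finite) ∧ IsAlmostPeriodicMeasure (pointMeasure a)

/-- The growth condition `log M_μ(r) = O(log r)`, `M_μ(r) = μ {|z| ≤ r} < ∞`, under which the
c-Fourier transform of a positive measure `μ` on a strip is defined. -/
def HasPolynomialGrowth (μ : Measure ℂ) : Prop :=
  (∀ r : ℝ, μ (Metric.closedBall 0 r) < ⊤) ∧
    (fun r : ℝ => Real.log (μ.real (Metric.closedBall 0 r))) =O[atTop] Real.log

/-- `φ̂ᶜ(z) = ∫_ℝ φ(t) e^{-2πizt} dt` for complex `z`. -/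
def cTransform (φ : ℝ → ℂ) (z : ℂ) : ℂ :=
  ∫ t : ℝ, φ t * Complex.exp (-(2 * Real.pi * Complex.I * z * (t : ℂ)))

/-- The c-Fourier transform of `μ` as a functional, `(μ̂ᶜ, φ) = ∫ φ̂ᶜ(z) μ(dz)`. -/
def cFourier (μ : Measure ℂ) (φ : ℝ → ℂ) : ℂ := ∫ z, cTransform φ z ∂μ

/-- The c-Fourier transform of `μ` is the pure point measure `∑_γ b_γ δ_γ` on `ℝ`: there are at
most countably many `γ` with `b_γ ≠ 0`, the sum has finite variation on bounded intervals, and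
`(μ̂ᶜ, φ)` exists and equals `∑_γ b_γ φ(γ)` for every `φ` in the space `𝓓` of
`C^∞`-functions with compact support. -/
def CFourierIsPurePoint (μ : Measure ℂ) (b : ℝ → ℂ) : Prop :=
  (Function.support b).Countable ∧
  (∀ r : ℝ, Summable fun γ : {γ : ℝ // |γ| < r} => ‖b γ‖) ∧
  ∀ φ : ℝ → ℂ, ContDiff ℝ ∞ φ → HasCompactSupport φ →
    Integrable (cTransform φ) μ ∧ HasSum (fun γ : ℝ => b γ * φ γ) (cFourier μ φ)

end

noncomputable section

/-! ### Zeros of entire functions -/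

section EntireZeros

open Complex

/-! Almost periodicity is a compactness statement. Multiply the coefficients `q w` by the
coordinates of a point `u` of the compact torus `W → Circle`. A real translation of the series then
becomes multiplication of `u` by a point of the one-parameter subgroup `torusLine`
(`dirichletSum_torusLine`). Every twisted series is nonzero, because its coefficients are Bohr means
of it, and the series depends continuously on `u`. Hurwitz' theorem therefore makes sums of a test
function over zeros continuous in `u` (`continuousAt_zeroSum`). The convolution with the zero
measure is thus a continuous function on torus × ℝ evaluated along a one-parameter subgroup, hence
almost periodic (`isAlmostPeriodicFun_of_compact_group`). The same compactness bounds the number of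
zeros in discs of fixed radius centred on the real line, which gives `∑ (1 + (Re aₙ)²)⁻¹ < ∞` and
polynomial growth.

For the Fourier transform, zeros confined to a strip force the spectrum to have a least and a
greatest element (`exists_least_frequency`). If the infimum of the spectrum were not attained, the
series normalised by it would either decay exponentially, which pushes the frequencies away from the
infimum, or stay bounded away from zero, although each of its terms tends to zero
(`exp_decay_or_norm_ge`, from Harnack and Phragmén–Lindelöf). Once the extremal term is factored
out, the rest is `1 + h` with `h` small far from the real axis. Expanding `log (1 + h)` and
differentiating shows that `Q'/Q` is an absolutely convergent Dirichlet series in an upper and in a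
lower half-plane (`exists_logDeriv_expansion`).

The residue theorem writes `2πi ∑ φ̂ᶜ(aₙ)` as the difference of the integrals of `φ̂ᶜ Q'/Q` over `Im
z = -s` and `Im z = s` (`two_pi_I_mul_tsum_eq`). Termwise Fourier inversion turns these into sums of
values of `φ`, so the transform is pure point. Convergence at height `s` bounds the masses with
weight `e^{-2πs|γ|}`. Each mass at `γ ≠ 0` carries a factor `γ` from differentiating the logarithm,
so division by `γ` keeps summability. With finitely many frequencies, only finitely many sums of
frequency gaps lie below a given bound. -/

lemma analyticOrderAt_ne_top_of_entire {F : ℂ → ℂ} (hF : Differentiable ℂ F)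
    (h0 : ∃ z, F z ≠ 0) (w : ℂ) : analyticOrderAt F w ≠ ⊤ := by
  obtain ⟨z, hz⟩ := h0
  have hA : AnalyticOnNhd ℂ F Set.univ := fun x _ => hF.analyticAt x
  refine hA.analyticOrderAt_ne_top_of_isPreconnected isPreconnected_univ
    (Set.mem_univ z) (Set.mem_univ w) ?_
  rw [(hF.analyticAt z).analyticOrderAt_eq_zero.2 hz]
  exact ENat.zero_ne_top

lemma analyticOrderNatAt_eq_zero_of_ne {F : ℂ → ℂ} (hF : Differentiable ℂ F) {w : ℂ}
    (hw : F w ≠ 0) : analyticOrderNatAt F w = 0 := by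
  simp [analyticOrderNatAt, (hF.analyticAt w).analyticOrderAt_eq_zero.2 hw]

lemma analyticOrderNatAt_pos_of_eq_zero {F : ℂ → ℂ} (hF : Differentiable ℂ F)
    (h0 : ∃ z, F z ≠ 0) {w : ℂ} (hw : F w = 0) : 0 < analyticOrderNatAt F w := by
  have h1 := analyticOrderAt_ne_top_of_entire hF h0 w
  have h2 : analyticOrderAt F w ≠ 0 := fun h =>
    (hF.analyticAt w).analyticOrderAt_eq_zero.1 h hw
  rw [← Nat.cast_analyticOrderNatAt h1] at h2
  exact Nat.pos_of_ne_zero fun h => h2 (by simp [h])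

lemma finite_zeros_of_isCompact {F : ℂ → ℂ} (hF : Differentiable ℂ F) (h0 : ∃ z, F z ≠ 0)
    {K : Set ℂ} (hK : IsCompact K) : {z | z ∈ K ∧ F z = 0}.Finite := by
  by_contra hinf
  obtain ⟨x, -, hx⟩ := Set.Infinite.exists_accPt_of_subset_isCompact
    (s := {z | z ∈ K ∧ F z = 0}) hinf hK (fun z hz => hz.1)
  have hA : AnalyticOnNhd ℂ F Set.univ := fun x _ => hF.analyticAt x
  obtain ⟨z, hz⟩ := h0
  refine hz (hA.eqOn_zero_of_preconnected_of_frequently_eq_zero isPreconnected_univ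
    (Set.mem_univ x) ?_ (Set.mem_univ z))
  exact (accPt_iff_frequently_nhdsNE.1 hx).mono fun y hy => hy.2

/-- The quotient `F z / (z - w) ^ n` is holomorphic off `w`, and near `w` it agrees with the local
analytic factor given by the order; the two pieces glue to one entire function. -/
lemma exists_entire_eq_pow_mul {F : ℂ → ℂ} (hF : Differentiable ℂ F) (h0 : ∃ z, F z ≠ 0)
    (w : ℂ) : ∃ G : ℂ → ℂ, Differentiable ℂ G ∧ G w ≠ 0 ∧
      ∀ z, F z = (z - w) ^ analyticOrderNatAt F w * G z := by
  have h1 := analyticOrderAt_ne_top_of_entire hF h0 w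
  obtain ⟨g, hg, hgw, hev⟩ := (hF.analyticAt w).analyticOrderAt_eq_natCast.1
    (Nat.cast_analyticOrderNatAt h1).symm
  set n := analyticOrderNatAt F w
  refine ⟨fun z => if z = w then g w else F z / (z - w) ^ n, fun z => ?_, by simpa, fun z => ?_⟩
  · by_cases hz : z = w
    · subst hz
      refine hg.differentiableAt.congr_of_eventuallyEq ?_
      filter_upwards [hev] with y hy
      by_cases hyz : y = z
      · simp [hyz]
      · have : y - z ≠ 0 := sub_ne_zero.2 hyz
        simp only [hyz, if_false, hy, smul_eq_mul]
        field_simp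
    · have hd : DifferentiableAt ℂ (fun z => F z / (z - w) ^ n) z :=
        (hF z).div (by fun_prop) (pow_ne_zero _ (sub_ne_zero.2 hz))
      refine hd.congr_of_eventuallyEq ?_
      filter_upwards [isOpen_ne.mem_nhds hz] with y hy
      simp [hy]
  · by_cases hz : z = w
    · subst hz
      simpa using hev.self_of_nhds
    · have : z - w ≠ 0 := sub_ne_zero.2 hz
      simp only [hz, if_false]
      field_simp

lemma exists_entire_factorization {F : ℂ → ℂ} (hF : Differentiable ℂ F) (h0 : ∃ z, F z ≠ 0)
    (S : Finset ℂ) : ∃ G : ℂ → ℂ, Differentiable ℂ G ∧ (∀ w ∈ S, G w ≠ 0) ∧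
      ∀ z, F z = (∏ w ∈ S, (z - w) ^ analyticOrderNatAt F w) * G z := by
  classical
  induction S using Finset.induction_on with
  | empty => exact ⟨F, hF, by simp, by simp⟩
  | insert w S hw ih =>
    obtain ⟨G, hG, hGS, hFG⟩ := ih
    have hG0 : ∃ z, G z ≠ 0 := by
      obtain ⟨z, hz⟩ := h0
      exact ⟨z, fun h => hz (by rw [hFG, h, mul_zero])⟩
    -- The factors already removed do not vanish at the new point `w`, so the order there is
    -- unchanged when passing from `F` to the cofactor.
    have hord : analyticOrderNatAt F w = analyticOrderNatAt G w := by
      have hP : Differentiable ℂ fun z : ℂ => ∏ v ∈ S, (z - v) ^ analyticOrderNatAt F v := by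
        fun_prop
      have hPw : (∏ v ∈ S, (w - v) ^ analyticOrderNatAt F v) ≠ 0 :=
        Finset.prod_ne_zero_iff.2 fun v hv =>
          pow_ne_zero _ (sub_ne_zero.2 fun h => hw (h ▸ hv))
      have hEq : F = (fun z : ℂ => ∏ v ∈ S, (z - v) ^ analyticOrderNatAt F v) * G :=
        funext hFG
      have := analyticOrderAt_mul (hP.analyticAt w) (hG.analyticAt w)
      rw [(hP.analyticAt w).analyticOrderAt_eq_zero.2 hPw, zero_add, ← hEq] at this
      simp only [analyticOrderNatAt, this]
    obtain ⟨G', hG', hG'w, hGG'⟩ := exists_entire_eq_pow_mul hG hG0 w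
    refine ⟨G', hG', ?_, fun z => ?_⟩
    · intro v hv
      rcases Finset.mem_insert.1 hv with rfl | hv
      · exact hG'w
      · intro h
        exact hGS v hv (by rw [hGG', h, mul_zero])
    · rw [hFG, Finset.prod_insert hw, hGG' z, hord]
      ring

/-- The logarithmic derivative turns the factorization into a sum of simple poles plus a function
regular on `K`. Both argument principles, on discs and on rectangles, then reduce to integrating `(z
- w)⁻¹`. -/
lemma exists_logDeriv_eq_sum {F : ℂ → ℂ} (hF : Differentiable ℂ F) (h0 : ∃ z, F z ≠ 0)
    {K : Set ℂ} {S : Finset ℂ} (hS : ∀ z, z ∈ S ↔ z ∈ K ∧ F z = 0) :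
    ∃ G : ℂ → ℂ, Differentiable ℂ G ∧ (∀ z ∈ K, G z ≠ 0) ∧
      ∀ z ∈ K, F z ≠ 0 →
        logDeriv F z = (∑ w ∈ S, (analyticOrderNatAt F w : ℂ) * (z - w)⁻¹) + logDeriv G z := by
  obtain ⟨G, hG, hGS, hFG⟩ := exists_entire_factorization hF h0 S
  have hGK : ∀ z ∈ K, G z ≠ 0 := by
    intro z hz h
    exact hGS z ((hS z).2 ⟨hz, by rw [hFG, h, mul_zero]⟩) h
  refine ⟨G, hG, hGK, fun z hz hFz => ?_⟩
  have hne : ∀ w ∈ S, (z - w) ^ analyticOrderNatAt F w ≠ 0 := fun w hw =>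
    pow_ne_zero _ (sub_ne_zero.2 fun h => hFz (h ▸ ((hS w).1 hw).2))
  have hEq : F = fun z => (∏ w ∈ S, (z - w) ^ analyticOrderNatAt F w) * G z := funext hFG
  conv_lhs => rw [hEq]
  rw [logDeriv_mul (f := fun z => ∏ w ∈ S, (z - w) ^ analyticOrderNatAt F w) z
    (Finset.prod_ne_zero_iff.2 hne) (hGK z hz) (by fun_prop) (hG z),
    logDeriv_prod hne (by fun_prop)]
  congr 1
  refine Finset.sum_congr rfl fun w _ => ?_
  rw [logDeriv_fun_pow (by fun_prop), logDeriv_apply]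
  simp

/-- The argument principle on a disc. -/
lemma circleIntegral_logDeriv {F : ℂ → ℂ} (hF : Differentiable ℂ F) {c : ℂ} {r : ℝ} (hr : 0 < r)
    (hne : ∀ z ∈ Metric.sphere c r, F z ≠ 0) {S : Finset ℂ}
    (hS : ∀ z, z ∈ S ↔ z ∈ Metric.ball c r ∧ F z = 0) :
    ∮ z in C(c, r), logDeriv F z = 2 * Real.pi * I * ∑ w ∈ S, (analyticOrderNatAt F w : ℂ) := by
  have h0 : ∃ z, F z ≠ 0 := by
    obtain ⟨z, hz⟩ := (NormedSpace.sphere_nonempty (x := c)).2 hr.le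
    exact ⟨z, hne z hz⟩
  have hS' : ∀ z, z ∈ S ↔ z ∈ Metric.closedBall c r ∧ F z = 0 := by
    intro z
    rw [hS, ← Metric.ball_union_sphere]
    constructor
    · exact fun h => ⟨Or.inl h.1, h.2⟩
    · rintro ⟨h | h, h'⟩
      · exact ⟨h, h'⟩
      · exact absurd h' (hne z h)
  obtain ⟨G, hG, hGK, hlog⟩ := exists_logDeriv_eq_sum hF h0 hS'
  have hGd : DifferentiableOn ℂ (logDeriv G) (Metric.closedBall c r) := fun z hz =>
    (((hG.deriv z).div (hG z) (hGK z hz))).differentiableWithinAt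
  have hI : ∀ w ∈ S, CircleIntegrable
      (fun z => (analyticOrderNatAt F w : ℂ) * (z - w)⁻¹) c r := by
    intro w hw
    refine ContinuousOn.circleIntegrable hr.le ?_
    refine ContinuousOn.mul continuousOn_const (ContinuousOn.inv₀ (by fun_prop) fun z hz => ?_)
    exact sub_ne_zero.2 fun h => hne z hz (h ▸ ((hS w).1 hw).2)
  have hIG : CircleIntegrable (logDeriv G) c r :=
    (hGd.continuousOn.mono Metric.sphere_subset_closedBall).circleIntegrable hr.le
  rw [circleIntegral.integral_congr hr.le (g := fun z =>
    (∑ w ∈ S, (analyticOrderNatAt F w : ℂ) * (z - w)⁻¹) + logDeriv G z) fun z hz =>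
      hlog z (Metric.sphere_subset_closedBall hz) (hne z hz)]
  have hG0 : ∮ z in C(c, r), logDeriv G z = 0 :=
    DiffContOnCl.circleIntegral_eq_zero hr.le (hGd.diffContOnCl_ball le_rfl)
  rw [circleIntegral.integral_add (CircleIntegrable.fun_sum S hI) hIG, hG0, add_zero,
    circleIntegral.integral_fun_sum hI, Finset.mul_sum]
  refine Finset.sum_congr rfl fun w hw => ?_
  rw [circleIntegral.integral_const_mul, circleIntegral.integral_sub_inv_of_mem_ball ((hS w).1 hw).1]
  ring

end EntireZeros

end

noncomputable section

/-! ### The residue theorem on a rectangle -/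

section Rectangle

open Complex

/-- The integral of `f` along the boundary of the rectangle `[x₁, x₂] × [y₁, y₂]`. -/
def rectangleIntegral (f : ℂ → ℂ) (x₁ x₂ y₁ y₂ : ℝ) : ℂ :=
  (∫ x in x₁..x₂, f (x + y₁ * I)) - (∫ x in x₁..x₂, f (x + y₂ * I)) +
    I * (∫ y in y₁..y₂, f (x₂ + y * I)) - I * ∫ y in y₁..y₂, f (x₁ + y * I)

/-- The boundary of the rectangle `[x₁, x₂] × [y₁, y₂]`. -/
def rectangleBoundary (x₁ x₂ y₁ y₂ : ℝ) : Set ℂ :=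
  {z | (z.re ∈ Set.Icc x₁ x₂ ∧ z.im ∈ Set.Icc y₁ y₂) ∧
    (z.re = x₁ ∨ z.re = x₂ ∨ z.im = y₁ ∨ z.im = y₂)}

variable {x₁ x₂ y₁ y₂ : ℝ} {f g : ℂ → ℂ}

lemma ContinuousOn.intervalIntegrable_rectangle (hx : x₁ ≤ x₂) (hy : y₁ ≤ y₂)
    (hf : ContinuousOn f (rectangleBoundary x₁ x₂ y₁ y₂)) :
    IntervalIntegrable (fun x : ℝ => f (x + y₁ * I)) volume x₁ x₂ ∧
    IntervalIntegrable (fun x : ℝ => f (x + y₂ * I)) volume x₁ x₂ ∧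
    IntervalIntegrable (fun y : ℝ => f (x₂ + y * I)) volume y₁ y₂ ∧
    IntervalIntegrable (fun y : ℝ => f (x₁ + y * I)) volume y₁ y₂ := by
  refine ⟨?_, ?_, ?_, ?_⟩ <;>
  · refine ContinuousOn.intervalIntegrable (hf.comp (by fun_prop) fun t ht => ?_)
    rw [Set.uIcc_of_le (by assumption)] at ht
    obtain ⟨h1, h2⟩ := ht
    simp [rectangleBoundary, *]

lemma rectangleIntegral_congr (hx : x₁ ≤ x₂) (hy : y₁ ≤ y₂)
    (h : ∀ z ∈ rectangleBoundary x₁ x₂ y₁ y₂, f z = g z) :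
    rectangleIntegral f x₁ x₂ y₁ y₂ = rectangleIntegral g x₁ x₂ y₁ y₂ := by
  have hX : ∀ y : ℝ, y ∈ Set.Icc y₁ y₂ → (y = y₁ ∨ y = y₂) →
      ∫ x in x₁..x₂, f (x + y * I) = ∫ x in x₁..x₂, g (x + y * I) := by
    intro y hy1 hy2
    refine intervalIntegral.integral_congr fun t ht => h _ ?_
    rw [Set.uIcc_of_le hx] at ht
    refine ⟨⟨by simpa using ht, by simpa using hy1⟩, ?_⟩
    rcases hy2 with rfl | rfl <;> simp
  have hY : ∀ x : ℝ, x ∈ Set.Icc x₁ x₂ → (x = x₁ ∨ x = x₂) →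
      ∫ y in y₁..y₂, f (x + y * I) = ∫ y in y₁..y₂, g (x + y * I) := by
    intro x hx1 hx2
    refine intervalIntegral.integral_congr fun t ht => h _ ?_
    rw [Set.uIcc_of_le hy] at ht
    refine ⟨⟨by simpa using hx1, by simpa using ht⟩, ?_⟩
    rcases hx2 with rfl | rfl <;> simp
  unfold rectangleIntegral
  rw [hX y₁ ⟨le_rfl, hy⟩ (Or.inl rfl), hX y₂ ⟨hy, le_rfl⟩ (Or.inr rfl),
    hY x₁ ⟨le_rfl, hx⟩ (Or.inl rfl), hY x₂ ⟨hx, le_rfl⟩ (Or.inr rfl)]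

lemma rectangleIntegral_add (hx : x₁ ≤ x₂) (hy : y₁ ≤ y₂)
    (hf : ContinuousOn f (rectangleBoundary x₁ x₂ y₁ y₂))
    (hg : ContinuousOn g (rectangleBoundary x₁ x₂ y₁ y₂)) :
    rectangleIntegral (fun z => f z + g z) x₁ x₂ y₁ y₂ =
      rectangleIntegral f x₁ x₂ y₁ y₂ + rectangleIntegral g x₁ x₂ y₁ y₂ := by
  obtain ⟨f1, f2, f3, f4⟩ := hf.intervalIntegrable_rectangle hx hy
  obtain ⟨g1, g2, g3, g4⟩ := hg.intervalIntegrable_rectangle hx hy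
  unfold rectangleIntegral
  rw [intervalIntegral.integral_add f1 g1, intervalIntegral.integral_add f2 g2,
    intervalIntegral.integral_add f3 g3, intervalIntegral.integral_add f4 g4]
  ring

lemma rectangleIntegral_const_mul (c : ℂ) :
    rectangleIntegral (fun z => c * f z) x₁ x₂ y₁ y₂ =
      c * rectangleIntegral f x₁ x₂ y₁ y₂ := by
  unfold rectangleIntegral
  simp only [intervalIntegral.integral_const_mul]
  ring

lemma rectangleIntegral_sum (hx : x₁ ≤ x₂) (hy : y₁ ≤ y₂) {ι : Type*} (S : Finset ι)
    {F : ι → ℂ → ℂ} (hF : ∀ i ∈ S, ContinuousOn (F i) (rectangleBoundary x₁ x₂ y₁ y₂)) :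
    rectangleIntegral (fun z => ∑ i ∈ S, F i z) x₁ x₂ y₁ y₂ =
      ∑ i ∈ S, rectangleIntegral (F i) x₁ x₂ y₁ y₂ := by
  classical
  induction S using Finset.induction_on with
  | empty => simp [rectangleIntegral]
  | insert i S hi ih =>
    simp only [Finset.sum_insert hi]
    rw [rectangleIntegral_add hx hy (hF i (Finset.mem_insert_self _ _))
      (continuousOn_finsetSum _ fun j hj => hF j (Finset.mem_insert_of_mem hj)),
      ih fun j hj => hF j (Finset.mem_insert_of_mem hj)]

lemma rectangleIntegral_eq_zero (hx : x₁ ≤ x₂) (hy : y₁ ≤ y₂)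
    (hf : DifferentiableOn ℂ f (Set.Icc x₁ x₂ ×ℂ Set.Icc y₁ y₂)) :
    rectangleIntegral f x₁ x₂ y₁ y₂ = 0 := by
  have := integral_boundary_rect_eq_zero_of_differentiableOn f ⟨x₁, y₁⟩ ⟨x₂, y₂⟩
    (by simpa [Set.uIcc_of_le hx, Set.uIcc_of_le hy] using hf)
  simpa [rectangleIntegral] using this

/-- The logarithm of the rotated segment is a primitive; the constant `c` serves to move the segment
off the branch cut. -/
lemma integral_inv_of_log_mem_slitPlane {p d c : ℂ} {a b : ℝ}
    (h : ∀ t ∈ Set.uIcc a b, c * (p + t * d) ∈ slitPlane) :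
    d * ∫ t in a..b, (p + t * d)⁻¹ = log (c * (p + b * d)) - log (c * (p + a * d)) := by
  rw [← intervalIntegral.integral_const_mul]
  have hc : c ≠ 0 := by
    rintro rfl
    exact slitPlane_ne_zero (h a Set.left_mem_uIcc) (zero_mul _)
  have hne : ∀ t ∈ Set.uIcc a b, p + t * d ≠ 0 := fun t ht h0 =>
    slitPlane_ne_zero (h t ht) (by rw [h0, mul_zero])
  refine intervalIntegral.integral_eq_sub_of_hasDerivAt (f := fun t : ℝ => log (c * (p + t * d)))
    (fun t ht => ?_) ?_
  · have h1 : HasDerivAt (fun t : ℝ => c * (p + t * d)) (c * (1 * d)) t :=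
      (((hasDerivAt_id t).ofReal_comp.mul_const d).const_add p).const_mul c
    refine (h1.clog_real (h t ht)).congr_deriv ?_
    rw [one_mul, mul_div_mul_left _ _ hc, div_eq_mul_inv]
  · refine ContinuousOn.intervalIntegrable (ContinuousOn.mul continuousOn_const ?_)
    exact ContinuousOn.inv₀ (by fun_prop) hne

/-- Seen from `a`, only the left side crosses the cut of the principal logarithm, so there the
branch `log (-·)` is used. Returning to the principal branch costs `-πi` at the upper corner and
`+πi` at the lower one, and these add up to `2πi`; everything else telescopes. -/
lemma rectangleIntegral_sub_inv {a : ℂ} (ha : a.re ∈ Set.Ioo x₁ x₂) (hb : a.im ∈ Set.Ioo y₁ y₂) :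
    rectangleIntegral (fun z => (z - a)⁻¹) x₁ x₂ y₁ y₂ = 2 * Real.pi * I := by
  obtain ⟨ha1, ha2⟩ := ha
  obtain ⟨hb1, hb2⟩ := hb
  have key1 := integral_inv_of_log_mem_slitPlane (p := y₁ * I - a) (d := 1) (c := 1) (a := x₁)
    (b := x₂) (fun t _ => by
      rw [mem_slitPlane_iff]; right; simp; linarith)
  have key2 := integral_inv_of_log_mem_slitPlane (p := y₂ * I - a) (d := 1) (c := 1) (a := x₁)
    (b := x₂) (fun t _ => by
      rw [mem_slitPlane_iff]; right; simp; linarith)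
  have key3 := integral_inv_of_log_mem_slitPlane (p := x₂ - a) (d := I) (c := 1) (a := y₁)
    (b := y₂) (fun t _ => by
      rw [mem_slitPlane_iff]; left; simp; linarith)
  have key4 := integral_inv_of_log_mem_slitPlane (p := x₁ - a) (d := I) (c := -1) (a := y₁)
    (b := y₂) (fun t _ => by
      rw [mem_slitPlane_iff]; left; simp; linarith)
  have e1 : ∀ (t y : ℝ), ((t : ℂ) + y * I - a)⁻¹ = (y * I - a + t * 1)⁻¹ := fun t y => by ring_nf
  have e2 : ∀ (t x : ℝ), ((x : ℂ) + t * I - a)⁻¹ = (x - a + t * I)⁻¹ := fun t y => by ring_nf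
  unfold rectangleIntegral
  rw [funext fun t => e1 t y₁, funext fun t => e1 t y₂, funext fun t => e2 t x₁,
    funext fun t => e2 t x₂]
  rw [one_mul] at key1 key2
  rw [key1, key2, key3, key4]
  have l1 : log (-1 * (x₁ - a + y₂ * I)) = log (x₁ - a + y₂ * I) - Real.pi * I := by
    rw [neg_one_mul, log, log, norm_neg, arg_neg_eq_arg_sub_pi_of_im_pos (by simp; linarith)]
    push_cast; ring
  have l2 : log (-1 * (x₁ - a + y₁ * I)) = log (x₁ - a + y₁ * I) + Real.pi * I := by
    rw [neg_one_mul, log, log, norm_neg, arg_neg_eq_arg_add_pi_of_im_neg (by simp; linarith)]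
    push_cast; ring
  rw [l1, l2]
  simp only [one_mul, mul_one]
  rw [show (y₁ * I - a + x₂ : ℂ) = x₂ - a + y₁ * I by ring,
    show (y₁ * I - a + x₁ : ℂ) = x₁ - a + y₁ * I by ring,
    show (y₂ * I - a + x₂ : ℂ) = x₂ - a + y₂ * I by ring,
    show (y₂ * I - a + x₁ : ℂ) = x₁ - a + y₂ * I by ring]
  ring

/-- On the boundary the integrand is `dslope h a` plus `h a * (z - a)⁻¹`; the first summand is
entire and contributes nothing. -/
lemma rectangleIntegral_div_sub {h : ℂ → ℂ} (hh : Differentiable ℂ h) {a : ℂ}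
    (ha : a.re ∈ Set.Ioo x₁ x₂) (hb : a.im ∈ Set.Ioo y₁ y₂) :
    rectangleIntegral (fun z => h z * (z - a)⁻¹) x₁ x₂ y₁ y₂ = 2 * Real.pi * I * h a := by
  have hx : x₁ ≤ x₂ := (ha.1.trans ha.2).le
  have hy : y₁ ≤ y₂ := (hb.1.trans hb.2).le
  have hna : ∀ z ∈ rectangleBoundary x₁ x₂ y₁ y₂, z - a ≠ 0 := by
    rintro z ⟨-, hz⟩ h0
    rw [sub_eq_zero] at h0
    subst h0
    rcases hz with h | h | h | h
    · exact ha.1.ne' h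
    · exact ha.2.ne h
    · exact hb.1.ne' h
    · exact hb.2.ne h
  have hds : Differentiable ℂ (dslope h a) :=
    differentiableOn_univ.1 ((differentiableOn_dslope univ_mem).2 hh.differentiableOn)
  rw [rectangleIntegral_congr hx hy (g := fun z => dslope h a z + h a * (z - a)⁻¹),
    rectangleIntegral_add hx hy hds.continuous.continuousOn, rectangleIntegral_const_mul,
    rectangleIntegral_sub_inv ha hb, rectangleIntegral_eq_zero hx hy hds.differentiableOn]
  · ring
  · exact continuousOn_const.mul (ContinuousOn.inv₀ (by fun_prop) hna)
  · intro z hz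
    have := hna z hz
    rw [dslope_of_ne _ (sub_ne_zero.1 this), slope_def_field]
    field_simp
    ring

lemma rectangleBoundary_subset : rectangleBoundary x₁ x₂ y₁ y₂ ⊆ Set.Icc x₁ x₂ ×ℂ Set.Icc y₁ y₂ :=
  fun _ hz => mem_reProdIm.2 hz.1

/-- The weighted argument principle on a rectangle. -/
lemma rectangleIntegral_mul_logDeriv (hx : x₁ ≤ x₂) (hy : y₁ ≤ y₂) {h F : ℂ → ℂ}
    (hh : Differentiable ℂ h) (hF : Differentiable ℂ F)
    (hne : ∀ z ∈ rectangleBoundary x₁ x₂ y₁ y₂, F z ≠ 0) {S : Finset ℂ}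
    (hS : ∀ z, z ∈ S ↔ z ∈ Set.Icc x₁ x₂ ×ℂ Set.Icc y₁ y₂ ∧ F z = 0) :
    rectangleIntegral (fun z => h z * logDeriv F z) x₁ x₂ y₁ y₂ =
      2 * Real.pi * I * ∑ w ∈ S, (analyticOrderNatAt F w : ℂ) * h w := by
  have h0 : ∃ z, F z ≠ 0 := ⟨⟨x₁, y₁⟩, hne _ (by simp [rectangleBoundary, hx, hy])⟩
  obtain ⟨G, hG, hGK, hlog⟩ := exists_logDeriv_eq_sum hF h0 hS
  have hGd : DifferentiableOn ℂ (fun z => h z * logDeriv G z) (Set.Icc x₁ x₂ ×ℂ Set.Icc y₁ y₂) :=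
    fun z hz => ((hh z).mul ((hG.deriv z).div (hG z) (hGK z hz))).differentiableWithinAt
  have hc : ∀ w ∈ S, ContinuousOn
      (fun z => (analyticOrderNatAt F w : ℂ) * (h z * (z - w)⁻¹))
      (rectangleBoundary x₁ x₂ y₁ y₂) := by
    intro w hw
    refine continuousOn_const.mul (hh.continuous.continuousOn.mul
      (ContinuousOn.inv₀ (by fun_prop) fun z hz => ?_))
    exact sub_ne_zero.2 fun h => hne z hz (h ▸ ((hS w).1 hw).2)
  rw [rectangleIntegral_congr hx hy (g := fun z =>
    (∑ w ∈ S, (analyticOrderNatAt F w : ℂ) * (h z * (z - w)⁻¹)) + h z * logDeriv G z),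
    rectangleIntegral_add hx hy (continuousOn_finsetSum _ hc)
      (hGd.continuousOn.mono rectangleBoundary_subset),
    rectangleIntegral_eq_zero hx hy hGd, rectangleIntegral_sum hx hy S hc, add_zero,
    Finset.mul_sum]
  · refine Finset.sum_congr rfl fun w hw => ?_
    have hwK := (hS w).1 hw
    have hwi := mem_reProdIm.1 hwK.1
    have hwb : w ∉ rectangleBoundary x₁ x₂ y₁ y₂ := fun h => hne w h hwK.2
    simp only [rectangleBoundary, Set.mem_ofPred_eq, hwi, true_and, not_or, and_self] at hwb
    rw [rectangleIntegral_const_mul, rectangleIntegral_div_sub hh]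
    · ring
    · exact ⟨lt_of_le_of_ne hwi.1.1 (Ne.symm hwb.1), lt_of_le_of_ne hwi.1.2 hwb.2.1⟩
    · exact ⟨lt_of_le_of_ne hwi.2.1 (Ne.symm hwb.2.2.1), lt_of_le_of_ne hwi.2.2 hwb.2.2.2⟩
  · intro z hz
    rw [hlog z (rectangleBoundary_subset hz) (hne z hz), mul_add, Finset.mul_sum]
    congr 1
    exact Finset.sum_congr rfl fun w _ => by ring

end Rectangle

end

noncomputable section

/-! ### Continuity of sums over zeros -/

section ZeroSum

open Complex

/-- The sum of `φ` over the zeros of `F`, counted with multiplicities. -/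
def zeroSum (F : ℂ → ℂ) (φ : ℂ → ℂ) : ℂ := ∑ᶠ z, (analyticOrderNatAt F z : ℂ) * φ z

lemma zeroSum_eq_sum {F φ : ℂ → ℂ} (hF : Differentiable ℂ F) {S : Finset ℂ}
    (hS : ∀ z, F z = 0 → φ z ≠ 0 → z ∈ S) :
    zeroSum F φ = ∑ z ∈ S, (analyticOrderNatAt F z : ℂ) * φ z := by
  refine finsum_eq_sum_of_support_subset _ fun z hz => ?_
  by_contra hzS
  refine hz ?_
  by_cases hφ : φ z = 0
  · simp [hφ]
  · have : F z ≠ 0 := fun h => hzS (hS z h hφ)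
    simp [analyticOrderNatAt_eq_zero_of_ne hF this]

variable {T : Type*} [TopologicalSpace T] {F : T → ℂ → ℂ}

/-- The nonvanishing set is open in `T × ℂ`, so the tube lemma applies to `{t₀} × K`. -/
lemma eventually_forall_ne_zero (hc : Continuous (Function.uncurry F)) {t₀ : T} {K : Set ℂ}
    (hK : IsCompact K) (hne : ∀ z ∈ K, F t₀ z ≠ 0) : ∀ᶠ t in 𝓝 t₀, ∀ z ∈ K, F t z ≠ 0 := by
  have hopen : IsOpen {p : T × ℂ | F p.1 p.2 ≠ 0} := isOpen_ne_fun hc continuous_const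
  obtain ⟨u, v, hu, -, htu, hKv, huv⟩ := generalized_tube_lemma
    (isCompact_singleton (x := t₀)) hK hopen (by rintro ⟨t, z⟩ ⟨ht, hz⟩; cases ht; exact hne z hz)
  filter_upwards [hu.mem_nhds (htu rfl)] with t ht z hz
  exact huv (Set.mk_mem_prod ht (hKv hz))

/-- Hurwitz' theorem: the number of zeros in a disc is locally constant. -/
lemma eventually_sum_order_eq (hF : ∀ t, Differentiable ℂ (F t))
    (hc : Continuous (Function.uncurry F))
    (hd : Continuous (Function.uncurry fun t => deriv (F t))) {t₀ : T} {c : ℂ} {r : ℝ} (hr : 0 < r)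
    (hne : ∀ z ∈ Metric.sphere c r, F t₀ z ≠ 0) {S₀ : Finset ℂ}
    (hS₀ : ∀ z, z ∈ S₀ ↔ z ∈ Metric.ball c r ∧ F t₀ z = 0) :
    ∀ᶠ t in 𝓝 t₀, ∀ S : Finset ℂ, (∀ z, z ∈ S ↔ z ∈ Metric.ball c r ∧ F t z = 0) →
      ∑ w ∈ S, analyticOrderNatAt (F t) w = ∑ w ∈ S₀, analyticOrderNatAt (F t₀) w := by
  set U : Set T := {t | ∀ z ∈ Metric.sphere c r, F t z ≠ 0}
  have hU : U ∈ 𝓝 t₀ := eventually_forall_ne_zero hc (isCompact_sphere c r) hne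
  have hcont : ContinuousOn (fun t => ∮ z in C(c, r), logDeriv (F t) z) U := by
    rw [continuousOn_iff_continuous_domRestrict]
    refine intervalIntegral.continuous_parametric_intervalIntegral_of_continuous'
      (f := fun (t : U) θ => deriv (circleMap c r) θ • logDeriv (F t) (circleMap c r θ)) ?_ 0
        (2 * Real.pi)
    have h1 : Continuous fun p : U × ℝ => ((p.1 : T), circleMap c r p.2) := by fun_prop
    refine Continuous.smul (f := fun p : U × ℝ => deriv (circleMap c r) p.2)
      (g := fun p : U × ℝ => logDeriv (F p.1) (circleMap c r p.2)) ?_ ?_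
    · simp only [deriv_circleMap]; fun_prop
    · refine Continuous.div (hd.comp h1) (hc.comp h1) fun p => ?_
      exact p.1.2 _ (circleMap_mem_sphere c hr.le p.2)
  have hat := (hcont.continuousAt hU)
  have h2 : (2 * Real.pi * I : ℂ) ≠ 0 := Complex.two_pi_I_ne_zero
  have hat' : Tendsto (fun t => (2 * Real.pi * I : ℂ)⁻¹ * ∮ z in C(c, r), logDeriv (F t) z) (𝓝 t₀)
      (𝓝 ((2 * Real.pi * I : ℂ)⁻¹ * ∮ z in C(c, r), logDeriv (F t₀) z)) := hat.const_mul _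
  rw [circleIntegral_logDeriv (hF t₀) hr hne hS₀, inv_mul_cancel_left₀ h2] at hat'
  filter_upwards [hU, Metric.tendsto_nhds.1 hat' 1 one_pos] with t ht hdist S hS
  rw [circleIntegral_logDeriv (hF t) hr ht hS, inv_mul_cancel_left₀ h2, dist_eq_norm] at hdist
  have h3 : (∑ w ∈ S, (analyticOrderNatAt (F t) w : ℂ)) -
      ∑ w ∈ S₀, (analyticOrderNatAt (F t₀) w : ℂ) =
      ((((∑ w ∈ S, analyticOrderNatAt (F t) w : ℕ) : ℤ) -
        ((∑ w ∈ S₀, analyticOrderNatAt (F t₀) w : ℕ) : ℤ) : ℤ) : ℂ) := by push_cast; rfl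
  rw [h3, Complex.norm_intCast] at hdist
  -- The zero count is an integer and, as a normalised contour integral, continuous in `t`; two
  -- integers at distance less than one coincide.
  have h4 : |((∑ w ∈ S, analyticOrderNatAt (F t) w : ℕ) : ℤ) -
      ((∑ w ∈ S₀, analyticOrderNatAt (F t₀) w : ℕ) : ℤ)| < 1 := by exact_mod_cast hdist
  have := Int.abs_lt_one_iff.1 h4
  omega

/-- Small disjoint discs isolate the zeros of `F t₀` in the support of `φ`. Inside each disc Hurwitz
preserves the number of zeros while `φ` varies by less than `η`; on the rest of the support there
are no zeros for nearby `t`. -/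
theorem continuousAt_zeroSum (hF : ∀ t, Differentiable ℂ (F t))
    (hc : Continuous (Function.uncurry F))
    (hd : Continuous (Function.uncurry fun t => deriv (F t))) {t₀ : T} (h0 : ∃ z, F t₀ z ≠ 0)
    {φ : ℂ → ℂ} (hφ : Continuous φ) (hφc : HasCompactSupport φ) :
    ContinuousAt (fun t => zeroSum (F t) φ) t₀ := by
  classical
  set K := tsupport φ
  have hK : IsCompact K := hφc
  set Z₀ : Finset ℂ := (finite_zeros_of_isCompact (hF t₀) h0 hK).toFinset
  have hZ₀ : ∀ z, z ∈ Z₀ ↔ z ∈ K ∧ F t₀ z = 0 := by simp [Z₀]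
  set N : ℝ := ∑ w ∈ Z₀, (analyticOrderNatAt (F t₀) w : ℝ)
  have hN : 0 ≤ N := Finset.sum_nonneg fun _ _ => Nat.cast_nonneg _
  rw [ContinuousAt, Metric.tendsto_nhds]
  intro ε hε
  -- The total error is at most `N * η`; the `+ 1` allows for `N = 0` and makes the final inequality
  -- strict.
  set η := ε / (N + 1)
  have hη : 0 < η := by positivity
  -- a radius that isolates the zeros of `F t₀` in `K`
  have hiso : ∀ w ∈ Z₀, ∀ᶠ r in 𝓝[>] (0 : ℝ), ∀ z ∈ Metric.closedBall w r,
      (z ≠ w → F t₀ z ≠ 0) ∧ dist (φ z) (φ w) < η := by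
    intro w hw
    have h1 : ∀ᶠ z in 𝓝 w, z ≠ w → F t₀ z ≠ 0 := by
      rcases ((hF t₀).analyticAt w).eventually_eq_zero_or_eventually_ne_zero with h | h
      · exact absurd (analyticOrderAt_eq_top.2 h) (analyticOrderAt_ne_top_of_entire (hF t₀) h0 w)
      · exact eventually_nhdsWithin_iff.1 h
    have h2 := (h1.and (Metric.tendsto_nhds.1 (hφ.tendsto w) η hη))
    obtain ⟨δ, hδ, hball⟩ := Metric.eventually_nhds_iff_ball.1 h2
    filter_upwards [Ioo_mem_nhdsGT hδ] with r hr z hz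
    exact hball z (Metric.closedBall_subset_ball hr.2 hz)
  have hdisj : ∀ w ∈ Z₀, ∀ w' ∈ Z₀, ∀ᶠ r in 𝓝[>] (0 : ℝ), w ≠ w' → 2 * r < dist w w' := by
    intro w _ w' _
    by_cases hww : w = w'
    · simp [hww]
    · have : 0 < dist w w' := dist_pos.2 hww
      filter_upwards [Ioo_mem_nhdsGT (half_pos this)] with r hr _
      linarith [hr.2]
  obtain ⟨r, ⟨hr1, hr2⟩, hr : 0 < r⟩ :=
    (((Z₀.eventually_all.2 hiso).and (Z₀.eventually_all.2 fun w hw =>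
      Z₀.eventually_all.2 (hdisj w hw))).and self_mem_nhdsWithin).exists
  have hsph : ∀ w ∈ Z₀, ∀ z ∈ Metric.sphere w r, F t₀ z ≠ 0 := by
    intro w hw z hz
    refine (hr1 w hw z (Metric.sphere_subset_closedBall hz)).1 fun h => ?_
    rw [h, Metric.mem_sphere, dist_self] at hz
    exact hr.ne hz
  have hcount : ∀ w ∈ Z₀, ∀ᶠ t in 𝓝 t₀, ∀ S : Finset ℂ,
      (∀ z, z ∈ S ↔ z ∈ Metric.ball w r ∧ F t z = 0) →
      ∑ z ∈ S, analyticOrderNatAt (F t) z = analyticOrderNatAt (F t₀) w := by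
    intro w hw
    have h := eventually_sum_order_eq (S₀ := {w}) hF hc hd hr (hsph w hw) (fun z => by
      rw [Finset.mem_singleton]
      constructor
      · rintro rfl
        exact ⟨Metric.mem_ball_self hr, ((hZ₀ z).1 hw).2⟩
      · rintro ⟨h1, h2⟩
        by_contra hne
        exact (hr1 w hw z (Metric.ball_subset_closedBall h1)).1 hne h2)
    simpa using h
  have hK' : IsCompact (K \ ⋃ w ∈ Z₀, Metric.ball w r) :=
    hK.diff (isOpen_biUnion fun _ _ => Metric.isOpen_ball)
  have hout : ∀ᶠ t in 𝓝 t₀, ∀ z ∈ K \ ⋃ w ∈ Z₀, Metric.ball w r, F t z ≠ 0 := by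
    refine eventually_forall_ne_zero hc hK' fun z hz h => hz.2 ?_
    exact Set.mem_biUnion (x := z) ((hZ₀ z).2 ⟨hz.1, h⟩) (Metric.mem_ball_self hr)
  have hnz : ∀ᶠ t in 𝓝 t₀, ∃ z, F t z ≠ 0 := by
    obtain ⟨z, hz⟩ := h0
    have := eventually_forall_ne_zero hc (isCompact_singleton (x := z)) (t₀ := t₀) (by simpa)
    filter_upwards [this] with t ht using ⟨z, ht z rfl⟩
  have hval₀ : zeroSum (F t₀) φ = ∑ w ∈ Z₀, (analyticOrderNatAt (F t₀) w : ℂ) * φ w :=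
    zeroSum_eq_sum (hF t₀) fun z hz hφz => (hZ₀ z).2 ⟨subset_tsupport _ hφz, hz⟩
  filter_upwards [Z₀.eventually_all.2 hcount, hout, hnz] with t h1 h2 h3
  set B : ℂ → Finset ℂ := fun w =>
    ((finite_zeros_of_isCompact (hF t) h3 (isCompact_closedBall w r)).toFinset).filter
      (· ∈ Metric.ball w r)
  have hB : ∀ w z, z ∈ B w ↔ z ∈ Metric.ball w r ∧ F t z = 0 := by
    intro w z
    simp only [B, Finset.mem_filter, Set.Finite.mem_toFinset, Set.mem_ofPred_eq]
    exact ⟨fun h => ⟨h.2, h.1.2⟩, fun h => ⟨⟨Metric.ball_subset_closedBall h.1, h.2⟩, h.1⟩⟩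
  have hval : zeroSum (F t) φ =
      ∑ w ∈ Z₀, ∑ z ∈ B w, (analyticOrderNatAt (F t) z : ℂ) * φ z := by
    rw [← Finset.sum_biUnion]
    · refine zeroSum_eq_sum (hF t) fun z hz hφz => ?_
      by_contra hnot
      refine h2 z ⟨subset_tsupport _ hφz, fun hmem => hnot ?_⟩ hz
      obtain ⟨w, hw, hzw⟩ := Set.mem_iUnion₂.1 hmem
      exact Finset.mem_biUnion.2 ⟨w, hw, (hB w z).2 ⟨hzw, hz⟩⟩
    · intro w hw w' hw' hww
      refine Finset.disjoint_left.2 fun z hz hz' => ?_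
      have a1 := Metric.mem_ball.1 ((hB w z).1 hz).1
      have a2 := Metric.mem_ball.1 ((hB w' z).1 hz').1
      have a3 := hr2 w hw w' hw' hww
      have a4 := dist_triangle_left w w' z
      linarith
  rw [hval, hval₀, dist_eq_norm, ← Finset.sum_sub_distrib]
  have hterm : ∀ w ∈ Z₀, ‖(∑ z ∈ B w, (analyticOrderNatAt (F t) z : ℂ) * φ z) -
      (analyticOrderNatAt (F t₀) w : ℂ) * φ w‖ ≤ (analyticOrderNatAt (F t₀) w : ℝ) * η := by
    intro w hw
    rw [← h1 w hw (B w) (hB w)]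
    push_cast
    rw [Finset.sum_mul, ← Finset.sum_sub_distrib, Finset.sum_mul]
    refine (norm_sum_le _ _).trans (Finset.sum_le_sum fun z hz => ?_)
    rw [← mul_sub, norm_mul, Complex.norm_natCast, ← dist_eq_norm]
    exact mul_le_mul_of_nonneg_left
      (hr1 w hw z (Metric.ball_subset_closedBall ((hB w z).1 hz).1)).2.le (Nat.cast_nonneg _)
  calc _ ≤ ∑ w ∈ Z₀, (analyticOrderNatAt (F t₀) w : ℝ) * η :=
        (norm_sum_le _ _).trans (Finset.sum_le_sum hterm)
    _ = N * η := by rw [Finset.sum_mul]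
    _ < (N + 1) * η := by linarith
    _ = ε := by simp only [η]; field_simp

end ZeroSum

end

noncomputable section

/-! ### Dirichlet series with bounded spectrum -/

section Dirichlet

open Complex

variable {W : Type*} {lam : W → ℝ} {q : W → ℂ} {B : ℝ}

/-- The Dirichlet series with frequencies `lam` and coefficients `q`. -/
def dirichletSum (lam : W → ℝ) (q : W → ℂ) (z : ℂ) : ℂ :=
  ∑' w, q w * exp (2 * Real.pi * I * (lam w : ℂ) * z)

lemma norm_exp_two_pi_I_mul (t : ℝ) (z : ℂ) :
    ‖exp (2 * Real.pi * I * (t : ℂ) * z)‖ = Real.exp (-(2 * Real.pi * t * z.im)) := by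
  rw [norm_exp]
  congr 1
  rw [show (2 * Real.pi * I * (t : ℂ) * z : ℂ) = ((2 * Real.pi * t : ℝ) : ℂ) * (I * z) by
    push_cast; ring, re_ofReal_mul]
  simp

lemma norm_exp_le_of_abs_le {t R : ℝ} (ht : |t| ≤ B) {z : ℂ} (hz : |z.im| ≤ R) :
    ‖exp (2 * Real.pi * I * (t : ℂ) * z)‖ ≤ Real.exp (2 * Real.pi * (B * R)) := by
  rw [norm_exp_two_pi_I_mul, Real.exp_le_exp]
  have h1 : |t * z.im| ≤ B * R := by
    rw [abs_mul]
    exact mul_le_mul ht hz (abs_nonneg _) ((abs_nonneg _).trans ht)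
  have h2 := neg_abs_le (t * z.im)
  have := Real.pi_pos
  nlinarith

lemma summable_dirichlet (hb : ∀ w, |lam w| ≤ B) (hq : Summable fun w => ‖q w‖) (z : ℂ) :
    Summable fun w => q w * exp (2 * Real.pi * I * (lam w : ℂ) * z) := by
  refine Summable.of_norm_bounded (hq.mul_right (Real.exp (2 * Real.pi * (B * |z.im|)))) fun w => ?_
  rw [norm_mul]
  exact mul_le_mul_of_nonneg_left (norm_exp_le_of_abs_le (hb w) le_rfl) (norm_nonneg _)

/-- Each term depends on one coordinate of `u` only, hence is continuous for the product topology. A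
bound uniform in `u` holds on every horizontal strip because the frequencies are bounded, and the
M-test applies. -/
lemma continuous_uncurry_dirichletSum (hb : ∀ w, |lam w| ≤ B) (hq : Summable fun w => ‖q w‖) :
    Continuous fun p : (W → Circle) × ℂ => dirichletSum lam (fun w => q w * p.1 w) p.2 := by
  rw [continuous_iff_continuousAt]
  rintro ⟨u, z⟩
  have hopen : IsOpen {p : (W → Circle) × ℂ | |p.2.im| < |z.im| + 1} :=
    isOpen_lt (by fun_prop) continuous_const
  refine ContinuousOn.continuousAt (s := {p | |p.2.im| < |z.im| + 1}) ?_
    (hopen.mem_nhds (by simp))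
  refine continuousOn_tsum (u := fun w => ‖q w‖ * Real.exp (2 * Real.pi * (B * (|z.im| + 1))))
    (fun w => ?_) (hq.mul_right _) fun w p hp => ?_
  · refine Continuous.continuousOn ?_
    have : Continuous fun p : (W → Circle) × ℂ => ((p.1 w : Circle) : ℂ) :=
      (continuous_subtype_val : Continuous fun c : Circle => (c : ℂ)).comp ((continuous_apply w).comp continuous_fst)
    fun_prop
  · rw [norm_mul, norm_mul, Circle.norm_coe, mul_one]
    exact mul_le_mul_of_nonneg_left (norm_exp_le_of_abs_le (hb w) (le_of_lt hp)) (norm_nonneg _)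

lemma isOpen_abs_im_lt (R : ℝ) : IsOpen {z : ℂ | |z.im| < R} :=
  isOpen_lt (by fun_prop) continuous_const

lemma differentiable_dirichletSum (hb : ∀ w, |lam w| ≤ B) (hq : Summable fun w => ‖q w‖) :
    Differentiable ℂ (dirichletSum lam q) := by
  intro z
  refine (differentiableOn_tsum_of_summable_norm (U := {w : ℂ | |w.im| < |z.im| + 1})
    (u := fun w => ‖q w‖ * Real.exp (2 * Real.pi * (B * (|z.im| + 1))))
    (hq.mul_right _) (fun w => by fun_prop) (isOpen_abs_im_lt _)
    fun w p hp => ?_).differentiableAt ((isOpen_abs_im_lt _).mem_nhds (by simp))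
  rw [norm_mul]
  exact mul_le_mul_of_nonneg_left (norm_exp_le_of_abs_le (hb w) (le_of_lt hp)) (norm_nonneg _)

lemma deriv_exp_two_pi_I_mul (c : ℂ) (t : ℝ) (z : ℂ) :
    deriv (fun z => c * exp (2 * Real.pi * I * (t : ℂ) * z)) z =
      2 * Real.pi * I * (t : ℂ) * c * exp (2 * Real.pi * I * (t : ℂ) * z) := by
  have h : HasDerivAt (fun z : ℂ => c * exp (2 * Real.pi * I * (t : ℂ) * z))
      (c * (exp (2 * Real.pi * I * (t : ℂ) * z) * (2 * Real.pi * I * (t : ℂ) * 1))) z :=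
    (((hasDerivAt_id z).const_mul _).cexp).const_mul c
  rw [h.deriv]; ring

lemma deriv_dirichletSum (hb : ∀ w, |lam w| ≤ B) (hq : Summable fun w => ‖q w‖) :
    deriv (dirichletSum lam q) =
      dirichletSum lam fun w => 2 * Real.pi * I * (lam w : ℂ) * q w := by
  ext z
  have := hasSum_deriv_of_summable_norm (U := {w : ℂ | |w.im| < |z.im| + 1})
    (F := fun w z => q w * exp (2 * Real.pi * I * (lam w : ℂ) * z))
    (u := fun w => ‖q w‖ * Real.exp (2 * Real.pi * (B * (|z.im| + 1)))) (z := z)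
    (hq.mul_right _) (fun w => by fun_prop) (isOpen_abs_im_lt _)
    (fun w p hp => by
      rw [norm_mul]
      exact mul_le_mul_of_nonneg_left (norm_exp_le_of_abs_le (hb w) (le_of_lt hp)) (norm_nonneg _))
    (by simp)
  refine this.tsum_eq.symm.trans ?_
  simp only [deriv_exp_two_pi_I_mul]
  rfl

lemma summable_norm_freq_mul (hb : ∀ w, |lam w| ≤ B) (hq : Summable fun w => ‖q w‖) :
    Summable fun w => ‖2 * Real.pi * I * (lam w : ℂ) * q w‖ := by
  refine Summable.of_nonneg_of_le (fun _ => norm_nonneg _) (fun w => ?_)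
    (hq.mul_left (2 * Real.pi * B))
  have : ‖(2 * Real.pi * I * (lam w : ℂ) : ℂ)‖ = 2 * Real.pi * |lam w| := by
    simp [abs_of_pos Real.pi_pos]
  rw [norm_mul, this]
  gcongr
  exact hb w

/-- The character `x ↦ (e^{2πiλx})_λ` into the torus. -/
def torusLine (lam : W → ℝ) (x : ℝ) : W → Circle := fun w => Circle.exp (2 * Real.pi * lam w * x)

lemma continuous_torusLine : Continuous (torusLine lam) := by
  refine continuous_pi fun w => ?_
  unfold torusLine
  fun_prop

lemma torusLine_add (x y : ℝ) : torusLine lam (x + y) = torusLine lam x * torusLine lam y := by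
  ext w
  simp [torusLine, mul_add, Circle.exp_add]

lemma coe_torusLine (x : ℝ) (w : W) :
    (torusLine lam x w : ℂ) = exp (2 * Real.pi * I * (lam w : ℂ) * x) := by
  simp only [torusLine, Circle.coe_exp]
  congr 1
  push_cast; ring

/-- This identity is what brings in the compact torus: the real translates of a series form an orbit
of coefficient twists. -/
lemma dirichletSum_torusLine (x : ℝ) (z : ℂ) :
    dirichletSum lam (fun w => q w * torusLine lam x w) z = dirichletSum lam q (x + z) := by
  unfold dirichletSum
  refine tsum_congr fun w => ?_
  beta_reduce
  rw [coe_torusLine, mul_assoc, ← exp_add]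
  ring_nf

lemma summable_norm_mul_circle (hq : Summable fun w => ‖q w‖) (u : W → Circle) :
    Summable fun w => ‖q w * u w‖ := by
  simpa only [norm_mul, Circle.norm_coe, mul_one] using hq

/-- A coefficient of a Dirichlet series is bounded by the supremum of its modulus on `ℝ`. -/
lemma norm_coeff_le_of_norm_dirichletSum_le [Countable W] (hlam : Function.Injective lam)
    (hq : Summable fun w => ‖q w‖) {M : ℝ} (hM : ∀ x : ℝ, ‖dirichletSum lam q x‖ ≤ M) (v : W) :
    ‖q v‖ ≤ M := by
  classical
  -- `m w T` is the mean over `[0, T]` of the character of frequency `lam w - lam v`. It tends to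
  -- `1` for `w = v` and to `0` otherwise, so the mean of the series against `e^{-2πi lam v x}`
  -- tends to `q v`.
  set m : W → ℝ → ℂ := fun w T => (T : ℂ)⁻¹ * ∫ x in (0 : ℝ)..T,
    exp (2 * Real.pi * I * ((lam w - lam v : ℝ) : ℂ) * x)
  have hunit : ∀ (t x : ℝ), ‖exp (2 * Real.pi * I * (t : ℂ) * x)‖ = 1 := fun t x => by
    simp [norm_exp_two_pi_I_mul]
  have hm1 : ∀ w, ∀ T : ℝ, 0 < T → ‖m w T‖ ≤ 1 := by
    intro w T hT
    have := intervalIntegral.norm_integral_le_of_norm_le_const (a := 0) (b := T)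
      (f := fun x : ℝ => exp (2 * Real.pi * I * ((lam w - lam v : ℝ) : ℂ) * x)) (C := 1)
      fun x _ => (hunit _ x).le
    simp only [m, norm_mul, norm_inv, norm_real, Real.norm_eq_abs, abs_of_pos hT]
    rw [sub_zero, abs_of_pos hT, one_mul] at this
    calc T⁻¹ * _ ≤ T⁻¹ * T := by gcongr
      _ = 1 := inv_mul_cancel₀ hT.ne'
  have hlim : ∀ w, Tendsto (fun T => q w * m w T) atTop (𝓝 (q w * if w = v then 1 else 0)) := by
    intro w
    refine Tendsto.const_mul _ ?_
    by_cases hwv : w = v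
    · subst hwv
      refine Tendsto.congr' ?_ tendsto_const_nhds
      filter_upwards [eventually_gt_atTop 0] with T hT
      have : (T : ℂ) ≠ 0 := ofReal_ne_zero.2 hT.ne'
      simp [m, this]
    · have hne : lam w - lam v ≠ 0 := sub_ne_zero.2 fun h => hwv (hlam h)
      have hc : (2 * Real.pi * I * ((lam w - lam v : ℝ) : ℂ)) ≠ 0 :=
        mul_ne_zero Complex.two_pi_I_ne_zero (ofReal_ne_zero.2 hne)
      simp only [hwv, if_false]
      refine squeeze_zero_norm' (a := fun T : ℝ =>
        T⁻¹ * (2 / ‖(2 * Real.pi * I * ((lam w - lam v : ℝ) : ℂ))‖)) ?_ ?_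
      · filter_upwards [eventually_gt_atTop 0] with T hT
        simp only [m]
        rw [integral_exp_mul_complex hc, norm_mul, norm_div, norm_inv, norm_real,
          Real.norm_eq_abs, abs_of_pos hT]
        gcongr
        refine (norm_sub_le _ _).trans ?_
        rw [hunit, hunit]; norm_num
      · simpa using tendsto_inv_atTop_zero.mul_const
          (2 / ‖(2 * Real.pi * I * ((lam w - lam v : ℝ) : ℂ))‖)
  have hsum : Tendsto (fun T => ∑' w, q w * m w T) atTop
      (𝓝 (∑' w, q w * if w = v then 1 else 0)) := by
    refine tendsto_tsum_of_dominated_convergence hq hlim ?_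
    filter_upwards [eventually_gt_atTop 0] with T hT w
    rw [norm_mul]
    exact mul_le_of_le_one_right (norm_nonneg _) (hm1 w T hT)
  have hval : (∑' w, q w * if w = v then (1 : ℂ) else 0) = q v := by
    rw [tsum_eq_single v fun w hw => by simp [hw]]
    simp
  rw [hval] at hsum
  refine le_of_tendsto hsum.norm ?_
  filter_upwards [eventually_gt_atTop 0] with T hT
  have hswap : ∑' w, q w * m w T = (T : ℂ)⁻¹ * ∫ x in (0 : ℝ)..T,
      exp (2 * Real.pi * I * ((-lam v : ℝ) : ℂ) * x) * dirichletSum lam q x := by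
    have hS : HasSum (fun w => ∫ x in (0 : ℝ)..T,
        q w * exp (2 * Real.pi * I * ((lam w - lam v : ℝ) : ℂ) * x))
        (∫ x in (0 : ℝ)..T,
          exp (2 * Real.pi * I * ((-lam v : ℝ) : ℂ) * x) * dirichletSum lam q x) := by
      refine intervalIntegral.hasSum_integral_of_dominated_convergence (fun w _ => ‖q w‖)
        (fun w => Continuous.aestronglyMeasurable (by fun_prop)) (fun w => ?_) ?_ ?_ ?_
      · exact Eventually.of_forall fun x _ => by rw [norm_mul, hunit, mul_one]
      · exact Eventually.of_forall fun _ _ => hq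
      · exact intervalIntegrable_const
      · refine Eventually.of_forall fun x _ => ?_
        have h1 : Summable fun w => q w * exp (2 * Real.pi * I * (lam w : ℂ) * (x : ℂ)) :=
          Summable.of_norm (by simpa only [norm_mul, hunit, mul_one] using hq)
        have h2 := h1.hasSum.mul_left (exp (2 * Real.pi * I * ((-lam v : ℝ) : ℂ) * x))
        have h3 : ∀ w, exp (2 * Real.pi * I * ((-lam v : ℝ) : ℂ) * x) *
            (q w * exp (2 * Real.pi * I * (lam w : ℂ) * (x : ℂ))) =
            q w * exp (2 * Real.pi * I * ((lam w - lam v : ℝ) : ℂ) * x) := fun w => by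
          rw [mul_left_comm, ← exp_add]
          congr 2
          push_cast; ring
        simp only [h3] at h2
        exact h2
    rw [← hS.tsum_eq, ← tsum_mul_left]
    refine tsum_congr fun w => ?_
    rw [intervalIntegral.integral_const_mul]
    ring
  rw [hswap, norm_mul, norm_inv, norm_real, Real.norm_eq_abs, abs_of_pos hT]
  have := intervalIntegral.norm_integral_le_of_norm_le_const (a := 0) (b := T)
      (f := fun x : ℝ => exp (2 * Real.pi * I * ((-lam v : ℝ) : ℂ) * x) * dirichletSum lam q x)
      (C := M) fun x _ => by rw [norm_mul, hunit, one_mul]; exact hM x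
  rw [sub_zero, abs_of_pos hT] at this
  calc T⁻¹ * _ ≤ T⁻¹ * (M * T) := by gcongr
    _ = M := by field_simp

/-- It is applied to every twist by a point of the torus, so that the zeros of limits of translates
are also isolated. -/
lemma exists_dirichletSum_ne_zero [Countable W] (hlam : Function.Injective lam)
    (hq : Summable fun w => ‖q w‖) {v : W} (hv : q v ≠ 0) : ∃ z, dirichletSum lam q z ≠ 0 := by
  by_contra! h
  have := norm_coeff_le_of_norm_dirichletSum_le hlam hq (M := 0) (fun x => by simp [h]) v
  exact hv (norm_le_zero_iff.1 this)

end Dirichlet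

/-! ### Almost periodicity from a one-parameter subgroup of a compact group -/

section AlmostPeriodic

variable {G : Type*} [Group G] [TopologicalSpace G] [IsTopologicalGroup G] [CompactSpace G]

/-- Finitely many translates `e t * U`, with `|t| ≤ M`, cover the compact closure of the orbit. Each
point of the orbit is therefore brought back to `U` by a time shift of size at most `M`. -/
lemma isRelativelyDense_preimage_nhds_one {e : ℝ → G} (he : ∀ x y, e (x + y) = e x * e y)
    {V : Set G} (hV : V ∈ 𝓝 1) : IsRelativelyDense {τ | e τ ∈ V} := by
  obtain ⟨U, hUV, hU, h1U⟩ := mem_nhds_iff.1 hV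
  have he0 : e 0 = 1 := by
    have := he 0 0
    rw [add_zero] at this
    exact (mul_eq_left.1 this.symm)
  have hneg : ∀ t, e (-t) = (e t)⁻¹ := fun t => by
    rw [eq_inv_iff_mul_eq_one, ← he, neg_add_cancel, he0]
  have hC : IsCompact (closure (Set.range e)) := isClosed_closure.isCompact
  obtain ⟨F, hF⟩ := hC.elim_finite_subcover (fun t : ℝ => {g : G | (e t)⁻¹ * g ∈ U})
    (fun t => hU.preimage (by fun_prop)) (by
      intro g hg
      have hopen : IsOpen {h : G | h⁻¹ * g ∈ U} := hU.preimage (by fun_prop)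
      obtain ⟨_, hh, ⟨t, rfl⟩⟩ := mem_closure_iff.1 hg _ hopen (by simpa using h1U)
      exact Set.mem_iUnion.2 ⟨t, hh⟩)
  obtain ⟨M, hM⟩ := (F.finite_toSet.image fun t => |t|).bddAbove
  -- The search starts at `s + M + 1`, the middle of the interval; a shift by at most `M` stays
  -- strictly inside it.
  refine ⟨2 * M + 2, fun s => ?_⟩
  have hs : e (s + M + 1) ∈ closure (Set.range e) := subset_closure ⟨_, rfl⟩
  obtain ⟨t, ht, htU⟩ := Set.mem_iUnion₂.1 (hF hs)
  have htM : |t| ≤ M := hM ⟨t, ht, rfl⟩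
  have := abs_le.1 htM
  refine ⟨-t + (s + M + 1), hUV ?_, by constructor <;> linarith⟩
  rw [he, hneg]
  exact htU

lemma isAlmostPeriodicFun_of_compact_group {e : ℝ → G} (he : ∀ x y, e (x + y) = e x * e y)
    (hec : Continuous e) {Φ : G × ℝ → ℂ} (hΦ : Continuous Φ) :
    IsAlmostPeriodicFun fun z => Φ (e z.re, z.im) := by
  refine ⟨by fun_prop, fun α β _ ε hε => ?_⟩
  -- The tube lemma at `1 ∈ G` gives a neighbourhood that works for all of `G × [α, β]` at once. The
  -- margin `ε / 2` leaves room for a uniform bound strictly below `ε`.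
  have hopen : IsOpen {p : G × (G × ℝ) | ‖Φ (p.2.1 * p.1, p.2.2) - Φ p.2‖ < ε / 2} :=
    isOpen_lt (by fun_prop) continuous_const
  obtain ⟨u, v, hu, -, h1u, hv, huv⟩ := generalized_tube_lemma (isCompact_singleton (x := (1 : G)))
    ((isCompact_univ (X := G)).prod (isCompact_Icc (a := α) (b := β))) hopen (by
      rintro ⟨g, p⟩ ⟨hg, -⟩
      simp only [Set.mem_singleton_iff] at hg
      subst hg
      simpa using hε)
  obtain ⟨L, hL⟩ := isRelativelyDense_preimage_nhds_one he (hu.mem_nhds (h1u rfl))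
  refine ⟨L, fun t => (hL t).mono ?_⟩
  rintro τ ⟨hτ, hτI⟩
  refine ⟨⟨ε / 2, half_lt_self hε, fun z hz1 hz2 => ?_⟩, hτI⟩
  have := huv (Set.mk_mem_prod hτ (hv (Set.mk_mem_prod (Set.mem_univ (e z.re))
    (Set.mem_Icc.2 ⟨hz1, hz2⟩))))
  simp only [Set.mem_ofPred_eq] at this
  simpa [he] using this.le

end AlmostPeriodic

end

noncomputable section

/-! ### The lowest frequency of a series without zeros in a half-plane -/

section HalfPlane

open Complex

/-- Harnack's inequality in the right half-plane for `-log ‖p‖`. -/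
lemma neg_log_norm_mul_le {p : ℂ → ℂ} (hp : Differentiable ℂ p)
    (hp0 : ∀ w : ℂ, 0 ≤ w.re → p w ≠ 0) (hp1 : ∀ w : ℂ, 0 ≤ w.re → ‖p w‖ ≤ 1)
    {x R : ℝ} (hx : 0 < x) (hxR : x ≤ R) (t : ℝ) :
    -Real.log ‖p (R + t * I)‖ * x ≤ 2 * R * -Real.log ‖p (x + t * I)‖ := by
  have hR : 0 < R := hx.trans_le hxR
  -- The disc of radius `R` about `c` touches the imaginary axis and stays in the closed half-plane,
  -- where `-log ‖p‖` is harmonic and nonnegative.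
  set c : ℂ := R + t * I
  set w : ℂ := x + t * I
  set v : ℂ → ℝ := fun z => -Real.log ‖p z‖
  have hre : ∀ z ∈ Metric.closedBall c R, 0 ≤ z.re := by
    intro z hz
    have h1 := (abs_re_le_norm (z - c)).trans (mem_closedBall_iff_norm.1 hz)
    have h2 := (abs_le.1 h1).1
    simp [c] at h2
    exact h2
  have hharm : InnerProductSpace.HarmonicOnNhd v (Metric.closedBall c R) := fun z hz =>
    ((hp.analyticAt z).harmonicAt_log_norm (hp0 z (hre z hz))).neg
  have hv : ∀ z ∈ Metric.closedBall c R, 0 ≤ v z := fun z hz =>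
    neg_nonneg.2 (Real.log_nonpos (norm_nonneg _) (hp1 z (hre z hz)))
  have hwc : ‖w - c‖ = R - x := by
    have : w - c = -((R - x : ℝ) : ℂ) := by simp [w, c]
    rw [this, norm_neg, norm_real, Real.norm_eq_abs, abs_of_nonneg (by linarith)]
  have hw : w ∈ Metric.ball c R := by
    rw [mem_ball_iff_norm, hwc]; linarith
  have hcv : ContinuousOn v (Metric.closedBall c R) := fun z hz =>
    ((hp.continuous.norm.continuousAt).log
      (norm_ne_zero_iff.2 (hp0 z (hre z hz)))).neg.continuousWithinAt
  have hcs : ContinuousOn v (Metric.sphere c R) := hcv.mono Metric.sphere_subset_closedBall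
  have h1 := hharm.circleAverage_poissonKernel_smul hw
  have h2 : Real.circleAverage v c R = v c :=
    InnerProductSpace.HarmonicOnNhd.circleAverage_eq (by rwa [abs_of_pos hR])
  -- The minimum of the Poisson kernel is `(R - ρ) / (R + ρ)` with `ρ = ‖w - c‖ = R - x`.
  have hker : ∀ z ∈ Metric.sphere c R, x / (2 * R - x) ≤ poissonKernel c w z := by
    intro z hz
    have := le_re_herglotzRieszKernel hz hw
    rw [hwc] at this
    rw [poissonKernel_eq_re_herglotzRieszKernel]
    refine le_trans (le_of_eq ?_) (this.trans_eq ?_)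
    · ring
    · simp [herglotzRieszKernel_def]
  have h3 : Real.circleAverage (fun z => (x / (2 * R - x)) • v z) c R ≤
      Real.circleAverage (poissonKernel c w • v) c R := by
    refine Real.circleAverage_mono ?_ ?_ fun z hz => ?_
    · refine ContinuousOn.circleIntegrable hR.le ?_
      exact continuousOn_const.mul hcs
    · refine ContinuousOn.circleIntegrable hR.le (ContinuousOn.smul ?_ hcs)
      rw [poissonKernel_eq_re_herglotzRieszKernel]
      have := continuousOn_herglotzRieszKernel_sphere hw
      rw [abs_of_pos hR] at this
      exact continuous_re.comp_continuousOn this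
    · rw [abs_of_pos hR] at hz
      exact mul_le_mul_of_nonneg_right (hker z hz) (hv z (Metric.sphere_subset_closedBall hz))
  rw [h1, Real.circleAverage_fun_smul, h2, smul_eq_mul] at h3
  have hvc : 0 ≤ v c := hv c (Metric.mem_closedBall_self hR.le)
  have h4 : x / (2 * R) * v c ≤ v w := by
    refine le_trans (mul_le_mul_of_nonneg_right ?_ hvc) h3
    exact div_le_div_of_nonneg_left hx.le (by linarith) (by linarith)
  have h5 := mul_le_mul_of_nonneg_left h4 (by positivity : 0 ≤ 2 * R)
  calc v c * x = 2 * R * (x / (2 * R) * v c) := by field_simp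
    _ ≤ _ := h5

/-- A zero-free function bounded by `1` in the right half-plane and bounded away from zero near its
boundary either decays exponentially or is bounded away from zero. -/
lemma exp_decay_or_norm_ge {p : ℂ → ℂ} (hp : Differentiable ℂ p)
    (hp0 : ∀ w : ℂ, 0 ≤ w.re → p w ≠ 0) (hp1 : ∀ w : ℂ, 0 ≤ w.re → ‖p w‖ ≤ 1) {c : ℝ} (hc : 0 < c)
    (hpc : ∀ w : ℂ, 0 ≤ w.re → w.re ≤ 1 → c ≤ ‖p w‖) :
    (∃ η > 0, ∀ w : ℂ, 0 ≤ w.re → ‖p w‖ ≤ Real.exp (-(η * w.re))) ∨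
      ∀ w : ℂ, 0 ≤ w.re → c ≤ ‖p w‖ := by
  have hpos : ∀ w : ℂ, 0 ≤ w.re → 0 < ‖p w‖ := fun w hw => norm_pos_iff.2 (hp0 w hw)
  -- The dichotomy is whether `-log ‖p‖` grows at least linearly along a sequence on the positive
  -- ray. The factor `2` cancels the one in Harnack's inequality, which carries the decay from large
  -- `R` down to every `x`; Phragmén–Lindelöf then spreads it over the half-plane.
  by_cases hcase : ∃ η > 0, ∃ᶠ R : ℝ in atTop, 2 * η * R ≤ -Real.log ‖p R‖
  · obtain ⟨η, hη, hfreq⟩ := hcase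
    left
    refine ⟨η, hη, ?_⟩
    have hray : ∀ x : ℝ, 0 < x → ‖p x‖ ≤ Real.exp (-(η * x)) := by
      intro x hx
      obtain ⟨R, hR, hxR⟩ := (hfreq.and_eventually (eventually_ge_atTop x)).exists
      have h := neg_log_norm_mul_le hp hp0 hp1 hx hxR 0
      simp only [ofReal_zero, zero_mul, add_zero] at h
      have hR0 : 0 < R := hx.trans_le hxR
      have h1 : 2 * R * (η * x) ≤ 2 * R * -Real.log ‖p x‖ :=
        le_trans (by nlinarith) h
      have h2 := le_of_mul_le_mul_left h1 (by positivity)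
      rw [← Real.log_le_iff_le_exp (hpos _ (by simpa using hx.le))]
      linarith
    intro w hw
    have hnorm : ∀ w : ℂ, ‖p w * exp (η * w)‖ = ‖p w‖ * Real.exp (η * w.re) := fun w => by
      rw [norm_mul, norm_exp, re_ofReal_mul]
    have := PhragmenLindelof.right_half_plane_of_bounded_on_real (C := 1) (z := w)
      (f := fun w => p w * exp (η * w)) (Differentiable.diffContOnCl (by fun_prop))
      ⟨1, by norm_num, η, ?_⟩ ?_ ?_ hw
    · rw [hnorm] at this
      rw [Real.exp_neg]
      rwa [← one_div, le_div_iff₀ (Real.exp_pos _)]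
    · refine Asymptotics.IsBigO.of_bound 1 (eventually_inf_principal.2 (Eventually.of_forall
        fun z (hz : 0 < z.re) => ?_))
      rw [hnorm, Real.rpow_one, one_mul, Real.norm_of_nonneg (Real.exp_pos _).le]
      calc ‖p z‖ * Real.exp (η * z.re) ≤ 1 * Real.exp (η * ‖z‖) := by
            gcongr
            · exact hp1 z hz.le
            · exact re_le_norm z
        _ = _ := one_mul _
    · refine ⟨1, ?_⟩
      rw [eventually_map]
      filter_upwards [eventually_gt_atTop 0] with x hx
      rw [hnorm, ofReal_re]
      calc ‖p x‖ * Real.exp (η * x) ≤ Real.exp (-(η * x)) * Real.exp (η * x) := by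
            gcongr; exact hray x hx
        _ = 1 := by rw [← Real.exp_add]; simp
    · intro x
      rw [hnorm]
      simpa using hp1 (x * I) (by simp)
  · right
    push Not at hcase
    set A := -Real.log c
    have hA : 0 ≤ A := by
      have h1 := hpc 0 (by simp) (by simp)
      have h2 := hp1 0 (by simp)
      exact neg_nonneg.2 (Real.log_nonpos hc.le (h1.trans h2))
    have hlogc : ∀ w : ℂ, 0 ≤ w.re → w.re ≤ 1 → -Real.log ‖p w‖ ≤ A := fun w h1 h2 =>
      neg_le_neg (Real.log_le_log hc (hpc w h1 h2))
    -- Harnack between real part `1`, where `‖p‖ ≥ c`, and real part `w.re` gives at most linear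
    -- growth of `-log ‖p‖`. This is the order-one bound that Phragmén–Lindelöf needs for `p⁻¹`.
    have hgrow : ∀ w : ℂ, 0 ≤ w.re → -Real.log ‖p w‖ ≤ A + 2 * A * ‖w‖ := by
      intro w hw
      have hre := re_le_norm w
      rcases le_total w.re 1 with h | h
      · have := hlogc w hw h
        have : 0 ≤ 2 * A * ‖w‖ := by positivity
        linarith
      · have h1 := neg_log_norm_mul_le hp hp0 hp1 one_pos h w.im
        rw [re_add_im, mul_one] at h1
        have h2 := hlogc ((1 : ℝ) + w.im * I) (by simp) (by simp)
        have h3 : 2 * w.re * -Real.log ‖p ((1 : ℝ) + w.im * I)‖ ≤ 2 * ‖w‖ * A :=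
          (mul_le_mul_of_nonneg_left h2 (by linarith)).trans
            (mul_le_mul_of_nonneg_right (by linarith) hA)
        linarith
    have hnorm : ∀ (ε : ℝ) (w : ℂ), 0 ≤ w.re → ‖exp (-(ε * w)) * (p w)⁻¹‖ =
        Real.exp (-Real.log ‖p w‖ - ε * w.re) := fun ε w hw => by
      rw [norm_mul, norm_exp, norm_inv, neg_re, re_ofReal_mul, sub_eq_add_neg, Real.exp_add,
        Real.exp_neg (Real.log _), Real.exp_log (hpos w hw), mul_comm]
    -- The factor `e^{-εw}` compensates the sublinear growth of `-log ‖p‖` on the ray, with a bound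
    -- independent of `ε`; afterwards `ε` tends to `0`.
    have hmain : ∀ ε : ℝ, 0 < ε → ∀ w : ℂ, 0 ≤ w.re → ‖exp (-(ε * w)) * (p w)⁻¹‖ ≤ c⁻¹ := by
      intro ε hε w hw
      refine PhragmenLindelof.right_half_plane_of_bounded_on_real
        (f := fun w => exp (-(ε * w)) * (p w)⁻¹) ?_ ⟨1, by norm_num, 2 * A, ?_⟩ ?_ ?_ hw
      · refine DifferentiableOn.diffContOnCl fun z hz => ?_
        rw [closure_setOfPred_lt_re] at hz
        have hz' : p z ≠ 0 := hp0 z hz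
        exact (DifferentiableAt.mul (by fun_prop) ((hp z).inv hz')).differentiableWithinAt
      · refine Asymptotics.IsBigO.of_bound (Real.exp A) (eventually_inf_principal.2
          (Eventually.of_forall fun z (hz : 0 < z.re) => ?_))
        rw [hnorm ε z hz.le, Real.rpow_one, Real.norm_of_nonneg (Real.exp_pos _).le,
          ← Real.exp_add, Real.exp_le_exp]
        have := hgrow z hz.le
        have : 0 ≤ ε * z.re := by positivity
        linarith
      · refine ⟨1, ?_⟩
        rw [eventually_map]
        have hev : ∀ᶠ R : ℝ in atTop, -Real.log ‖p R‖ < 2 * (ε / 2) * R := by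
          have := hcase (ε / 2) (by positivity)
          simpa only [not_frequently, not_le] using this
        filter_upwards [eventually_gt_atTop 0, hev] with x hx hx2
        rw [hnorm ε x (by simpa using hx.le), Real.exp_le_one_iff, ofReal_re]
        linarith
      · intro x
        rw [norm_mul, norm_exp, norm_inv]
        have h0 : (-(ε * (x * I)) : ℂ).re = 0 := by simp
        rw [h0, Real.exp_zero, one_mul]
        exact inv_anti₀ hc (hpc _ (by simp) (by simp))
    intro w hw
    have hlim : Tendsto (fun ε : ℝ => ‖exp (-(ε * w)) * (p w)⁻¹‖) (𝓝[>] 0) (𝓝 ‖(p w)⁻¹‖) := by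
      refine Tendsto.mono_left ?_ nhdsWithin_le_nhds
      exact Continuous.tendsto' (by fun_prop) _ _ (by simp)
    have h1 : ‖(p w)⁻¹‖ ≤ c⁻¹ := le_of_tendsto hlim (by
      filter_upwards [self_mem_nhdsWithin] with ε hε using hmain ε hε w hw)
    rw [norm_inv] at h1
    exact (inv_le_inv₀ (hpos w hw) hc).1 h1

end HalfPlane

end

noncomputable section

/-! ### Limits of translates and existence of the least frequency -/

section LowestFrequency

open Complex

variable {W : Type*} {lam : W → ℝ} {q : W → ℂ} {B : ℝ}

lemma continuous_uncurry_deriv_dirichletSum (hb : ∀ w, |lam w| ≤ B)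
    (hq : Summable fun w => ‖q w‖) :
    Continuous fun p : (W → Circle) × ℂ =>
      deriv (dirichletSum lam fun w => q w * p.1 w) p.2 := by
  have := continuous_uncurry_dirichletSum hb (summable_norm_freq_mul hb hq)
  refine this.congr fun p => ?_
  rw [deriv_dirichletSum hb (summable_norm_mul_circle hq p.1)]
  simp only [mul_assoc]

/-- A zero of a limit of translates would, by Hurwitz, persist in some translate `Q (x + ·)` within
a small disc above height `H`. A real translation does not change the height, so `Q` itself would
vanish there. -/
lemma dirichletSum_ne_zero_of_mem_closure [Countable W] (hlam : Function.Injective lam) (hb : ∀ w, |lam w| ≤ B)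
    (hq : Summable fun w => ‖q w‖) {v : W} (hv : q v ≠ 0) {H : ℝ}
    (hH : ∀ z : ℂ, H < z.im → dirichletSum lam q z ≠ 0) {u : W → Circle}
    (hu : u ∈ closure (Set.range (torusLine lam))) {z : ℂ} (hz : H < z.im) :
    dirichletSum lam (fun w => q w * u w) z ≠ 0 := by
  classical
  intro h0
  set F : (W → Circle) → ℂ → ℂ := fun u => dirichletSum lam fun w => q w * u w
  have hF : ∀ u, Differentiable ℂ (F u) := fun u =>
    differentiable_dirichletSum hb (summable_norm_mul_circle hq u)
  have hne : ∃ z, F u z ≠ 0 := exists_dirichletSum_ne_zero hlam (summable_norm_mul_circle hq u)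
    (v := v) (mul_ne_zero hv (Circle.coe_ne_zero _))
  have hiso : ∀ᶠ y in 𝓝[≠] z, F u y ≠ 0 := by
    rcases ((hF u).analyticAt z).eventually_eq_zero_or_eventually_ne_zero with h | h
    · exact absurd (analyticOrderAt_eq_top.2 h) (analyticOrderAt_ne_top_of_entire (hF u) hne z)
    · exact h
  have hhalf : ∀ᶠ y in 𝓝 z, H < y.im :=
    (isOpen_lt continuous_const continuous_im).mem_nhds hz
  obtain ⟨δ, hδ, hball⟩ := Metric.eventually_nhds_iff_ball.1
    ((eventually_nhdsWithin_iff.1 hiso).and hhalf)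
  set r := δ / 2
  have hr : 0 < r := half_pos hδ
  have hrδ : Metric.closedBall z r ⊆ Metric.ball z δ :=
    Metric.closedBall_subset_ball (half_lt_self hδ)
  have hsph : ∀ y ∈ Metric.sphere z r, F u y ≠ 0 := by
    intro y hy
    refine (hball y (hrδ (Metric.sphere_subset_closedBall hy))).1 fun h => ?_
    rw [Set.mem_singleton_iff.1 h, Metric.mem_sphere, dist_self] at hy
    exact hr.ne hy
  have hev := eventually_sum_order_eq (S₀ := {z}) hF (continuous_uncurry_dirichletSum hb hq)
    (continuous_uncurry_deriv_dirichletSum hb hq) hr hsph (fun y => by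
      rw [Finset.mem_singleton]
      constructor
      · rintro rfl
        exact ⟨Metric.mem_ball_self hr, h0⟩
      · rintro ⟨h1, h2⟩
        by_contra hne
        exact (hball y (hrδ (Metric.ball_subset_closedBall h1))).1 hne h2)
  obtain ⟨_, hx, ⟨x, rfl⟩⟩ := mem_closure_iff_nhds.1 hu _ hev
  have h1 := hx ∅ fun y => by
    simp only [Finset.notMem_empty, false_iff, not_and]
    intro hy
    simp only [F]
    rw [dirichletSum_torusLine]
    refine hH _ ?_
    simpa using (hball y (hrδ (Metric.ball_subset_closedBall hy))).2
  rw [Finset.sum_empty, Finset.sum_singleton] at h1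
  exact (analyticOrderNatAt_pos_of_eq_zero (hF u) hne h0).ne h1

/-- The modulus attains a minimum on the compact product of the orbit closure with `[α, β]`. It is
positive because limits of translates have no zeros above `H` either. -/
lemma exists_forall_le_norm_dirichletSum [Countable W] (hlam : Function.Injective lam) (hb : ∀ w, |lam w| ≤ B)
    (hq : Summable fun w => ‖q w‖) {v : W} (hv : q v ≠ 0) {H : ℝ}
    (hH : ∀ z : ℂ, H < z.im → dirichletSum lam q z ≠ 0) {α β : ℝ} (hα : H < α) (hαβ : α ≤ β) :
    ∃ c > 0, ∀ z : ℂ, α ≤ z.im → z.im ≤ β → c ≤ ‖dirichletSum lam q z‖ := by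
  set C : Set ((W → Circle) × ℝ) := closure (Set.range (torusLine lam)) ×ˢ Set.Icc α β
  have hC : IsCompact C := isClosed_closure.isCompact.prod isCompact_Icc
  have hcont : Continuous fun p : (W → Circle) × ℝ =>
      ‖dirichletSum lam (fun w => q w * p.1 w) (p.2 * I)‖ :=
    ((continuous_uncurry_dirichletSum hb hq).comp
      (by fun_prop : Continuous fun p : (W → Circle) × ℝ => (p.1, (p.2 : ℂ) * I))).norm
  obtain ⟨p, hp, hmin⟩ := hC.exists_isMinOn
    ⟨(torusLine lam 0, α), subset_closure ⟨0, rfl⟩, le_rfl, hαβ⟩ hcont.continuousOn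
  refine ⟨_, norm_pos_iff.2 (dirichletSum_ne_zero_of_mem_closure hlam hb hq hv hH hp.1
    (z := p.2 * I) (by simpa using hα.trans_le hp.2.1)), fun z hz1 hz2 => ?_⟩
  have := hmin (a := (torusLine lam z.re, z.im)) ⟨subset_closure ⟨_, rfl⟩, hz1, hz2⟩
  simp only [Set.mem_ofPred_eq] at this
  rwa [dirichletSum_torusLine, re_add_im] at this

lemma dirichletSum_add (ζ z : ℂ) :
    dirichletSum lam (fun w => q w * exp (2 * Real.pi * I * (lam w : ℂ) * ζ)) z =
      dirichletSum lam q (ζ + z) := by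
  unfold dirichletSum
  refine tsum_congr fun w => ?_
  beta_reduce
  rw [mul_assoc, ← exp_add]
  ring_nf

/-- If a Dirichlet series has no zeros in an upper half-plane, then its spectrum has a least
element. -/
theorem exists_least_frequency [Countable W] [Nonempty W] (hlam : Function.Injective lam)
    (hb : ∀ w, |lam w| ≤ B) (hq : Summable fun w => ‖q w‖) (hq0 : ∀ w, q w ≠ 0) {H : ℝ}
    (hH : ∀ z : ℂ, H < z.im → dirichletSum lam q z ≠ 0) : ∃ w₀, ∀ w, lam w₀ ≤ lam w := by
  by_contra! hno
  -- If the infimum is not attained, the shifted frequencies `mu` are all positive but have infimum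
  -- `0`. Each alternative of `exp_decay_or_norm_ge` is incompatible with this.
  set l := ⨅ w, lam w
  have hbdd : BddBelow (Set.range lam) := ⟨-B, by rintro _ ⟨w, rfl⟩; exact (abs_le.1 (hb w)).1⟩
  have hl : ∀ w, l < lam w := fun w => by
    obtain ⟨w', hw'⟩ := hno w
    exact (ciInf_le hbdd w').trans_lt hw'
  have v : W := Classical.arbitrary W
  set mu : W → ℝ := fun w => lam w - l
  have hmu : ∀ w, 0 < mu w := fun w => sub_pos.2 (hl w)
  have hmuinj : Function.Injective mu := fun w w' h => hlam (by simpa [mu] using h)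
  have hmub : ∀ w, |mu w| ≤ B + |l| := fun w => (abs_sub _ _).trans (by linarith [hb w])
  have hshift : ∀ z, dirichletSum mu q z =
      exp (-(2 * Real.pi * I * l * z)) * dirichletSum lam q z := by
    intro z
    unfold dirichletSum
    rw [← tsum_mul_left]
    refine tsum_congr fun w => ?_
    rw [mul_left_comm, ← exp_add]
    congr 2
    simp only [mu]
    push_cast; ring
  have hne : ∀ z : ℂ, H < z.im → dirichletSum mu q z ≠ 0 := fun z hz => by
    rw [hshift]
    exact mul_ne_zero (exp_ne_zero _) (hH z hz)
  set H₁ := max (H + 1) 0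
  have hH₁ : H < H₁ := (lt_add_one H).trans_le (le_max_left _ _)
  have hH₁0 : 0 ≤ H₁ := le_max_right _ _
  obtain ⟨c, hc, hcle⟩ := exists_forall_le_norm_dirichletSum hmuinj hmub hq (hq0 v) hne hH₁
    (β := H₁ + 1) (by linarith)
  set M := (∑' w, ‖q w‖) + 1
  have hM : 0 < M := by
    have : 0 ≤ ∑' w, ‖q w‖ := tsum_nonneg fun _ => norm_nonneg _
    positivity
  have hQM : ∀ z : ℂ, 0 ≤ z.im → ‖dirichletSum mu q z‖ ≤ M := by
    intro z hz
    refine (tsum_of_norm_bounded hq.hasSum fun w => ?_).trans (by linarith)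
    rw [norm_mul, norm_exp_two_pi_I_mul]
    refine mul_le_of_le_one_right (norm_nonneg _) (Real.exp_le_one_iff.2 ?_)
    have := hmu w
    have : 0 ≤ 2 * Real.pi * mu w * z.im := by positivity
    linarith
  -- Rotation carries the right half-plane to `Im z ≥ H₁`; division by `M` makes the modulus at most
  -- `1`, using `H₁ ≥ 0` and `mu > 0`.
  set p : ℂ → ℂ := fun w => dirichletSum mu q (I * w + H₁ * I) / M
  have him : ∀ w : ℂ, (I * w + H₁ * I).im = w.re + H₁ := fun w => by simp
  have hdiff := differentiable_dirichletSum hmub hq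
  have hpnorm : ∀ w, ‖p w‖ = ‖dirichletSum mu q (I * w + H₁ * I)‖ / M := fun w => by
    simp [p, abs_of_pos hM]
  have hpQ : ∀ z : ℂ, dirichletSum mu q z = M * p (-I * z - H₁) := fun z => by
    have hM' : (M : ℂ) ≠ 0 := ofReal_ne_zero.2 hM.ne'
    have : I * (-I * z - H₁) + H₁ * I = z := by
      linear_combination (-z) * I_mul_I
    simp only [p, this]
    field_simp
  rcases exp_decay_or_norm_ge (p := p) (by fun_prop) (fun w hw => div_ne_zero (hne _ (by
      rw [him]; linarith)) (ofReal_ne_zero.2 hM.ne')) (fun w hw => by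
        rw [hpnorm, div_le_one hM]
        exact hQM _ (by rw [him]; linarith)) (div_pos hc hM) (fun w hw hw' => by
        rw [hpnorm]
        gcongr
        exact hcle _ (by rw [him]; linarith) (by rw [him]; linarith)) with ⟨η, hη, hdec⟩ | hge
  · -- the frequencies stay away from `0`
    have hfreq : ∀ w, η ≤ 2 * Real.pi * mu w := by
      intro w
      by_contra! hlt
      -- A coefficient is bounded by the supremum on a horizontal line. On the line at height `y +
      -- H₁` the coefficient decays like `e^{-2π mu w y}` and the series at least like `e^{-ηy}`; if
      -- `2π mu w < η`, letting `y → ∞` forces `q w = 0`.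
      have hbound : ∀ y : ℝ, 0 ≤ y → ‖q w‖ * Real.exp (-(2 * Real.pi * mu w * (y + H₁))) ≤
          M * Real.exp (-(η * y)) := by
        intro y hy
        have h1 := norm_coeff_le_of_norm_dirichletSum_le (lam := mu)
          (q := fun w => q w * exp (2 * Real.pi * I * (mu w : ℂ) * ((y + H₁ : ℝ) * I)))
          (M := M * Real.exp (-(η * y))) hmuinj ?_ ?_ w
        · rw [norm_mul, norm_exp_two_pi_I_mul] at h1
          simpa using h1
        · refine hq.of_nonneg_of_le (fun _ => norm_nonneg _) fun w => ?_
          rw [norm_mul, norm_exp_two_pi_I_mul]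
          refine mul_le_of_le_one_right (norm_nonneg _) (Real.exp_le_one_iff.2 ?_)
          have := hmu w
          have h2 : (((y + H₁ : ℝ) : ℂ) * I).im = y + H₁ := by simp
          rw [h2]
          have : 0 ≤ 2 * Real.pi * mu w * (y + H₁) := by positivity
          linarith
        · intro x
          rw [dirichletSum_add, hpQ, norm_mul, norm_real, Real.norm_of_nonneg hM.le]
          have h2 : (-I * (((y + H₁ : ℝ) : ℂ) * I + x) - H₁).re = y := by simp
          have h3 := hdec (-I * (((y + H₁ : ℝ) : ℂ) * I + x) - H₁) (by rw [h2]; exact hy)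
          rw [h2] at h3
          gcongr
      have hlim : Tendsto (fun y : ℝ => M * Real.exp (-((η - 2 * Real.pi * mu w) * y))) atTop
          (𝓝 (M * 0)) := by
        refine Tendsto.const_mul _ (Real.tendsto_exp_neg_atTop_nhds_zero.comp ?_)
        exact tendsto_id.const_mul_atTop (sub_pos.2 hlt)
      rw [mul_zero] at hlim
      have hle : ‖q w‖ * Real.exp (-(2 * Real.pi * mu w * H₁)) ≤ 0 := by
        refine ge_of_tendsto hlim ?_
        filter_upwards [eventually_ge_atTop 0] with y hy
        have h1 := mul_le_mul_of_nonneg_right (hbound y hy)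
          (Real.exp_pos (2 * Real.pi * mu w * y)).le
        have e1 : Real.exp (-(2 * Real.pi * mu w * H₁)) =
            Real.exp (-(2 * Real.pi * mu w * (y + H₁))) * Real.exp (2 * Real.pi * mu w * y) := by
          rw [← Real.exp_add]; congr 1; ring
        have e2 : Real.exp (-((η - 2 * Real.pi * mu w) * y)) =
            Real.exp (-(η * y)) * Real.exp (2 * Real.pi * mu w * y) := by
          rw [← Real.exp_add]; congr 1; ring
        rw [e1, e2, ← mul_assoc, ← mul_assoc]
        exact h1
      have : 0 < ‖q w‖ * Real.exp (-(2 * Real.pi * mu w * H₁)) :=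
        mul_pos (norm_pos_iff.2 (hq0 w)) (Real.exp_pos _)
      linarith
    have : l + η / (2 * Real.pi) ≤ l := le_ciInf fun w => by
      have h1 := hfreq w
      have h2 : η / (2 * Real.pi) ≤ mu w := by
        rw [div_le_iff₀ (by positivity)]; linarith
      simp only [mu] at h2
      linarith
    have : 0 < η / (2 * Real.pi) := by positivity
    linarith
  · -- the series tends to `0` along the imaginary axis
    have hlim : Tendsto (fun y : ℝ => dirichletSum mu q ((y : ℂ) * I)) atTop
        (𝓝 (∑' _ : W, (0 : ℂ))) := by
      refine tendsto_tsum_of_dominated_convergence hq (fun w => ?_) ?_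
      · refine squeeze_zero_norm (a := fun y : ℝ => ‖q w‖ *
          Real.exp (-(2 * Real.pi * mu w * y))) (fun y => ?_) ?_
        · rw [norm_mul, norm_exp_two_pi_I_mul]; simp
        · have : Tendsto (fun y : ℝ => Real.exp (-(2 * Real.pi * mu w * y))) atTop (𝓝 0) :=
            Real.tendsto_exp_neg_atTop_nhds_zero.comp
              (tendsto_id.const_mul_atTop (mul_pos Real.two_pi_pos (hmu w)))
          simpa using this.const_mul ‖q w‖
      · filter_upwards [eventually_ge_atTop 0] with y hy w
        rw [norm_mul, norm_exp_two_pi_I_mul]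
        refine mul_le_of_le_one_right (norm_nonneg _) (Real.exp_le_one_iff.2 ?_)
        have := hmu w
        have h2 : ((y : ℂ) * I).im = y := by simp
        rw [h2]
        have : 0 ≤ 2 * Real.pi * mu w * y := by positivity
        linarith
    rw [tsum_zero] at hlim
    have hle : c ≤ ‖(0 : ℂ)‖ := by
      refine ge_of_tendsto hlim.norm ?_
      filter_upwards [eventually_ge_atTop H₁] with y hy
      have h2 : (-I * ((y : ℂ) * I) - H₁).re = y - H₁ := by simp
      have h3 := hge (-I * ((y : ℂ) * I) - H₁) (by rw [h2]; linarith)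
      rw [hpQ, norm_mul, norm_real, Real.norm_of_nonneg hM.le]
      rw [div_le_iff₀ hM] at h3
      linarith
    rw [norm_zero] at hle
    linarith

end LowestFrequency

end

noncomputable section

/-! ### The logarithmic derivative as a Dirichlet series -/

section LogExpansion

open Complex

/-- Induction on `k` by multiplying absolutely convergent series, `Fin.consEquiv` identifying pairs
(head, tail) with longer tuples. Indexing by tuples makes powers of a Dirichlet series again
Dirichlet series, with frequencies added. -/
lemma hasSum_prod_fin {𝕜 V : Type*} [NormedField 𝕜] [CompleteSpace 𝕜] {f : V → 𝕜}
    (hf : Summable fun v => ‖f v‖) (k : ℕ) :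
    (Summable fun t : Fin k → V => ‖∏ j, f (t j)‖) ∧
      HasSum (fun t : Fin k → V => ∏ j, f (t j)) ((∑' v, f v) ^ k) := by
  induction k with
  | zero =>
    refine ⟨(hasSum_unique _).summable, ?_⟩
    simp
  | succ k ih =>
    have hsum : Summable fun p : V × (Fin k → V) => ‖f p.1 * ∏ j, f (p.2 j)‖ :=
      hf.mul_norm (g := fun t : Fin k → V => ∏ j, f (t j)) ih.1
    have hprod : HasSum (fun p : V × (Fin k → V) => f p.1 * ∏ j, f (p.2 j))
        ((∑' v, f v) * (∑' v, f v) ^ k) :=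
      HasSum.mul (g := fun t : Fin k → V => ∏ j, f (t j)) hf.of_norm.hasSum ih.2 hsum.of_norm
    have hcons : ∀ p : V × (Fin k → V),
        ∏ j, f (Fin.consEquiv (fun _ => V) p j) = f p.1 * ∏ j, f (p.2 j) := fun p => by
      simp [Fin.prod_univ_succ, Fin.consEquiv]
    constructor
    · rw [← (Fin.consEquiv fun _ => V).summable_iff]
      simpa only [Function.comp_def, hcons] using hsum
    · rw [← (Fin.consEquiv fun _ => V).hasSum_iff]
      simp only [Function.comp_def, hcons, pow_succ']
      exact hprod

/-- The index set of the expansion of `log (1 + h)`. -/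
abbrev LogIndex (V : Type*) := Σ k : ℕ, Fin (k + 1) → V

/-- The frequencies of the expansion of `log (1 + h)`. -/
def logFreq {V : Type*} (mu : V → ℝ) (i : LogIndex V) : ℝ := ∑ j, mu (i.2 j)

/-- The coefficients of the expansion of `log (1 + h)`. -/
def logCoeff {V : Type*} (r : V → ℂ) (i : LogIndex V) : ℂ :=
  (-1) ^ i.1 / ((i.1 : ℂ) + 1) * ∏ j, r (i.2 j)

variable {V : Type*} {mu : V → ℝ} {r : V → ℂ} {s : ℝ}

lemma logFreq_pos (hmu : ∀ v, 0 < mu v) (i : LogIndex V) : 0 < logFreq mu i :=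
  Finset.sum_pos (fun _ _ => hmu _) Finset.univ_nonempty

lemma logCoeff_mul_exp (i : LogIndex V) (z : ℂ) :
    logCoeff r i * exp (2 * Real.pi * I * (logFreq mu i : ℂ) * z) =
      (-1) ^ i.1 / ((i.1 : ℂ) + 1) *
        ∏ j, (r (i.2 j) * exp (2 * Real.pi * I * (mu (i.2 j) : ℂ) * z)) := by
  rw [logCoeff, logFreq, Finset.prod_mul_distrib, ← exp_sum, mul_assoc]
  congr 3
  push_cast
  rw [Finset.mul_sum, Finset.sum_mul]

lemma norm_logCoeff_mul_exp_le (i : LogIndex V) (s : ℝ) :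
    ‖logCoeff r i‖ * Real.exp (-(2 * Real.pi * logFreq mu i * s)) ≤
      ∏ j, (‖r (i.2 j)‖ * Real.exp (-(2 * Real.pi * mu (i.2 j) * s))) := by
  rw [logCoeff, logFreq, Finset.prod_mul_distrib, ← Real.exp_sum, norm_mul, norm_prod, norm_div,
    norm_pow, norm_neg, norm_one, one_pow]
  have h1 : -(2 * Real.pi * (∑ j, mu (i.2 j)) * s) = ∑ j, -(2 * Real.pi * mu (i.2 j) * s) := by
    rw [Finset.mul_sum, Finset.sum_mul, Finset.sum_neg_distrib]
  have h2 : (1 : ℝ) ≤ ‖((i.1 : ℂ) + 1)‖ := by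
    have : ((i.1 : ℂ) + 1) = ((i.1 + 1 : ℕ) : ℂ) := by push_cast; rfl
    rw [this, norm_natCast]
    push_cast
    linarith [(Nat.cast_nonneg i.1 : (0 : ℝ) ≤ i.1)]
  rw [h1]
  have h3 : (1 : ℝ) / ‖((i.1 : ℂ) + 1)‖ ≤ 1 := by
    rw [div_le_one (by linarith)]; exact h2
  have h4 : 0 ≤ ∏ j, ‖r (i.2 j)‖ := Finset.prod_nonneg fun _ _ => norm_nonneg _
  exact mul_le_mul_of_nonneg_right (mul_le_of_le_one_left h4 h3) (Real.exp_pos _).le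

/-- Dropping the factors `1 / (k + 1)`, the tuples of length `k + 1` contribute at most the `(k +
1)`-st power of a number below `1`. -/
lemma summable_logCoeff (hr : Summable fun v => ‖r v‖ * Real.exp (-(2 * Real.pi * mu v * s)))
    (hlt : ∑' v, ‖r v‖ * Real.exp (-(2 * Real.pi * mu v * s)) < 1) :
    Summable fun i => ‖logCoeff r i‖ * Real.exp (-(2 * Real.pi * logFreq mu i * s)) := by
  have hnn : ∀ v, 0 ≤ ‖r v‖ * Real.exp (-(2 * Real.pi * mu v * s)) := fun v => by positivity
  refine Summable.of_nonneg_of_le (fun i => by positivity)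
    (fun i => norm_logCoeff_mul_exp_le i s) ?_
  have hr' : Summable fun v => ‖(‖r v‖ * Real.exp (-(2 * Real.pi * mu v * s)))‖ := hr.norm
  rw [summable_sigma_of_nonneg fun i => Finset.prod_nonneg fun _ _ => hnn _]
  refine ⟨fun k => (hasSum_prod_fin hr' (k + 1)).2.summable, ?_⟩
  simp only [fun k => (hasSum_prod_fin hr' (k + 1)).2.tsum_eq]
  exact (summable_nat_add_iff 1).2 (summable_geometric_of_lt_one (tsum_nonneg hnn) hlt)

lemma norm_mul_exp_le_of_le_im {m : ℝ} (hm : 0 ≤ m) (c : ℂ) {z : ℂ} (hz : s ≤ z.im) :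
    ‖c * exp (2 * Real.pi * I * (m : ℂ) * z)‖ ≤ ‖c‖ * Real.exp (-(2 * Real.pi * m * s)) := by
  rw [norm_mul, norm_exp_two_pi_I_mul]
  gcongr

lemma hasSum_logCoeff (hmu : ∀ v, 0 < mu v)
    (hr : Summable fun v => ‖r v‖ * Real.exp (-(2 * Real.pi * mu v * s)))
    (hlt : ∑' v, ‖r v‖ * Real.exp (-(2 * Real.pi * mu v * s)) < 1) {z : ℂ} (hz : s ≤ z.im) :
    ‖dirichletSum mu r z‖ < 1 ∧
    HasSum (fun i => logCoeff r i * exp (2 * Real.pi * I * (logFreq mu i : ℂ) * z))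
      (log (1 + dirichletSum mu r z)) := by
  have hterm : ∀ v, ‖r v * exp (2 * Real.pi * I * (mu v : ℂ) * z)‖ ≤
      ‖r v‖ * Real.exp (-(2 * Real.pi * mu v * s)) := fun v =>
    norm_mul_exp_le_of_le_im (hmu v).le _ hz
  have hnorm : ‖dirichletSum mu r z‖ < 1 := (tsum_of_norm_bounded hr.hasSum hterm).trans_lt hlt
  refine ⟨hnorm, ?_⟩
  have hS : Summable fun i => logCoeff r i * exp (2 * Real.pi * I * (logFreq mu i : ℂ) * z) :=
    Summable.of_norm_bounded (summable_logCoeff hr hlt) fun i =>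
      norm_mul_exp_le_of_le_im (logFreq_pos hmu i).le _ hz
  -- The Taylor series of `log (1 + ·)` is indexed from `0` with vanishing zeroth term; the shift by
  -- one matches `LogIndex`, whose tuples are nonempty.
  have hlog := (hasSum_nat_add_iff' 1).2 (hasSum_taylorSeries_log hnorm)
  simp only [Finset.sum_range_one, Nat.cast_zero, div_zero, sub_zero] at hlog
  have hnr : Summable fun v => ‖r v * exp (2 * Real.pi * I * (mu v : ℂ) * z)‖ :=
    hr.of_nonneg_of_le (fun _ => norm_nonneg _) hterm
  refine HasSum.sigma_of_hasSum hlog (fun k => ?_) hS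
  simp only [logCoeff_mul_exp]
  have := ((hasSum_prod_fin hnr (k + 1)).2).mul_left ((-1 : ℂ) ^ k / ((k : ℂ) + 1))
  have e : (-1 : ℂ) ^ (k + 1 + 1) * dirichletSum mu r z ^ (k + 1) / ((k + 1 : ℕ) : ℂ) =
      (-1) ^ k / ((k : ℂ) + 1) * dirichletSum mu r z ^ (k + 1) := by
    push_cast
    ring
  rw [e]
  exact this

lemma hasSum_deriv_logCoeff (hmu : ∀ v, 0 < mu v)
    (hh : Differentiable ℂ (dirichletSum mu r))
    (hr : Summable fun v => ‖r v‖ * Real.exp (-(2 * Real.pi * mu v * s)))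
    (hlt : ∑' v, ‖r v‖ * Real.exp (-(2 * Real.pi * mu v * s)) < 1) {z : ℂ} (hz : s < z.im) :
    HasSum (fun i => 2 * Real.pi * I * (logFreq mu i : ℂ) * logCoeff r i *
        exp (2 * Real.pi * I * (logFreq mu i : ℂ) * z))
      (deriv (dirichletSum mu r) z / (1 + dirichletSum mu r z)) := by
  have hopen : IsOpen {z : ℂ | s < z.im} := isOpen_lt continuous_const continuous_im
  have h1 := hasSum_deriv_of_summable_norm (U := {z : ℂ | s < z.im}) (z := z)
    (F := fun i z => logCoeff r i * exp (2 * Real.pi * I * (logFreq mu i : ℂ) * z))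
    (summable_logCoeff hr hlt) (fun i => by fun_prop) hopen
    (fun i w hw => norm_mul_exp_le_of_le_im (logFreq_pos hmu i).le _ (le_of_lt hw)) hz
  simp only [deriv_exp_two_pi_I_mul] at h1
  have h2 : deriv (fun w => ∑' i, logCoeff r i * exp (2 * Real.pi * I * (logFreq mu i : ℂ) * w)) z
      = deriv (fun w => log (1 + dirichletSum mu r w)) z := by
    refine Filter.EventuallyEq.deriv_eq ?_
    filter_upwards [hopen.mem_nhds hz] with w hw
    exact (hasSum_logCoeff hmu hr hlt (le_of_lt hw)).2.tsum_eq
  rw [h2] at h1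
  have h3 : HasDerivAt (fun w => log (1 + dirichletSum mu r w))
      (deriv (dirichletSum mu r) z / (1 + dirichletSum mu r z)) z :=
    ((hh z).hasDerivAt.const_add 1).clog
      (mem_slitPlane_of_norm_lt_one (hasSum_logCoeff hmu hr hlt hz.le).1)
  rwa [h3.deriv] at h1

/-- With `δ > 0` the least of the finitely many gaps, a tuple of length `k + 1` has frequency at
least `(k + 1) δ`. A bound on the frequency thus bounds the length, and there are finitely many
tuples of each length. -/
lemma finite_logFreq_le [Finite V] (hmu : ∀ v, 0 < mu v) (R : ℝ) :
    {i | logFreq mu i ≤ R}.Finite := by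
  obtain ⟨δ, hδ, hle⟩ : ∃ δ > 0, ∀ v, δ ≤ mu v := by
    rcases isEmpty_or_nonempty V with h | h
    · exact ⟨1, one_pos, fun v => (h.false v).elim⟩
    · obtain ⟨v, hv⟩ := Finite.exists_min mu
      exact ⟨mu v, hmu v, hv⟩
  obtain ⟨N, hN⟩ := exists_nat_gt (R / δ)
  refine Set.Finite.subset (Set.Finite.biUnion (Set.finite_lt_nat N)
    fun k _ => Set.finite_range (Sigma.mk (β := fun k => Fin (k + 1) → V) k)) ?_
  rintro ⟨k, t⟩ ht
  refine Set.mem_biUnion (x := k) ?_ ⟨t, rfl⟩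
  have h1 : ((k + 1 : ℕ) : ℝ) * δ ≤ logFreq mu ⟨k, t⟩ := by
    rw [logFreq]
    have := Finset.card_nsmul_le_sum Finset.univ (fun j => mu (t j)) δ fun j _ => hle _
    simpa using this
  have h2 : ((k + 1 : ℕ) : ℝ) ≤ R / δ := by
    rw [le_div_iff₀ hδ]; exact h1.trans ht
  have h3 : ((k + 1 : ℕ) : ℝ) < N := h2.trans_lt hN
  have : k + 1 < N := by exact_mod_cast h3
  show k < N
  omega

/-- In a half-plane the logarithmic derivative of a Dirichlet series with a least frequency is an
absolutely convergent Dirichlet series. -/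
theorem exists_logDeriv_expansion.{u} {W : Type u} [Countable W] {lam : W → ℝ} {q : W → ℂ} {B : ℝ}
    (hlam : Function.Injective lam) (hb : ∀ w, |lam w| ≤ B) (hq : Summable fun w => ‖q w‖)
    {w₀ : W} (hq0 : q w₀ ≠ 0) (hmin : ∀ w, lam w₀ ≤ lam w) :
    ∃ (J : Type u) (_ : Countable J) (L : J → ℝ) (d : J → ℂ) (s : ℝ), (∀ i, 0 < L i) ∧
      (Summable fun i => ‖d i‖ * Real.exp (-(2 * Real.pi * L i * s))) ∧
      (Finite W → ∀ R, {i | L i ≤ R}.Finite) ∧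
      ∀ z : ℂ, s < z.im → dirichletSum lam q z ≠ 0 ∧
        HasSum (fun i => 2 * Real.pi * I * (L i : ℂ) * d i * exp (2 * Real.pi * I * (L i : ℂ) * z))
          (logDeriv (dirichletSum lam q) z - 2 * Real.pi * I * (lam w₀ : ℂ)) := by
  classical
  set V := {w : W // w ≠ w₀}
  set mu : V → ℝ := fun v => lam v - lam w₀
  set r : V → ℂ := fun v => q v / q w₀
  have hmu : ∀ v, 0 < mu v := fun v =>
    sub_pos.2 (lt_of_le_of_ne (hmin v) fun h => v.2 (hlam h).symm)
  have hmub : ∀ v, |mu v| ≤ B + B := fun v =>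
    (abs_sub _ _).trans (add_le_add (hb _) (hb _))
  have hrs : Summable fun v => ‖r v‖ := by
    simp only [r, norm_div]
    exact (hq.subtype _).div_const _
  have hh := differentiable_dirichletSum hmub hrs
  have hterm : ∀ v (s : ℝ), 0 ≤ s → ‖‖r v‖ * Real.exp (-(2 * Real.pi * mu v * s))‖ ≤ ‖r v‖ := by
    intro v s hs
    rw [norm_mul, norm_norm, Real.norm_of_nonneg (Real.exp_pos _).le]
    refine mul_le_of_le_one_right (norm_nonneg _) (Real.exp_le_one_iff.2 ?_)
    have := hmu v
    have : 0 ≤ 2 * Real.pi * mu v * s := by positivity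
    linarith
  -- All gaps `mu v` are positive, so by dominated convergence the majorant of the non-leading terms
  -- tends to `0` with growing height, even if the gaps accumulate at `0`. Hence some `s` makes it
  -- less than `1`.
  have hlim : Tendsto (fun s : ℝ => ∑' v, ‖r v‖ * Real.exp (-(2 * Real.pi * mu v * s))) atTop
      (𝓝 (∑' _ : V, (0 : ℝ))) := by
    refine tendsto_tsum_of_dominated_convergence hrs (fun v => ?_) ?_
    · have : Tendsto (fun s : ℝ => Real.exp (-(2 * Real.pi * mu v * s))) atTop (𝓝 0) :=
        Real.tendsto_exp_neg_atTop_nhds_zero.comp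
          (tendsto_id.const_mul_atTop (mul_pos Real.two_pi_pos (hmu v)))
      simpa using this.const_mul ‖r v‖
    · filter_upwards [eventually_ge_atTop 0] with s hs v using hterm v s hs
  rw [tsum_zero] at hlim
  obtain ⟨s, hlt, hs⟩ := ((hlim.eventually (gt_mem_nhds one_pos)).and
    (eventually_ge_atTop (0 : ℝ))).exists
  have hr : Summable fun v => ‖r v‖ * Real.exp (-(2 * Real.pi * mu v * s)) :=
    Summable.of_norm_bounded hrs fun v => hterm v s hs
  refine ⟨LogIndex V, inferInstance, logFreq mu, logCoeff r, s, logFreq_pos hmu,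
    summable_logCoeff hr hlt, fun _ => finite_logFreq_le hmu, fun z hz => ?_⟩
  have hfac : ∀ z, dirichletSum lam q z =
      (q w₀ * exp (2 * Real.pi * I * (lam w₀ : ℂ) * z)) * (1 + dirichletSum mu r z) := by
    intro z
    have h1 := (summable_dirichlet hb hq z).tsum_eq_add_tsum_ite w₀
    have h2 : ∑' w, ite (w = w₀) 0 (q w * exp (2 * Real.pi * I * (lam w : ℂ) * z)) =
        ∑' v : V, q v * exp (2 * Real.pi * I * (lam v : ℂ) * z) := by
      refine Eq.trans ?_ (tsum_subtype {w | w ≠ w₀}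
        fun w => q w * exp (2 * Real.pi * I * (lam w : ℂ) * z)).symm
      refine tsum_congr fun w => ?_
      by_cases hw : w = w₀ <;> simp [hw]
    rw [dirichletSum, h1, h2, mul_add, mul_one, dirichletSum, ← tsum_mul_left]
    congr 1
    refine tsum_congr fun v => ?_
    simp only [r, mu]
    rw [show q w₀ * exp (2 * Real.pi * I * (lam w₀ : ℂ) * z) * (q v / q w₀ *
      exp (2 * Real.pi * I * ((lam v - lam w₀ : ℝ) : ℂ) * z)) = q v *
      (exp (2 * Real.pi * I * (lam w₀ : ℂ) * z) *
        exp (2 * Real.pi * I * ((lam v - lam w₀ : ℝ) : ℂ) * z)) by field_simp, ← exp_add]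
    congr 2
    push_cast; ring
  have hnorm := (hasSum_logCoeff hmu hr hlt hz.le).1
  have hne1 : 1 + dirichletSum mu r z ≠ 0 :=
    slitPlane_ne_zero (mem_slitPlane_of_norm_lt_one hnorm)
  have hne2 : q w₀ * exp (2 * Real.pi * I * (lam w₀ : ℂ) * z) ≠ 0 :=
    mul_ne_zero hq0 (exp_ne_zero _)
  refine ⟨by rw [hfac]; exact mul_ne_zero hne2 hne1, ?_⟩
  have hlog : logDeriv (dirichletSum lam q) z - 2 * Real.pi * I * (lam w₀ : ℂ) =
      deriv (dirichletSum mu r) z / (1 + dirichletSum mu r z) := by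
    rw [show dirichletSum lam q = fun z => (q w₀ * exp (2 * Real.pi * I * (lam w₀ : ℂ) * z)) *
      (1 + dirichletSum mu r z) from funext hfac,
      logDeriv_mul (f := fun z => q w₀ * exp (2 * Real.pi * I * (lam w₀ : ℂ) * z)) z hne2 hne1
        (by fun_prop) (by fun_prop), logDeriv_apply, logDeriv_apply, deriv_exp_two_pi_I_mul,
        deriv_const_add]
    rw [mul_assoc (2 * Real.pi * I * (lam w₀ : ℂ)), mul_div_cancel_right₀ _ hne2]
    ring
  rw [hlog]
  exact hasSum_deriv_logCoeff hmu hh hr hlt hz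

end LogExpansion

end

noncomputable section

open scoped FourierTransform

/-! ### The transform `φ̂ᶜ` -/

section CTransform

open Complex

variable {φ : ℝ → ℂ}

lemma norm_cTransform_kernel (z : ℂ) (t : ℝ) :
    ‖exp (-(2 * Real.pi * I * z * (t : ℂ)))‖ = Real.exp (2 * Real.pi * (t * z.im)) := by
  have h := norm_exp_two_pi_I_mul (-t) z
  rw [show (-(2 * Real.pi * I * z * (t : ℂ)) : ℂ) = 2 * Real.pi * I * ((-t : ℝ) : ℂ) * z by
    push_cast; ring, h]
  congr 1; ring

lemma integrable_mul_of_hasCompactSupport (hφ : Continuous φ) (hφc : HasCompactSupport φ)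
    {g : ℝ → ℂ} (hg : Continuous g) : Integrable fun t => φ t * g t :=
  (hφ.mul hg).integrable_of_hasCompactSupport hφc.mul_right

lemma differentiable_cTransform (hφ : Continuous φ) (hφc : HasCompactSupport φ) :
    Differentiable ℂ (cTransform φ) := by
  intro z₀
  have h := hasDerivAt_integral_of_dominated_loc_of_deriv_le (μ := volume) (x₀ := z₀)
    (s := Metric.ball z₀ 1)
    (F := fun z (t : ℝ) => φ t * exp (-(2 * Real.pi * I * z * (t : ℂ))))
    (F' := fun z (t : ℝ) => φ t * (exp (-(2 * Real.pi * I * z * (t : ℂ))) *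
      (-(2 * Real.pi * I * t))))
    (bound := fun t => ‖φ t * ((Real.exp (2 * Real.pi * (|t| * (|z₀.im| + 1))) *
      (2 * Real.pi * |t|) : ℝ) : ℂ)‖)
    (Metric.ball_mem_nhds z₀ one_pos)
    (Eventually.of_forall fun z => Continuous.aestronglyMeasurable (by fun_prop))
    (integrable_mul_of_hasCompactSupport hφ hφc (by fun_prop))
    (Continuous.aestronglyMeasurable (by fun_prop)) ?_ ?_ ?_
  · exact h.2.differentiableAt
  · refine Eventually.of_forall fun t z hz => ?_
    rw [norm_mul, norm_mul, norm_mul, norm_cTransform_kernel, norm_real, Real.norm_of_nonneg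
      (by positivity)]
    have h1 : ‖(-(2 * Real.pi * I * t) : ℂ)‖ = 2 * Real.pi * |t| := by
      simp [abs_of_pos Real.pi_pos]
    have h2 : |z.im| ≤ |z₀.im| + 1 := by
      have h3 := (abs_im_le_norm (z - z₀)).trans (mem_ball_iff_norm.1 hz).le
      rw [sub_im] at h3
      have := abs_sub_abs_le_abs_sub z.im z₀.im
      linarith
    have h4 : t * z.im ≤ |t| * (|z₀.im| + 1) :=
      (le_abs_self _).trans (by rw [abs_mul]; gcongr)
    rw [h1]
    gcongr
  · exact (integrable_mul_of_hasCompactSupport hφ hφc (by fun_prop)).norm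
  · refine Eventually.of_forall fun t z _ => ?_
    have : HasDerivAt (fun z : ℂ => exp (-(2 * Real.pi * I * z * (t : ℂ))))
        (exp (-(2 * Real.pi * I * z * (t : ℂ))) * (-(2 * Real.pi * I * 1 * t))) z :=
      ((((hasDerivAt_id z).const_mul (2 * Real.pi * I)).mul_const (t : ℂ)).neg).cexp
    rw [mul_one] at this
    exact this.const_mul _

/-- Integration by parts, without boundary terms because of compact support. Two applications yield
quadratic decay. -/
lemma cTransform_deriv (hφ : ContDiff ℝ 1 φ) (hφc : HasCompactSupport φ) (z : ℂ) :
    cTransform (deriv φ) z = 2 * Real.pi * I * z * cTransform φ z := by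
  have hd : Continuous (deriv φ) := hφ.continuous_deriv le_rfl
  have hu : ∀ t : ℝ, HasDerivAt (fun t : ℝ => exp (-(2 * Real.pi * I * z * (t : ℂ))))
      (exp (-(2 * Real.pi * I * z * (t : ℂ))) * (-(2 * Real.pi * I * z * 1))) t := fun t =>
    ((((hasDerivAt_id t).ofReal_comp).const_mul (2 * Real.pi * I * z)).neg).cexp
  have h := integral_mul_deriv_eq_deriv_mul_of_integrable (u := φ) (u' := deriv φ)
    (v := fun t : ℝ => exp (-(2 * Real.pi * I * z * (t : ℂ))))
    (v' := fun t : ℝ => exp (-(2 * Real.pi * I * z * (t : ℂ))) * (-(2 * Real.pi * I * z * 1)))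
    (fun t _ => ((hφ.differentiable one_ne_zero) t).hasDerivAt) (fun t _ => hu t)
    (integrable_mul_of_hasCompactSupport hφ.continuous hφc (by fun_prop))
    (integrable_mul_of_hasCompactSupport hd hφc.deriv (by fun_prop))
    (integrable_mul_of_hasCompactSupport hφ.continuous hφc (by fun_prop))
  have h2 : ∀ t : ℝ, φ t * (exp (-(2 * Real.pi * I * z * (t : ℂ))) * (-(2 * Real.pi * I * z * 1))) =
      (-(2 * Real.pi * I * z)) * (φ t * exp (-(2 * Real.pi * I * z * (t : ℂ)))) := fun t => by ring
  simp only [h2] at h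
  rw [integral_const_mul] at h
  unfold cTransform
  linear_combination h

lemma exists_norm_cTransform_le (hφ : Continuous φ) (hφc : HasCompactSupport φ) (R : ℝ) :
    ∃ C, ∀ z : ℂ, |z.im| ≤ R → ‖cTransform φ z‖ ≤ C := by
  refine ⟨∫ t, ‖φ t * ((Real.exp (2 * Real.pi * (|t| * R)) : ℝ) : ℂ)‖, fun z hz => ?_⟩
  refine norm_integral_le_of_norm_le
    (integrable_mul_of_hasCompactSupport hφ hφc (by fun_prop)).norm (Eventually.of_forall fun t => ?_)
  rw [norm_mul, norm_mul, norm_cTransform_kernel, norm_real, Real.norm_of_nonneg (by positivity)]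
  have h4 : t * z.im ≤ |t| * R := (le_abs_self _).trans (by rw [abs_mul]; gcongr)
  gcongr

/-- On horizontal strips `φ̂ᶜ` decays quadratically. -/
lemma exists_norm_cTransform_le_div (hφ : ContDiff ℝ ∞ φ) (hφc : HasCompactSupport φ) (R : ℝ) :
    ∃ C, 0 ≤ C ∧ ∀ z : ℂ, |z.im| ≤ R → ‖cTransform φ z‖ ≤ C * (1 + z.re ^ 2)⁻¹ := by
  have hφ2 : ContDiff ℝ 2 φ := contDiff_infty.1 hφ 2
  have hd : ContDiff ℝ 1 (deriv φ) := ContDiff.deriv' (n := 1) (by simpa [one_add_one_eq_two] using hφ2)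
  have hdd : Continuous (deriv (deriv φ)) := hd.continuous_deriv le_rfl
  obtain ⟨C₀, hC₀⟩ := exists_norm_cTransform_le hφ.continuous hφc R
  obtain ⟨C₂, hC₂⟩ := exists_norm_cTransform_le hdd hφc.deriv.deriv R
  have key : ∀ z : ℂ, |z.im| ≤ R → ‖cTransform φ z‖ * (1 + z.re ^ 2) ≤ |C₀| + |C₂| := by
    intro z hz
    have h0 := (hC₀ z hz).trans (le_abs_self _)
    have h2 := (hC₂ z hz).trans (le_abs_self _)
    rw [cTransform_deriv hd hφc.deriv, cTransform_deriv (hφ2.of_le (by norm_num)) hφc,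
      ← mul_assoc, norm_mul] at h2
    have h3 : ‖(2 * Real.pi * I * z * (2 * Real.pi * I * z) : ℂ)‖ =
        (2 * Real.pi) ^ 2 * ‖z‖ ^ 2 := by
      simp [abs_of_pos Real.pi_pos]; ring
    rw [h3] at h2
    have h4 : z.re ^ 2 ≤ (2 * Real.pi) ^ 2 * ‖z‖ ^ 2 := by
      have h5 : z.re ^ 2 ≤ ‖z‖ ^ 2 := by
        rw [← sq_abs]; exact pow_le_pow_left₀ (abs_nonneg _) (abs_re_le_norm z) 2
      have h6 : (1 : ℝ) ≤ (2 * Real.pi) ^ 2 := by nlinarith [Real.pi_gt_three]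
      nlinarith [sq_nonneg ‖z‖]
    have := mul_le_mul_of_nonneg_right h4 (norm_nonneg (cTransform φ z))
    linarith
  refine ⟨|C₀| + |C₂|, by positivity, fun z hz => ?_⟩
  rw [← div_eq_mul_inv, le_div_iff₀ (by positivity)]
  exact key z hz

lemma integrable_of_norm_le_inv_one_add_sq {f : ℝ → ℂ} (hf : Continuous f) {C : ℝ}
    (h : ∀ x, ‖f x‖ ≤ C * (1 + x ^ 2)⁻¹) : Integrable f :=
  (integrable_inv_one_add_sq.const_mul C).mono' hf.aestronglyMeasurable (Eventually.of_forall h)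

/-- Fourier inversion on a horizontal line. -/
lemma integral_cTransform_mul_exp (hφ : ContDiff ℝ ∞ φ) (hφc : HasCompactSupport φ) (s γ : ℝ) :
    ∫ x : ℝ, cTransform φ (x + s * I) * exp (2 * Real.pi * I * (γ : ℂ) * (x + s * I)) = φ γ := by
  -- The real exponential `e^{2πts}` moves the transform to the line `Im z = s`: the ordinary
  -- Fourier transform of `ψ` is `cTransform φ` on that line, so inversion on `ℝ` applies.
  set ψ : ℝ → ℂ := fun t => φ t * ((Real.exp (2 * Real.pi * t * s) : ℝ) : ℂ)
  have hψ : Continuous ψ := hφ.continuous.mul (by fun_prop)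
  have hψi : Integrable ψ :=
    integrable_mul_of_hasCompactSupport hφ.continuous hφc (by fun_prop)
  have hF : 𝓕 ψ = fun x : ℝ => cTransform φ (x + s * I) := by
    ext x
    rw [Real.fourier_real_eq_integral_exp_smul, cTransform]
    congr 1
    ext t
    simp only [ψ, smul_eq_mul]
    rw [mul_left_comm, ofReal_exp, ← exp_add]
    congr 2
    push_cast
    linear_combination (2 * Real.pi * t * s : ℂ) * I_mul_I
  obtain ⟨C, -, hC⟩ := exists_norm_cTransform_le_div hφ hφc |s|
  have hFi : Integrable (𝓕 ψ) := by
    rw [hF]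
    refine integrable_of_norm_le_inv_one_add_sq (C := C)
      ((differentiable_cTransform hφ.continuous hφc).continuous.comp (by fun_prop)) fun x => ?_
    simpa using hC (x + s * I) (by simp)
  have h := hψi.fourierInv_fourier_eq hFi (v := γ) hψ.continuousAt
  rw [Real.fourierInv_eq', hF] at h
  have h2 : ∀ x : ℝ, cTransform φ (x + s * I) * exp (2 * Real.pi * I * (γ : ℂ) * (x + s * I)) =
      ((Real.exp (-(2 * Real.pi * γ * s)) : ℝ) : ℂ) *
        (exp (((2 * Real.pi * inner ℝ x γ : ℝ) : ℂ) * I) • cTransform φ (x + s * I)) := by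
    intro x
    rw [smul_eq_mul, ← mul_assoc, ofReal_exp, ← exp_add, mul_comm]
    congr 2
    simp only [RCLike.inner_apply, conj_trivial]
    push_cast
    linear_combination (2 * Real.pi * γ * s : ℂ) * I_mul_I
  simp only [h2]
  rw [integral_const_mul]
  push_cast at h ⊢
  rw [h]
  simp only [ψ]
  rw [mul_left_comm, ofReal_exp, ← exp_add]
  push_cast
  rw [neg_add_cancel, exp_zero, mul_one]

end CTransform

end

noncomputable section

/-! ### Zero multisets -/

section ZeroMultiset

open Complex

variable {ι : Type*} {a : ι → ℂ} {Q : ℂ → ℂ}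

/-- For `Q = 0` the order at a point is infinite, contradicting the finiteness of multiplicities. -/
lemma IsZeroMultiset.exists_ne_zero (h : IsZeroMultiset a Q) : ∃ z, Q z ≠ 0 := by
  by_contra! h0
  have h1 := h 0
  have h2 : analyticOrderAt Q 0 = ⊤ := analyticOrderAt_eq_top.2 (Eventually.of_forall h0)
  rw [h2, Set.encard_eq_top_iff] at h1
  exact h1.2 h1.1

lemma IsZeroMultiset.ncard_eq (h : IsZeroMultiset a Q) (z : ℂ) :
    {n | a n = z}.ncard = analyticOrderNatAt Q z := by
  rw [Set.ncard, (h z).2, analyticOrderNatAt]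

lemma IsZeroMultiset.map_eq_zero (h : IsZeroMultiset a Q) (hQ : Differentiable ℂ Q) (n : ι) :
    Q (a n) = 0 := by
  by_contra h0
  have h1 := (h (a n)).2
  rw [(hQ.analyticAt _).analyticOrderAt_eq_zero.2 h0, Set.encard_eq_zero] at h1
  exact Set.eq_empty_iff_forall_notMem.1 h1 n rfl

lemma IsZeroMultiset.exists_eq (h : IsZeroMultiset a Q) (hQ : Differentiable ℂ Q) {z : ℂ}
    (hz : Q z = 0) : ∃ n, a n = z := by
  have h1 := analyticOrderNatAt_pos_of_eq_zero hQ h.exists_ne_zero hz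
  rw [← h.ncard_eq] at h1
  exact Set.nonempty_of_ncard_ne_zero h1.ne'

lemma IsZeroMultiset.finite_mem_finset (h : IsZeroMultiset a Q) (S : Finset ℂ) :
    {n | a n ∈ S}.Finite := by
  have : {n | a n ∈ S} = ⋃ z ∈ S, {n | a n = z} := by ext n; simp
  rw [this]
  exact Set.Finite.biUnion S.finite_toSet fun z _ => (h z).1

/-- Grouping the indices by the value of `a` gives the passage between sums over the multiset and
sums over points weighted by the order. -/
lemma IsZeroMultiset.hasSum_comp (h : IsZeroMultiset a Q) {S : Finset ℂ} {f : ℂ → ℂ}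
    (hf : ∀ n, a n ∉ S → f (a n) = 0) :
    HasSum (fun n => f (a n)) (∑ z ∈ S, (analyticOrderNatAt Q z : ℂ) * f z) := by
  classical
  set T := (h.finite_mem_finset S).toFinset
  have hT : ∀ n, n ∈ T ↔ a n ∈ S := by simp [T]
  have h1 : HasSum (fun n => f (a n)) (∑ n ∈ T, f (a n)) :=
    hasSum_sum_of_ne_finset_zero fun n hn => hf n fun h => hn ((hT n).2 h)
  convert h1 using 1
  rw [← Finset.sum_fiberwise_of_maps_to (fun n hn => (hT n).1 hn)]
  refine Finset.sum_congr rfl fun z hz => ?_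
  rw [Finset.sum_congr rfl (g := fun _ => f z) fun n hn => by rw [(Finset.mem_filter.1 hn).2],
    Finset.sum_const, nsmul_eq_mul, ← h.ncard_eq]
  congr 2
  rw [← Set.ncard_coe_finset]
  congr 1
  ext n
  simp only [Set.mem_ofPred_eq, Finset.coe_filter, hT]
  exact ⟨fun hn => ⟨hn ▸ hz, hn⟩, fun hn => hn.2⟩

lemma IsZeroMultiset.finite_mem_of_isCompact (h : IsZeroMultiset a Q) (hQ : Differentiable ℂ Q)
    {K : Set ℂ} (hK : IsCompact K) : {n | a n ∈ K}.Finite := by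
  refine (h.finite_mem_finset (finite_zeros_of_isCompact hQ h.exists_ne_zero hK).toFinset).subset
    fun n hn => ?_
  simpa using ⟨hn, h.map_eq_zero hQ n⟩

lemma IsZeroMultiset.countable (h : IsZeroMultiset a Q) (hQ : Differentiable ℂ Q) :
    Countable ι := by
  rw [← Set.countable_univ_iff]
  have : (Set.univ : Set ι) = ⋃ k : ℕ, {n | a n ∈ Metric.closedBall (0 : ℂ) k} := by
    ext n
    obtain ⟨k, hk⟩ := exists_nat_ge ‖a n‖
    simp only [Set.mem_univ, Set.mem_iUnion, true_iff]
    exact ⟨k, by simpa using hk⟩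
  rw [this]
  exact Set.countable_iUnion fun k =>
    (h.finite_mem_of_isCompact hQ (isCompact_closedBall 0 _)).countable

lemma integrable_pointMeasure [Countable ι] {f : ℂ → ℂ} (hf : Summable fun n => ‖f (a n)‖) :
    Integrable f (pointMeasure a) ∧ ∫ z, f z ∂pointMeasure a = ∑' n, f (a n) := by
  have hμ : pointMeasure a = Measure.sum fun n => (1 : ENNReal) • Measure.dirac (a n) := by
    simp [pointMeasure]
  rw [hμ]
  refine ⟨integrable_sum_dirac (fun _ => ENNReal.one_ne_top) (by simpa using hf), ?_⟩
  rw [integral_sum_dirac_eq_tsum (fun _ => ENNReal.one_ne_top) (by simpa using hf)]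
  simp

/-- The reflection `w ↦ z - w` has nonzero derivative and so preserves orders. The convolution
becomes a zero sum of a reflected series against a fixed test function, the form to which the
continuity theorem applies. -/
lemma IsZeroMultiset.hasSum_sub (h : IsZeroMultiset a Q) (hQ : Differentiable ℂ Q) {φ : ℂ → ℂ}
    (hφc : HasCompactSupport φ) (z : ℂ) :
    HasSum (fun n => φ (z - a n)) (zeroSum (fun w => Q (z - w)) φ) := by
  have hK : IsCompact ((fun w => z - w) '' tsupport φ) :=
    IsCompact.image hφc (by fun_prop)
  set S := (finite_zeros_of_isCompact hQ h.exists_ne_zero hK).toFinset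
  have hmem : ∀ w, Q w = 0 → φ (z - w) ≠ 0 → w ∈ S := by
    intro w hw hφw
    simp only [S, Set.Finite.mem_toFinset, Set.mem_ofPred_eq]
    exact ⟨⟨z - w, subset_tsupport _ hφw, by ring⟩, hw⟩
  have h1 := h.hasSum_comp (S := S) (f := fun w => φ (z - w)) fun n hn => by
    by_contra hne
    exact hn (hmem _ (h.map_eq_zero hQ n) hne)
  rw [← zeroSum_eq_sum (φ := fun w => φ (z - w)) hQ hmem] at h1
  convert h1 using 1
  unfold zeroSum
  rw [← finsum_comp_equiv (Equiv.subLeft z)]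
  refine finsum_congr fun w => ?_
  have h2 : analyticOrderAt (fun w => Q (z - w)) (z - w) = analyticOrderAt Q w := by
    have hd : HasDerivAt (fun w : ℂ => z - w) (-1) (z - w) := (hasDerivAt_id _).const_sub z
    have := analyticOrderAt_comp_of_deriv_ne_zero (f := Q) (g := fun w : ℂ => z - w) (z₀ := z - w)
      (by fun_prop) (by rw [hd.deriv]; norm_num)
    rw [sub_sub_cancel] at this
    exact this
  simp only [Equiv.subLeft_apply, analyticOrderNatAt, h2]

end ZeroMultiset

/-! ### Zeros of a Dirichlet series: almost periodicity, counting, vertical lines avoiding zeros -/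

section DirichletZeros

open Complex

variable {ι W : Type*} {a : ι → ℂ} {lam : W → ℝ} {q : W → ℂ} {B H : ℝ}

/-- This is the continuous extension to torus × ℝ of the convolution with the zero measure, which
itself lives on the orbit. -/
lemma continuous_zeroSum_dirichletSum [Countable W] (hlam : Function.Injective lam) (hb : ∀ w, |lam w| ≤ B)
    (hq : Summable fun w => ‖q w‖) {v : W} (hv : q v ≠ 0) {φ : ℂ → ℂ} (hφ : Continuous φ)
    (hφc : HasCompactSupport φ) :
    Continuous fun p : (W → Circle) × ℝ =>
      zeroSum (fun w => dirichletSum lam (fun w => q w * p.1 w) (p.2 * I - w)) φ := by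
  rw [continuous_iff_continuousAt]
  intro p
  have hmap : Continuous fun x : ((W → Circle) × ℝ) × ℂ => (x.1.1, (x.1.2 : ℂ) * I - x.2) := by
    fun_prop
  have hdiff : ∀ p : (W → Circle) × ℝ,
      Differentiable ℂ (dirichletSum lam fun w => q w * p.1 w) := fun p =>
    differentiable_dirichletSum hb (summable_norm_mul_circle hq p.1)
  refine continuousAt_zeroSum
    (F := fun (p : (W → Circle) × ℝ) w => dirichletSum lam (fun w => q w * p.1 w) (p.2 * I - w))
    (fun p => (hdiff p).comp (by fun_prop))
    ((continuous_uncurry_dirichletSum hb hq).comp hmap) ?_ ?_ hφ hφc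
  · refine ((continuous_uncurry_deriv_dirichletSum hb hq).comp hmap).neg.congr fun x => ?_
    have h1 : HasDerivAt (fun w : ℂ => (x.1.2 : ℂ) * I - w) (-1) x.2 :=
      (hasDerivAt_id _).const_sub _
    have h2 := ((hdiff x.1) ((x.1.2 : ℂ) * I - x.2)).hasDerivAt.comp x.2 h1
    simp only [Function.uncurry, Function.comp_def] at h2 ⊢
    rw [h2.deriv, mul_neg_one]
    rfl
  · obtain ⟨z, hz⟩ := exists_dirichletSum_ne_zero hlam (summable_norm_mul_circle hq p.1)
      (v := v) (mul_ne_zero hv (Circle.coe_ne_zero _))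
    exact ⟨p.2 * I - z, by simpa using hz⟩

lemma zeroSum_sub_eq (φ : ℂ → ℂ) (z : ℂ) :
    zeroSum (fun w => dirichletSum lam q (z - w)) φ =
      zeroSum (fun w => dirichletSum lam (fun w => q w * torusLine lam z.re w) (z.im * I - w)) φ := by
  congr 1
  ext w
  rw [dirichletSum_torusLine]
  congr 1
  conv_lhs => rw [← re_add_im z]
  ring

lemma isAlmostPeriodicMultiset_of_dirichletSum [Countable W] (hlam : Function.Injective lam)
    (hb : ∀ w, |lam w| ≤ B) (hq : Summable fun w => ‖q w‖) {v : W} (hv : q v ≠ 0)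
    (ha : IsZeroMultiset a (dirichletSum lam q)) : IsAlmostPeriodicMultiset a := by
  have hQ := differentiable_dirichletSum hb hq
  have := ha.countable hQ
  refine ⟨fun K hK => ha.finite_mem_of_isCompact hQ hK, fun φ hφ hφc => ?_⟩
  have h1 := isAlmostPeriodicFun_of_compact_group (e := torusLine lam) torusLine_add
    continuous_torusLine (continuous_zeroSum_dirichletSum hlam hb hq hv hφ hφc)
  convert h1 using 2 with z
  have h2 := ha.hasSum_sub hQ hφc z
  rw [(integrable_pointMeasure (f := fun w => φ (z - w)) h2.summable.norm).2, h2.tsum_eq,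
    zeroSum_sub_eq]

lemma exists_card_le_of_dirichletSum [Countable W] (hlam : Function.Injective lam)
    (hb : ∀ w, |lam w| ≤ B) (hq : Summable fun w => ‖q w‖) {v : W} (hv : q v ≠ 0)
    (ha : IsZeroMultiset a (dirichletSum lam q)) (R : ℝ) :
    ∃ C : ℝ, ∀ (x : ℝ) (T : Finset ι), (∀ n ∈ T, ‖(x : ℂ) - a n‖ ≤ R) → (T.card : ℝ) ≤ C := by
  -- A continuous cutoff equal to `1` for `‖z‖ ≤ R` and to `0` for `‖z‖ ≥ R + 1`. Its zero sum
  -- dominates the count and is bounded on the compact torus.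
  set ψ : ℂ → ℝ := fun z => max 0 (1 - max 0 (‖z‖ - R))
  have hψ0 : ∀ z, 0 ≤ ψ z := fun z => le_max_left _ _
  have hψ1 : ∀ z, ‖z‖ ≤ R → ψ z = 1 := fun z hz => by
    simp [ψ, max_eq_left (sub_nonpos.2 hz)]
  set φ : ℂ → ℂ := fun z => (ψ z : ℂ)
  have hφ : Continuous φ := by fun_prop
  have hφc : HasCompactSupport φ := by
    refine HasCompactSupport.intro (isCompact_closedBall 0 (R + 1)) fun z hz => ?_
    have : R + 1 < ‖z‖ := by simpa using hz
    have h2 : ψ z = 0 := by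
      simp only [ψ]
      rw [max_eq_right (a := 0) (b := ‖z‖ - R) (by linarith), max_eq_left (by linarith)]
    simp [φ, h2]
  have hcont := continuous_zeroSum_dirichletSum hlam hb hq hv hφ hφc
  obtain ⟨C, hC⟩ := ((isCompact_univ (X := W → Circle)).prod
    (isCompact_singleton (x := (0 : ℝ)))).exists_bound_of_continuousOn hcont.continuousOn
  refine ⟨C, fun x T hT => ?_⟩
  have h1 := ha.hasSum_sub (differentiable_dirichletSum hb hq) hφc x
  have h2 := hC (torusLine lam x, 0) ⟨Set.mem_univ _, rfl⟩
  rw [zeroSum_sub_eq] at h1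
  simp only [ofReal_re, ofReal_im] at h1
  have h3 := hasSum_re h1
  simp only [φ, ofReal_re] at h3
  calc (T.card : ℝ) = ∑ n ∈ T, ψ (x - a n) := by
        rw [Finset.sum_congr rfl fun n hn => hψ1 _ (hT n hn)]; simp
    _ ≤ _ := sum_le_hasSum T (fun n _ => hψ0 _) h3
    _ ≤ ‖_‖ := re_le_norm _
    _ ≤ C := h2

lemma summable_inv_one_add_sq_int : Summable fun k : ℤ => (1 + (k : ℝ) ^ 2)⁻¹ := by
  refine Summable.of_norm_bounded_eventually
    (Real.summable_one_div_int_pow.2 (one_lt_two : 1 < 2)) ?_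
  rw [Filter.eventually_cofinite]
  refine (Set.finite_singleton (0 : ℤ)).subset fun k hk => ?_
  by_contra h0
  refine hk ?_
  have hk0 : (0 : ℝ) < (k : ℝ) ^ 2 := by
    have : (k : ℝ) ≠ 0 := by exact_mod_cast h0
    positivity
  rw [Real.norm_of_nonneg (by positivity), one_div]
  exact inv_anti₀ hk0 (by linarith)

/-- Zeros are grouped by the integer part `k` of their real part. Each group lies within `H + 1 ≤ R`
of `k`, so it has at most `C` members, and `(1 + x²)⁻¹ ≤ 3 (1 + k²)⁻¹` for `k ≤ x < k + 1`. -/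
lemma summable_inv_one_add_re_sq {R : ℝ} (haH : ∀ n, a n ∈ closedStrip H)
    (hR : ∃ C : ℝ, ∀ (x : ℝ) (T : Finset ι), (∀ n ∈ T, ‖(x : ℂ) - a n‖ ≤ R) → (T.card : ℝ) ≤ C)
    (hHR : H + 1 ≤ R) : Summable fun n => (1 + (a n).re ^ 2)⁻¹ := by
  classical
  obtain ⟨C, hC⟩ := hR
  have hC0 : 0 ≤ C := by simpa using hC 0 ∅ (by simp)
  set κ : ι → ℤ := fun n => ⌊(a n).re⌋
  refine summable_of_sum_le (c := ∑' k : ℤ, C * (3 * (1 + (k : ℝ) ^ 2)⁻¹))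
    (fun n => by positivity) fun T => ?_
  have hs : Summable fun k : ℤ => C * (3 * (1 + (k : ℝ) ^ 2)⁻¹) :=
    (summable_inv_one_add_sq_int.mul_left 3).mul_left C
  rw [← Finset.sum_fiberwise_of_maps_to (g := κ) (t := T.image κ)
    fun n hn => Finset.mem_image_of_mem _ hn]
  refine le_trans (Finset.sum_le_sum fun k _ => ?_) (hs.sum_le_tsum _ fun _ _ => by positivity)
  have hterm : ∀ n ∈ T.filter (κ · = k), (1 + (a n).re ^ 2)⁻¹ ≤ 3 * (1 + (k : ℝ) ^ 2)⁻¹ := by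
    intro n hn
    have hk : ⌊(a n).re⌋ = k := (Finset.mem_filter.1 hn).2
    have h1 : (k : ℝ) ≤ (a n).re := hk ▸ Int.floor_le _
    have h2 : (a n).re < k + 1 := hk ▸ Int.lt_floor_add_one _
    rw [← div_eq_mul_inv, inv_le_comm₀ (by positivity) (by positivity), inv_div,
      div_le_iff₀ (by norm_num)]
    nlinarith [sq_nonneg ((a n).re + (k - (a n).re)), sq_nonneg ((a n).re - (k - (a n).re))]
  refine (Finset.sum_le_card_nsmul _ _ _ hterm).trans ?_
  rw [nsmul_eq_mul]
  refine mul_le_mul_of_nonneg_right (hC k _ fun n hn => ?_) (by positivity)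
  have hk : ⌊(a n).re⌋ = k := (Finset.mem_filter.1 hn).2
  have h1 : (k : ℝ) ≤ (a n).re := hk ▸ Int.floor_le _
  have h2 : (a n).re < k + 1 := hk ▸ Int.lt_floor_add_one _
  refine (norm_le_abs_re_add_abs_im _).trans ?_
  have h3 : |((k : ℝ) - a n : ℂ).re| ≤ 1 := by
    rw [sub_re, ofReal_re, abs_le]; constructor <;> linarith
  have h4 : |((k : ℝ) - a n : ℂ).im| ≤ H := by
    rw [sub_im, ofReal_im, zero_sub, abs_neg]; exact haH n
  linarith

/-- Each zero in the disc of radius `r` contributes at least `(1 + r²)⁻¹` to the convergent sum `S`,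
so there are at most `(1 + r²) S` of them. -/
lemma hasPolynomialGrowth_pointMeasure
    (hfin : ∀ K : Set ℂ, IsCompact K → {n | a n ∈ K}.Finite)
    (hsum : Summable fun n => (1 + (a n).re ^ 2)⁻¹) : HasPolynomialGrowth (pointMeasure a) := by
  classical
  set T : ℝ → Finset ι := fun r => (hfin _ (isCompact_closedBall (0 : ℂ) r)).toFinset
  have hT : ∀ r n, n ∈ T r ↔ ‖a n‖ ≤ r := by simp [T]
  have hμ : ∀ r, pointMeasure a (Metric.closedBall 0 r) = ((T r).card : ENNReal) := by
    intro r
    rw [pointMeasure, Measure.sum_apply _ measurableSet_closedBall]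
    simp only [Measure.dirac_apply' _ measurableSet_closedBall]
    rw [tsum_eq_sum (s := T r) fun n hn => ?_]
    · rw [Finset.sum_congr rfl (g := fun _ => 1) fun n hn => ?_]
      · simp
      · exact Set.indicator_of_mem (by simpa using (hT r n).1 hn) _
    · refine Set.indicator_of_notMem ?_ _
      simpa using fun h => hn ((hT r n).2 h)
  refine ⟨fun r => by rw [hμ]; exact ENNReal.natCast_lt_top _, ?_⟩
  have hreal : ∀ r, (pointMeasure a).real (Metric.closedBall 0 r) = (T r).card := fun r => by
    simp [Measure.real, hμ]
  simp only [hreal]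
  set S := ∑' n, (1 + (a n).re ^ 2)⁻¹
  have hS : 0 ≤ S := tsum_nonneg fun n => by positivity
  have hcard : ∀ r, ((T r).card : ℝ) ≤ (1 + r ^ 2) * S := by
    intro r
    have h1 : ((T r).card : ℝ) ≤ ∑ n ∈ T r, (1 + r ^ 2) * (1 + (a n).re ^ 2)⁻¹ := by
      rw [Finset.card_eq_sum_ones, Nat.cast_sum]
      refine Finset.sum_le_sum fun n hn => ?_
      rw [Nat.cast_one, ← div_eq_mul_inv, le_div_iff₀ (by positivity), one_mul]
      have h2 := (abs_re_le_norm (a n)).trans ((hT r n).1 hn)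
      have h3 := pow_le_pow_left₀ (abs_nonneg _) h2 2
      rw [sq_abs] at h3
      linarith
    rw [← Finset.mul_sum] at h1
    exact h1.trans (mul_le_mul_of_nonneg_left
      (hsum.sum_le_tsum _ fun _ _ => by positivity) (by positivity))
  refine Asymptotics.IsBigO.of_bound 3 ?_
  -- For `r ≥ 1` and `r ≥ 2S` one has `(1 + r²) S ≤ 2r² S ≤ r³`, whence the constant `3`.
  filter_upwards [eventually_ge_atTop (2 * S), eventually_ge_atTop (1 : ℝ)] with r hr1 hr2
  have hlogr : 0 ≤ Real.log r := Real.log_nonneg hr2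
  rw [Real.norm_of_nonneg (Real.log_natCast_nonneg _), Real.norm_of_nonneg hlogr]
  rcases Nat.eq_zero_or_pos (T r).card with h0 | hpos
  · rw [h0]; simp; positivity
  · have h1 : ((T r).card : ℝ) ≤ r ^ 3 := by
      refine (hcard r).trans ?_
      nlinarith [mul_nonneg hS (by nlinarith : 0 ≤ r ^ 2 - 1), sq_nonneg r]
    calc Real.log (T r).card ≤ Real.log (r ^ 3) :=
          Real.log_le_log (by exact_mod_cast hpos) h1
      _ = 3 * Real.log r := by rw [Real.log_pow]; norm_num

/-- For one twist `u`, an abscissa in `[0, 1]` avoids the real parts of the finitely many zeros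
nearby, and by the tube lemma the same abscissa works near `u`. Compactness of the torus makes the
lower bound uniform; the twist by `torusLine lam x` then serves `[x, x + 1]`. -/
lemma exists_vertical_line_bound [Countable W] (hlam : Function.Injective lam) (hb : ∀ w, |lam w| ≤ B)
    (hq : Summable fun w => ‖q w‖) {v : W} (hv : q v ≠ 0) (s : ℝ) :
    ∃ c > 0, ∀ x : ℝ, ∃ x' ∈ Set.Icc x (x + 1), ∀ y : ℝ, |y| ≤ s →
      c ≤ ‖dirichletSum lam q (x' + y * I)‖ := by
  have hcont := continuous_uncurry_dirichletSum hb hq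
  obtain ⟨c, hc, hle⟩ := (isCompact_univ (X := W → Circle)).induction_on
    (p := fun A => ∃ c > 0, ∀ u ∈ A, ∃ x' ∈ Set.Icc (0 : ℝ) 1, ∀ y : ℝ, |y| ≤ s →
      c ≤ ‖dirichletSum lam (fun w => q w * u w) (x' + y * I)‖)
    ⟨1, one_pos, by simp⟩
    (fun A A' hAA' ⟨c, hc, h⟩ => ⟨c, hc, fun u hu => h u (hAA' hu)⟩)
    (fun A A' ⟨c, hc, h⟩ ⟨c', hc', h'⟩ => ⟨min c c', lt_min hc hc', fun u hu => by
      rcases hu with hu | hu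
      · obtain ⟨x', hx', hy⟩ := h u hu
        exact ⟨x', hx', fun y hys => (min_le_left _ _).trans (hy y hys)⟩
      · obtain ⟨x', hx', hy⟩ := h' u hu
        exact ⟨x', hx', fun y hys => (min_le_right _ _).trans (hy y hys)⟩⟩)
    (fun u _ => by
      have hdu := differentiable_dirichletSum hb (summable_norm_mul_circle hq u)
      have hnu := exists_dirichletSum_ne_zero hlam (summable_norm_mul_circle hq u)
        (v := v) (mul_ne_zero hv (Circle.coe_ne_zero _))
      have hK : IsCompact (Set.Icc (0 : ℝ) 1 ×ℂ Set.Icc (-s) s) :=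
        isCompact_Icc.reProdIm isCompact_Icc
      have hfin := (finite_zeros_of_isCompact hdu hnu hK).image re
      obtain ⟨x', hx', hx'n⟩ := (Set.Icc_infinite (zero_lt_one' ℝ)).exists_notMem_finite hfin
      have hne : ∀ y ∈ Set.Icc (-s) s,
          dirichletSum lam (fun w => q w * u w) (x' + y * I) ≠ 0 := by
        intro y hy h0
        exact hx'n ⟨x' + y * I, ⟨by simpa [mem_reProdIm] using ⟨hx', hy⟩, h0⟩, by simp⟩
      rcases (Set.Icc (-s) s).eq_empty_or_nonempty with hem | hnem
      · refine ⟨Set.univ, univ_mem, 1, one_pos, fun u _ => ⟨x', hx', fun y hy => ?_⟩⟩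
        exact absurd (abs_le.1 hy) (Set.eq_empty_iff_forall_notMem.1 hem y)
      · have hcl : Continuous fun y : ℝ =>
            ‖dirichletSum lam (fun w => q w * u w) (x' + y * I)‖ :=
          (hdu.continuous.comp (by fun_prop)).norm
        obtain ⟨y₀, hy₀, hmin⟩ := isCompact_Icc.exists_isMinOn hnem hcl.continuousOn
        set m := ‖dirichletSum lam (fun w => q w * u w) (x' + y₀ * I)‖
        have hm : 0 < m := norm_pos_iff.2 (hne y₀ hy₀)
        have hopen : IsOpen {p : (W → Circle) × ℝ |
            m / 2 < ‖dirichletSum lam (fun w => q w * p.1 w) (x' + p.2 * I)‖} :=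
          isOpen_lt continuous_const (hcont.comp (by fun_prop :
            Continuous fun p : (W → Circle) × ℝ => (p.1, (x' : ℂ) + p.2 * I))).norm
        obtain ⟨U, V, hU, -, hsU, hV, hUV⟩ := generalized_tube_lemma
          (isCompact_singleton (x := u)) (isCompact_Icc (a := -s) (b := s)) hopen (by
            rintro ⟨u', y⟩ ⟨hu', hy⟩
            cases hu'
            exact (half_lt_self hm).trans_le (hmin hy))
        refine ⟨U, mem_nhdsWithin_of_mem_nhds (hU.mem_nhds (hsU rfl)), m / 2, half_pos hm,
          fun u' hu' => ⟨x', hx', fun y hy => ?_⟩⟩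
        exact le_of_lt (hUV (Set.mk_mem_prod hu' (hV (abs_le.1 hy)))))
  refine ⟨c, hc, fun x => ?_⟩
  obtain ⟨x', hx', hy⟩ := hle (torusLine lam x) (Set.mem_univ _)
  refine ⟨x + x', ⟨by linarith [hx'.1], by linarith [hx'.2]⟩, fun y hys => ?_⟩
  have := hy y hys
  rw [dirichletSum_torusLine] at this
  convert this using 3
  push_cast; ring

end DirichletZeros

end

noncomputable section

/-! ### The trace formula -/

section TraceFormula

open Complex

variable {ι : Type*} {a : ι → ℂ} {Q h : ℂ → ℂ} {H s C M D : ℝ}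

lemma tendsto_inv_one_add_sq_nat (c : ℝ) :
    Tendsto (fun k : ℕ => c * (1 + (k : ℝ) ^ 2)⁻¹) atTop (𝓝 0) := by
  have h1 : Tendsto (fun k : ℕ => 1 + (k : ℝ) ^ 2) atTop atTop :=
    tendsto_atTop_add_const_left _ _
      ((tendsto_pow_atTop two_ne_zero).comp tendsto_natCast_atTop_atTop)
  simpa using h1.inv_tendsto_atTop.const_mul c

lemma IsZeroMultiset.ne_zero_of_lt_abs_im (ha : IsZeroMultiset a Q) (hQ : Differentiable ℂ Q)
    (haH : ∀ n, a n ∈ closedStrip H) {z : ℂ} (hz : H < |z.im|) : Q z ≠ 0 := by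
  intro h0
  obtain ⟨n, rfl⟩ := ha.exists_eq hQ h0
  exact absurd (haH n) (not_le.2 hz)

/-- The sum of `h` over the zeros of `Q` as a difference of integrals over two horizontal lines. -/
lemma two_pi_I_mul_tsum_eq (hQ : Differentiable ℂ Q) (hh : Differentiable ℂ h)
    (ha : IsZeroMultiset a Q) (haH : ∀ n, a n ∈ closedStrip H) (hHs : H < s) (hs : 0 < s)
    (hC : ∀ z : ℂ, |z.im| ≤ s → ‖h z‖ ≤ C * (1 + z.re ^ 2)⁻¹)
    (hsum : Summable fun n => (1 + (a n).re ^ 2)⁻¹)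
    (hM : ∀ z : ℂ, |z.im| = s → ‖logDeriv Q z‖ ≤ M)
    (hD : ∀ z : ℂ, |z.im| ≤ s → ‖deriv Q z‖ ≤ D)
    (hline : ∃ c > 0, ∀ x : ℝ, ∃ x' ∈ Set.Icc x (x + 1), ∀ y : ℝ, |y| ≤ s →
      c ≤ ‖Q (x' + y * I)‖) :
    2 * Real.pi * I * ∑' n, h (a n) =
      (∫ x : ℝ, h (x + (-s : ℝ) * I) * logDeriv Q (x + (-s : ℝ) * I)) -
        ∫ x : ℝ, h (x + s * I) * logDeriv Q (x + s * I) := by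
  classical
  obtain ⟨c, hc, hline⟩ := hline
  choose X hXmem hX using hline
  -- The vertical sides lie in `[-k - 1, -k]` and `[k, k + 1]`, on lines where `‖Q‖ ≥ c`.
  set x₁ : ℕ → ℝ := fun k => X (-(k : ℝ) - 1)
  set x₂ : ℕ → ℝ := fun k => X k
  have hx₁ : ∀ k, x₁ k ≤ -(k : ℝ) := fun k => by linarith [(hXmem (-(k : ℝ) - 1)).2]
  have hx₂ : ∀ k : ℕ, (k : ℝ) ≤ x₂ k := fun k => (hXmem k).1
  have hx₁₂ : ∀ k, x₁ k ≤ x₂ k := fun k => by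
    linarith [hx₁ k, hx₂ k, (Nat.cast_nonneg k : (0 : ℝ) ≤ k)]
  have hx₁t : Tendsto x₁ atTop atBot :=
    tendsto_atBot_mono hx₁ (tendsto_neg_atTop_atBot.comp tendsto_natCast_atTop_atTop)
  have hx₂t : Tendsto x₂ atTop atTop := tendsto_atTop_mono hx₂ tendsto_natCast_atTop_atTop
  have hss : -s ≤ s := by linarith
  have hne : ∀ z : ℂ, |z.im| = s → Q z ≠ 0 := fun z hz =>
    ha.ne_zero_of_lt_abs_im hQ haH (hz ▸ hHs)
  -- the sums over the zeros in the rectangles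
  have hrect : ∀ k, rectangleIntegral (fun z => h z * logDeriv Q z) (x₁ k) (x₂ k) (-s) s =
      2 * Real.pi * I * ∑' n, (if (a n).re ∈ Set.Icc (x₁ k) (x₂ k) then h (a n) else 0) := by
    intro k
    have hK : IsCompact (Set.Icc (x₁ k) (x₂ k) ×ℂ Set.Icc (-s) s) :=
      isCompact_Icc.reProdIm isCompact_Icc
    set S := (finite_zeros_of_isCompact hQ ha.exists_ne_zero hK).toFinset
    have hS : ∀ z, z ∈ S ↔ z ∈ Set.Icc (x₁ k) (x₂ k) ×ℂ Set.Icc (-s) s ∧ Q z = 0 := by simp [S]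
    rw [rectangleIntegral_mul_logDeriv (hx₁₂ k) hss hh hQ ?_ hS]
    · congr 1
      have h1 := ha.hasSum_comp (S := S)
        (f := fun z => if z.re ∈ Set.Icc (x₁ k) (x₂ k) then h z else 0) fun n hn => by
          refine if_neg fun hre => hn ((hS _).2 ⟨mem_reProdIm.2 ⟨hre, ?_⟩, ha.map_eq_zero hQ n⟩)
          exact abs_le.1 ((haH n).trans hHs.le)
      rw [h1.tsum_eq]
      refine Finset.sum_congr rfl fun z hz => ?_
      rw [if_pos (mem_reProdIm.1 ((hS z).1 hz).1).1]
    · rintro z ⟨⟨-, hzi⟩, hz⟩ h0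
      have hzs : |z.im| ≤ s := abs_le.2 hzi
      have hvert : ∀ x, z.re = X x → False := fun x hx => by
        have h1 := hX x z.im hzs
        rw [← hx, re_add_im, h0, norm_zero] at h1
        linarith
      rcases hz with hz | hz | hz | hz
      · exact hvert _ hz
      · exact hvert _ hz
      · exact hne z (by rw [hz, abs_neg, abs_of_pos hs]) h0
      · exact hne z (by rw [hz, abs_of_pos hs]) h0
  have hlim1 : Tendsto (fun k => rectangleIntegral (fun z => h z * logDeriv Q z)
      (x₁ k) (x₂ k) (-s) s) atTop (𝓝 (2 * Real.pi * I * ∑' n, h (a n))) := by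
    simp only [hrect]
    refine Tendsto.const_mul _ ?_
    refine tendsto_tsum_of_dominated_convergence (hsum.mul_left C) (fun n => ?_)
      (Eventually.of_forall fun k n => ?_)
    · refine tendsto_const_nhds.congr' ?_
      filter_upwards [hx₁t.eventually_le_atBot (a n).re, hx₂t.eventually_ge_atTop (a n).re]
        with k h1 h2
      rw [if_pos ⟨h1, h2⟩]
    · have h1 := hC (a n) ((haH n).trans hHs.le)
      split_ifs
      · exact h1
      · rw [norm_zero]; exact (norm_nonneg _).trans h1
  -- the horizontal sides
  have hhor : ∀ y : ℝ, |y| = s → Tendsto (fun k => ∫ x in x₁ k..x₂ k,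
      h (x + y * I) * logDeriv Q (x + y * I)) atTop
      (𝓝 (∫ x : ℝ, h (x + y * I) * logDeriv Q (x + y * I))) := by
    intro y hy
    have him : ∀ x : ℝ, |((x : ℂ) + y * I).im| = s := fun x => by simpa using hy
    refine intervalIntegral_tendsto_integral ?_ hx₁t hx₂t
    refine integrable_of_norm_le_inv_one_add_sq (C := C * M) ?_ fun x => ?_
    · refine (hh.continuous.comp (by fun_prop)).mul (Continuous.div ?_ ?_ fun x => hne _ (him x))
      · exact hQ.deriv.continuous.comp (by fun_prop)
      · exact hQ.continuous.comp (by fun_prop)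
    · have h1 := hC (x + y * I) (him x).le
      have h2 := hM (x + y * I) (him x)
      have h3 : ((x : ℂ) + y * I).re = x := by simp
      rw [h3] at h1
      rw [norm_mul]
      calc _ ≤ C * (1 + x ^ 2)⁻¹ * M := mul_le_mul h1 h2 (norm_nonneg _) ((norm_nonneg _).trans h1)
        _ = _ := by ring
  -- the vertical sides
  have hC0 : 0 ≤ C := by
    have := (norm_nonneg _).trans (hC 0 (by simpa using hs.le))
    simpa using this
  -- On these sides `‖Q'/Q‖ ≤ D / c`, while `h` is `O(k⁻²)`, and the length does not depend on `k`.
  have hver : ∀ x : ℕ → ℝ, (∀ k : ℕ, (k : ℝ) ^ 2 ≤ x k ^ 2) →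
      (∀ k, ∀ y : ℝ, |y| ≤ s → c ≤ ‖Q (x k + y * I)‖) →
      Tendsto (fun k => I * ∫ y in (-s)..s, h (x k + y * I) * logDeriv Q (x k + y * I)) atTop
        (𝓝 0) := by
    intro x hxk hxc
    refine squeeze_zero_norm (fun k => ?_) (tendsto_inv_one_add_sq_nat (C * (D / c) * |s - -s|))
    rw [norm_mul, norm_I, one_mul]
    have h1 := intervalIntegral.norm_integral_le_of_norm_le_const (a := -s) (b := s)
      (f := fun y : ℝ => h (x k + y * I) * logDeriv Q (x k + y * I))
      (C := C * (1 + (k : ℝ) ^ 2)⁻¹ * (D / c)) fun y hy => ?_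
    · refine h1.trans (le_of_eq (by ring))
    · rw [Set.uIoc_of_le hss] at hy
      have hys : |y| ≤ s := abs_le.2 ⟨hy.1.le, hy.2⟩
      have him : |((x k : ℂ) + y * I).im| ≤ s := by simpa using hys
      have h2 := hC _ him
      have h3 : ((x k : ℂ) + y * I).re = x k := by simp
      rw [h3] at h2
      have h4 : C * (1 + x k ^ 2)⁻¹ ≤ C * (1 + (k : ℝ) ^ 2)⁻¹ := by
        gcongr C * ?_
        exact inv_anti₀ (by positivity) (by linarith [hxk k])
      have h5 : ‖logDeriv Q (x k + y * I)‖ ≤ D / c := by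
        rw [logDeriv_apply, norm_div]
        have hD' := hD _ him
        exact div_le_div₀ ((norm_nonneg _).trans hD') hD' hc (hxc k y hys)
      rw [norm_mul]
      exact mul_le_mul (h2.trans h4) h5 (norm_nonneg _) (by positivity)
  have hv1 := hver x₁ (fun k => by
    have h0 : (0 : ℝ) ≤ k := Nat.cast_nonneg k
    nlinarith [hx₁ k]) fun k y hy => hX _ y hy
  have hv2 := hver x₂ (fun k => by
    have h0 : (0 : ℝ) ≤ k := Nat.cast_nonneg k
    nlinarith [hx₂ k]) fun k y hy => hX _ y hy
  have hlim2 := (((hhor (-s) (by rw [abs_neg, abs_of_pos hs])).sub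
    (hhor s (abs_of_pos hs))).add hv2).sub hv1
  rw [add_zero, sub_zero] at hlim2
  exact tendsto_nhds_unique hlim1 hlim2

/-- Termwise integration of a Dirichlet series against `φ̂ᶜ` on a horizontal line. -/
lemma hasSum_integral_cTransform_mul {J : Type*} [Countable J] {φ : ℝ → ℂ}
    (hφ : ContDiff ℝ ∞ φ) (hφc : HasCompactSupport φ) (s : ℝ) {c : J → ℂ} {γ : J → ℝ} {f : ℝ → ℂ}
    (hc : Summable fun j => ‖c j‖ * Real.exp (-(2 * Real.pi * γ j * s)))
    (hf : ∀ x : ℝ, HasSum (fun j => c j * exp (2 * Real.pi * I * (γ j : ℂ) * (x + s * I))) (f x)) :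
    HasSum (fun j => c j * φ (γ j)) (∫ x : ℝ, cTransform φ (x + s * I) * f x) := by
  obtain ⟨C, hC0, hC⟩ := exists_norm_cTransform_le_div hφ hφc |s|
  have hcont : Continuous fun x : ℝ => cTransform φ (x + s * I) :=
    (differentiable_cTransform hφ.continuous hφc).continuous.comp (by fun_prop)
  have hbound : ∀ x : ℝ, ‖cTransform φ (x + s * I)‖ ≤ C * (1 + x ^ 2)⁻¹ := fun x => by
    simpa using hC (x + s * I) (by simp)
  have hnorm : ∀ j (x : ℝ), ‖c j * exp (2 * Real.pi * I * (γ j : ℂ) * (x + s * I))‖ =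
      ‖c j‖ * Real.exp (-(2 * Real.pi * γ j * s)) := fun j x => by
    rw [norm_mul, norm_exp_two_pi_I_mul]; simp
  have hint : ∀ j, Integrable fun x : ℝ => cTransform φ (x + s * I) *
      (c j * exp (2 * Real.pi * I * (γ j : ℂ) * (x + s * I))) := fun j => by
    refine integrable_of_norm_le_inv_one_add_sq
      (C := C * (‖c j‖ * Real.exp (-(2 * Real.pi * γ j * s)))) (hcont.mul (by fun_prop)) fun x => ?_
    rw [norm_mul, hnorm]
    calc _ ≤ C * (1 + x ^ 2)⁻¹ * (‖c j‖ * Real.exp (-(2 * Real.pi * γ j * s))) := by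
          gcongr; exact hbound x
      _ = _ := by ring
  have h1 := hasSum_integral_of_summable_integral_norm hint (by
    simp only [norm_mul (cTransform φ _), hnorm]
    simp only [integral_mul_const]
    exact hc.mul_left _)
  have h2 : ∀ x : ℝ, ∑' j, cTransform φ (x + s * I) *
      (c j * exp (2 * Real.pi * I * (γ j : ℂ) * (x + s * I))) = cTransform φ (x + s * I) * f x :=
    fun x => by rw [tsum_mul_left, (hf x).tsum_eq]
  have h3 : ∀ j, ∫ x : ℝ, cTransform φ (x + s * I) *
      (c j * exp (2 * Real.pi * I * (γ j : ℂ) * (x + s * I))) = c j * φ (γ j) := fun j => by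
    rw [← integral_cTransform_mul_exp hφ hφc s (γ j), ← integral_const_mul]
    exact integral_congr_ae (Eventually.of_forall fun x => mul_left_comm _ _ _)
  simp only [h2, h3] at h1
  exact h1

/-- The surplus height absorbs the factor `L i` produced by differentiation, since `t ≤ e^{kt} / k`
with `k = 2π (s - s₁)`. -/
lemma summable_mul_exp_of_lt {J : Type*} {L : J → ℝ} {d : J → ℂ} {s₁ s : ℝ} (hL : ∀ i, 0 < L i)
    (hd : Summable fun i => ‖d i‖ * Real.exp (-(2 * Real.pi * L i * s₁))) (hs : s₁ < s) :
    (Summable fun i => ‖d i‖ * Real.exp (-(2 * Real.pi * L i * s))) ∧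
      Summable fun i => L i * ‖d i‖ * Real.exp (-(2 * Real.pi * L i * s)) := by
  constructor
  · refine hd.of_nonneg_of_le (fun i => by positivity) fun i => ?_
    have := hL i
    gcongr
  · refine (hd.mul_left (2 * Real.pi * (s - s₁))⁻¹).of_nonneg_of_le
      (fun i => by have := hL i; positivity) fun i => ?_
    have hLi := hL i
    have hk : 0 < 2 * Real.pi * (s - s₁) := mul_pos Real.two_pi_pos (sub_pos.2 hs)
    have h1 := Real.add_one_le_exp (2 * Real.pi * (s - s₁) * L i)
    have h2 : L i ≤ (2 * Real.pi * (s - s₁))⁻¹ * Real.exp (2 * Real.pi * (s - s₁) * L i) := by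
      rw [← div_eq_inv_mul, le_div_iff₀ hk]
      linarith
    have h3 : Real.exp (-(2 * Real.pi * L i * s₁)) =
        Real.exp (2 * Real.pi * (s - s₁) * L i) * Real.exp (-(2 * Real.pi * L i * s)) := by
      rw [← Real.exp_add]; congr 1; ring
    rw [h3]
    calc L i * ‖d i‖ * Real.exp (-(2 * Real.pi * L i * s)) ≤
        ((2 * Real.pi * (s - s₁))⁻¹ * Real.exp (2 * Real.pi * (s - s₁) * L i)) * ‖d i‖ *
          Real.exp (-(2 * Real.pi * L i * s)) := by gcongr
      _ = _ := by ring

end TraceFormula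

end

noncomputable section

/-! ### Push-forward of weighted point masses -/

section FiberSum

variable {J : Type*} {γ : J → ℝ} {c : J → ℂ}

/-- The total mass at `x` of the point masses `c j` placed at `γ j`. -/
def fiberSum (γ : J → ℝ) (c : J → ℂ) (x : ℝ) : ℂ := ∑' j : {j // γ j = x}, c j

/-- A function of the frequency is constant along fibres. Used both for the exponential weights and
for the test function. -/
lemma fiberSum_mul (γ : J → ℝ) (c : J → ℂ) (w : ℝ → ℂ) (x : ℝ) :
    fiberSum γ (fun j => c j * w (γ j)) x = fiberSum γ c x * w x := by
  unfold fiberSum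
  rw [← tsum_mul_right]
  exact tsum_congr fun j => by simp only [j.2]

lemma hasSum_fiberSum {F : ℂ} (hc : HasSum c F) : HasSum (fiberSum γ c) F :=
  HasSum.sigma ((Equiv.sigmaFiberEquiv γ).hasSum_iff.2 hc) fun x =>
    (hc.summable.comp_injective (i := fun j : {j // γ j = x} => (j : J))
      Subtype.val_injective).hasSum

lemma summable_norm_fiberSum (hc : Summable fun j => ‖c j‖) :
    Summable fun x => ‖fiberSum γ c x‖ := by
  have h1 : Summable fun p : Σ x, {j // γ j = x} => ‖c p.2‖ :=
    (Equiv.sigmaFiberEquiv γ).summable_iff.2 hc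
  refine h1.sigma.of_nonneg_of_le (fun _ => norm_nonneg _) fun x => ?_
  exact norm_tsum_le_tsum_norm (h1.sigma_factor x)

lemma summable_norm_fiberSum_mul {w : ℝ → ℂ} (hc : Summable fun j => ‖c j‖ * ‖w (γ j)‖) :
    Summable fun x => ‖fiberSum γ c x‖ * ‖w x‖ := by
  simp only [← norm_mul, ← fiberSum_mul] at hc ⊢
  exact summable_norm_fiberSum hc

lemma support_fiberSum_subset : Function.support (fiberSum γ c) ⊆ Set.range γ := by
  intro x hx
  by_contra hne
  refine hx ?_
  have : IsEmpty {j // γ j = x} := ⟨fun j => hne ⟨j, j.2⟩⟩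
  exact tsum_empty

lemma finite_support_fiberSum_inter (hfin : ∀ R : ℝ, {j | |γ j| ≤ R}.Finite) {K : Set ℝ}
    (hK : IsCompact K) : (Function.support (fiberSum γ c) ∩ K).Finite := by
  obtain ⟨R, hR⟩ := hK.isBounded.exists_norm_le
  refine ((hfin R).image γ).subset ?_
  rintro x ⟨hx, hxK⟩
  obtain ⟨j, rfl⟩ := support_fiberSum_subset hx
  exact ⟨j, hR _ hxK, rfl⟩

end FiberSum

/-! ### Growth of masses summable with an exponential weight -/

section ExponentialWeight

variable {b : ℝ → ℂ} {κ : ℝ}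

lemma summable_norm_of_abs_lt (hκ : 0 ≤ κ) (hb : Summable fun x => ‖b x‖ * Real.exp (-(κ * |x|)))
    (r : ℝ) : (Summable fun x : {x : ℝ // |x| < r} => ‖b x‖) ∧
      ∑' x : {x : ℝ // |x| < r}, ‖b x‖ ≤
        Real.exp (κ * r) * ∑' x, ‖b x‖ * Real.exp (-(κ * |x|)) := by
  have h1 : ∀ x : {x : ℝ // |x| < r},
      ‖b x‖ ≤ Real.exp (κ * r) * (‖b x‖ * Real.exp (-(κ * |(x : ℝ)|))) := fun x => by
    have h2 : 1 ≤ Real.exp (κ * r) * Real.exp (-(κ * |(x : ℝ)|)) := by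
      rw [← Real.exp_add]
      refine Real.one_le_exp ?_
      nlinarith [x.2]
    calc ‖b x‖ = ‖b x‖ * 1 := (mul_one _).symm
      _ ≤ ‖b x‖ * (Real.exp (κ * r) * Real.exp (-(κ * |(x : ℝ)|))) := by gcongr
      _ = _ := by ring
  have h3 : Summable fun x : {x : ℝ // |x| < r} => ‖b x‖ * Real.exp (-(κ * |(x : ℝ)|)) :=
    hb.comp_injective Subtype.val_injective
  have h4 := (h3.mul_left (Real.exp (κ * r))).of_nonneg_of_le (fun _ => norm_nonneg _) h1
  refine ⟨h4, ?_⟩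
  refine (h4.tsum_le_tsum h1 (h3.mul_left _)).trans ?_
  rw [tsum_mul_left]
  gcongr
  exact hb.tsum_subtype_le _ {x : ℝ | |x| < r} fun x => by positivity

lemma isBigO_log_tsum_norm (hκ : 0 ≤ κ) (hb : Summable fun x => ‖b x‖ * Real.exp (-(κ * |x|))) :
    (fun r : ℝ => Real.log (∑' γ : {γ : ℝ // |γ| < r}, ‖b γ‖)) =O[atTop] fun r : ℝ => r := by
  set S : ℝ → ℝ := fun r => ∑' γ : {γ : ℝ // |γ| < r}, ‖b γ‖
  set K := ∑' x, ‖b x‖ * Real.exp (-(κ * |x|))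
  have hS0 : ∀ r, 0 ≤ S r := fun r => tsum_nonneg fun _ => norm_nonneg _
  -- The logarithm has to be bounded from both sides. Unless all the sums vanish, where `log 0 = 0`,
  -- monotonicity keeps `S r` above a fixed positive `S r₀`.
  by_cases h0 : ∀ r, S r = 0
  · change (fun r => Real.log (S r)) =O[atTop] _
    simp only [h0, Real.log_zero]
    exact Asymptotics.isBigO_zero _ _
  push Not at h0
  obtain ⟨r₀, hr₀⟩ := h0
  have hpos : 0 < S r₀ := lt_of_le_of_ne (hS0 _) hr₀.symm
  have hmono : ∀ r, r₀ ≤ r → S r₀ ≤ S r := fun r hr =>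
    (summable_norm_of_abs_lt hκ hb r₀).1.tsum_le_tsum_of_inj
      (fun x => (⟨x, x.2.trans_le hr⟩ : {x : ℝ // |x| < r}))
      (fun _ _ hxy => Subtype.ext (congrArg (Subtype.val : {x : ℝ // |x| < r} → ℝ) hxy))
      (fun _ _ => norm_nonneg _) (fun _ => le_rfl) (summable_norm_of_abs_lt hκ hb r).1
  refine Asymptotics.IsBigO.of_bound (|Real.log (S r₀)| + κ + |Real.log K|) ?_
  filter_upwards [eventually_ge_atTop r₀, eventually_ge_atTop 1] with r hr hr1
  have hSr : 0 < S r := hpos.trans_le (hmono r hr)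
  have hle : S r ≤ Real.exp (κ * r) * K := (summable_norm_of_abs_lt hκ hb r).2
  have hK : 0 < K := pos_of_mul_pos_right (hSr.trans_le hle) (Real.exp_pos _).le
  have h1 : Real.log (S r₀) ≤ Real.log (S r) := Real.log_le_log hpos (hmono r hr)
  have h2 : Real.log (S r) ≤ κ * r + Real.log K := by
    rw [← Real.log_exp (κ * r), ← Real.log_mul (Real.exp_pos _).ne' hK.ne']
    exact Real.log_le_log hSr hle
  have h3 := le_abs_self (Real.log K)
  have h4 := neg_abs_le (Real.log (S r₀))
  have h5 := abs_nonneg (Real.log K)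
  have h6 := abs_nonneg (Real.log (S r₀))
  rw [Real.norm_eq_abs, Real.norm_eq_abs, abs_of_pos (by linarith : 0 < r), abs_le]
  constructor <;> nlinarith

lemma summable_norm_div_of_abs_lt_one (hκ : 0 ≤ κ)
    (hb : Summable fun x => ‖b x / x‖ * Real.exp (-(κ * |x|))) :
    Summable fun γ : {γ : ℝ // 0 < |γ| ∧ |γ| < 1} => ‖b γ / ((γ : ℝ) : ℂ)‖ :=
  (summable_norm_of_abs_lt (b := fun x : ℝ => b x / x) hκ hb 1).1.comp_injective
    (i := fun x : {γ : ℝ // 0 < |γ| ∧ |γ| < 1} => (⟨x, x.2.2⟩ : {x : ℝ // |x| < 1}))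
    fun _ _ hxy => Subtype.ext (congrArg (Subtype.val : {x : ℝ // |x| < 1} → ℝ) hxy)

end ExponentialWeight

end

noncomputable section

/-! ### The c-Fourier transform of the zeros of a Dirichlet series -/

section Coefficients

open Complex

universe u

variable {ι : Type*} {W : Type u} {a : ι → ℂ} {lam : W → ℝ} {q : W → ℂ} {B H : ℝ}

/-- The logarithmic derivative of a Dirichlet series with a least frequency is a Dirichlet series
with nonnegative frequencies on some upper half-plane. -/
lemma exists_hasSum_logDeriv [Countable W] (hlam : Function.Injective lam) (hb : ∀ w, |lam w| ≤ B)
    (hq : Summable fun w => ‖q w‖) {w₀ : W} (hq0 : q w₀ ≠ 0) (hmin : ∀ w, lam w₀ ≤ lam w) :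
    ∃ (J : Type u) (_ : Countable J) (L : J → ℝ) (c : J → ℂ) (s₁ : ℝ), (∀ i, 0 ≤ L i) ∧
      (∀ s, s₁ < s → (Summable fun i => ‖c i‖ * Real.exp (-(2 * Real.pi * s * L i))) ∧
        Summable fun i => ‖c i / L i‖ * Real.exp (-(2 * Real.pi * s * L i))) ∧
      (Finite W → ∀ R, {i | L i ≤ R}.Finite) ∧
      ∀ z : ℂ, s₁ < z.im →
        HasSum (fun i => c i * exp (2 * Real.pi * I * (L i : ℂ) * z))
          (logDeriv (dirichletSum lam q) z) := by
  obtain ⟨J, hJ, L, d, s₁, hL, hd, hfin, hexp⟩ := exists_logDeriv_expansion hlam hb hq hq0 hmin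
  -- The extra index carries the constant `2πi lam w₀` contributed by the leading exponential, at
  -- frequency `0`. Its quotient by the frequency is `0` by convention; in the other quotients the
  -- factor `L i` cancels.
  refine ⟨PUnit ⊕ J, inferInstance, Sum.elim (fun _ => 0) L,
    Sum.elim (fun _ => 2 * Real.pi * I * (lam w₀ : ℂ)) fun i => 2 * Real.pi * I * (L i : ℂ) * d i,
    s₁, ?_, fun s hs => ?_, fun hW R => ?_, fun z hz => ?_⟩
  · rintro (_ | i)
    · exact le_rfl
    · exact (hL i).le
  · obtain ⟨h1, h2⟩ := summable_mul_exp_of_lt hL hd hs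
    have hnorm : ∀ i, ‖(2 * Real.pi * I * (L i : ℂ) * d i : ℂ)‖ = 2 * Real.pi * (L i * ‖d i‖) := by
      intro i
      simp [abs_of_pos Real.pi_pos, abs_of_pos (hL i)]; ring
    constructor
    · refine Summable.sum _ Summable.of_finite ?_
      refine (h2.mul_left (2 * Real.pi)).congr fun i => ?_
      simp only [Function.comp_apply, Sum.elim_inr, hnorm]
      rw [mul_right_comm _ s]
      ring
    · refine Summable.sum _ Summable.of_finite ?_
      refine (h1.mul_left (2 * Real.pi)).congr fun i => ?_
      simp only [Function.comp_apply, Sum.elim_inr, norm_div, hnorm, norm_real, Real.norm_eq_abs,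
        abs_of_pos (hL i)]
      rw [mul_right_comm _ s]
      have := hL i
      field_simp
  · have := ((hfin hW R).image Sum.inr).union (Set.finite_range (Sum.inl : PUnit.{u+1} → PUnit ⊕ J))
    refine this.subset ?_
    rintro (i | i) hi
    · exact Or.inr ⟨i, rfl⟩
    · exact Or.inl ⟨i, hi, rfl⟩
  · rw [← add_sub_cancel (2 * Real.pi * I * (lam w₀ : ℂ)) (logDeriv (dirichletSum lam q) z)]
    refine HasSum.sum ?_ (hexp z hz).2
    refine (hasSum_unique fun _ : PUnit.{u + 1} => (2 * Real.pi * I * (lam w₀ : ℂ) : ℂ)).congr_fun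
      fun i => ?_
    simp

/-- The sum of `φ̂ᶜ` over the zeros of a Dirichlet series is a sum of values of `φ`. -/
lemma exists_cFourier_hasSum [Countable W] [Nonempty W] (hlam : Function.Injective lam)
    (hb : ∀ w, |lam w| ≤ B) (hq : Summable fun w => ‖q w‖) (hq0 : ∀ w, q w ≠ 0)
    (ha : IsZeroMultiset a (dirichletSum lam q)) (haH : ∀ n, a n ∈ closedStrip H)
    (hsum : Summable fun n => (1 + (a n).re ^ 2)⁻¹) :
    ∃ (J : Type u) (_ : Countable J) (γ : J → ℝ) (c : J → ℂ) (κ : ℝ), 0 ≤ κ ∧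
      (Summable fun j => ‖c j‖ * Real.exp (-(κ * |γ j|))) ∧
      (Summable fun j => ‖c j / γ j‖ * Real.exp (-(κ * |γ j|))) ∧
      (Finite W → ∀ R, {j | |γ j| ≤ R}.Finite) ∧
      ∀ φ : ℝ → ℂ, ContDiff ℝ ∞ φ → HasCompactSupport φ →
        Integrable (cTransform φ) (pointMeasure a) ∧
          HasSum (fun j => c j * φ (γ j)) (cFourier (pointMeasure a) φ) := by
  set Q := dirichletSum lam q with hQdef
  have hQ : Differentiable ℂ Q := differentiable_dirichletSum hb hq
  have := ha.countable hQ
  -- The lower half-plane is handled by `z ↦ -z`, which negates the spectrum, so that a greatest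
  -- frequency becomes a least one.
  have hlam' : Function.Injective fun w => -lam w := neg_injective.comp hlam
  have hb' : ∀ w, |-lam w| ≤ B := fun w => by rw [abs_neg]; exact hb w
  have hneg : ∀ z, dirichletSum (fun w => -lam w) q z = Q (-z) := fun z => by
    simp only [hQdef, dirichletSum]
    refine tsum_congr fun w => ?_
    congr 2
    push_cast; ring
  have hne : ∀ z : ℂ, H < |z.im| → Q z ≠ 0 := fun z hz => ha.ne_zero_of_lt_abs_im hQ haH hz
  obtain ⟨w₁, hw₁⟩ := exists_least_frequency hlam hb hq hq0 (H := H) fun z hz =>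
    hne z (hz.trans_le (le_abs_self _))
  obtain ⟨w₂, hw₂⟩ := exists_least_frequency hlam' hb' hq hq0 (H := H) fun z hz => by
    rw [hneg]
    exact hne _ (by rw [neg_im, abs_neg]; exact hz.trans_le (le_abs_self _))
  obtain ⟨J₁, hJ₁, L₁, c₁, s₁, hL₁, hc₁, hfin₁, hexp₁⟩ :=
    exists_hasSum_logDeriv hlam hb hq (hq0 w₁) hw₁
  obtain ⟨J₂, hJ₂, L₂, c₂, s₂, hL₂, hc₂, hfin₂, hexp₂⟩ :=
    exists_hasSum_logDeriv hlam' hb' hq (hq0 w₂) hw₂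
  set s := max (max s₁ s₂) |H| + 1 with hsdef
  have hs₁ : s₁ < s := by
    have := (le_max_left s₁ s₂).trans (le_max_left (max s₁ s₂) |H|); linarith
  have hs₂ : s₂ < s := by
    have := (le_max_right s₁ s₂).trans (le_max_left (max s₁ s₂) |H|); linarith
  have hHs' : |H| < s := by
    have := le_max_right (max s₁ s₂) |H|; linarith
  have hHs : H < s := (le_abs_self H).trans_lt hHs'
  have hs : 0 < s := (abs_nonneg H).trans_lt hHs'
  obtain ⟨hc₁, hc₁'⟩ := hc₁ s hs₁
  obtain ⟨hc₂, hc₂'⟩ := hc₂ s hs₂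
  have hexp₂' : ∀ z : ℂ, z.im < -s₂ →
      HasSum (fun i => -c₂ i * exp (2 * Real.pi * I * ((-L₂ i : ℝ) : ℂ) * z)) (logDeriv Q z) := by
    intro z hz
    have h1 := (hexp₂ (-z) (by rw [neg_im]; linarith)).neg
    have h2 : -logDeriv (dirichletSum (fun w => -lam w) q) (-z) = logDeriv Q z := by
      have h3 : dirichletSum (fun w => -lam w) q = fun z => Q (-z) := funext hneg
      rw [h3, logDeriv_apply, logDeriv_apply, deriv_comp_neg, neg_neg]
      ring
    rw [h2] at h1
    refine h1.congr_fun fun i => ?_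
    rw [neg_mul]
    congr 3
    push_cast; ring
  have hp : (2 * Real.pi * I : ℂ) ≠ 0 := two_pi_I_ne_zero
  have hpn : ∀ c : ℂ, ‖(2 * Real.pi * I : ℂ)⁻¹ * c‖ = (2 * Real.pi)⁻¹ * ‖c‖ := fun c => by
    simp [abs_of_pos Real.pi_pos]
  -- Both families carry a minus sign: for `J₁` because the upper line is traversed backwards, for
  -- `J₂` because `(Q (-·))' / Q (-·)` is minus `Q'/Q` at the reflected point.
  refine ⟨J₁ ⊕ J₂, inferInstance, Sum.elim L₁ fun i => -L₂ i,
    Sum.elim (fun i => (2 * Real.pi * I)⁻¹ * -c₁ i) fun i => (2 * Real.pi * I)⁻¹ * -c₂ i,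
    2 * Real.pi * s, by positivity, Summable.sum _ ?_ ?_, Summable.sum _ ?_ ?_,
    fun hW R => ?_, fun φ hφ hφc => ?_⟩
  · refine (hc₁.mul_left (2 * Real.pi)⁻¹).congr fun i => ?_
    simp only [Function.comp_apply, Sum.elim_inl, hpn, norm_neg, abs_of_nonneg (hL₁ i)]
    ring
  · refine (hc₂.mul_left (2 * Real.pi)⁻¹).congr fun i => ?_
    simp only [Function.comp_apply, Sum.elim_inr, hpn, norm_neg, abs_neg, abs_of_nonneg (hL₂ i)]
    ring
  · refine (hc₁'.mul_left (2 * Real.pi)⁻¹).congr fun i => ?_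
    simp only [Function.comp_apply, Sum.elim_inl, norm_div, hpn, norm_neg, abs_of_nonneg (hL₁ i)]
    ring
  · refine (hc₂'.mul_left (2 * Real.pi)⁻¹).congr fun i => ?_
    simp only [Function.comp_apply, Sum.elim_inr, norm_div, hpn, norm_neg, abs_neg, ofReal_neg,
      abs_of_nonneg (hL₂ i)]
    ring
  · refine (((hfin₁ hW R).image Sum.inl).union ((hfin₂ hW R).image Sum.inr)).subset ?_
    rintro (i | i) hi
    · have hi' : |L₁ i| ≤ R := hi
      have hi'' : L₁ i ≤ R := (le_abs_self _).trans hi'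
      exact Or.inl ⟨i, hi'', rfl⟩
    · have hi' : |-L₂ i| ≤ R := hi
      have hi'' : L₂ i ≤ R := (le_abs_self _).trans (abs_neg (L₂ i) ▸ hi')
      exact Or.inr ⟨i, hi'', rfl⟩
  · set h := cTransform φ with hh
    have hhd : Differentiable ℂ h := differentiable_cTransform hφ.continuous hφc
    obtain ⟨C, hC0, hC⟩ := exists_norm_cTransform_le_div hφ hφc s
    have hsn : Summable fun n => ‖h (a n)‖ := (hsum.mul_left C).of_nonneg_of_le
      (fun _ => norm_nonneg _) fun n => hC _ ((haH n).trans hHs.le)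
    obtain ⟨hint, heq⟩ := integrable_pointMeasure hsn
    refine ⟨hint, ?_⟩
    have hup := hasSum_integral_cTransform_mul hφ hφc s (c := c₁) (γ := L₁)
      (f := fun x => logDeriv Q (x + s * I)) (hc₁.congr fun i => by rw [mul_right_comm _ s])
      fun x => hexp₁ _ (by simpa using hs₁)
    have hlow := hasSum_integral_cTransform_mul hφ hφc (-s) (c := fun i => -c₂ i)
      (γ := fun i => -L₂ i) (f := fun x => logDeriv Q (x + (-s : ℝ) * I))
      (hc₂.congr fun i => by rw [norm_neg]; congr 3; ring)
      fun x => hexp₂' _ (by simpa using hs₂)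
    have hMup : ∀ z : ℂ, z.im = s → ‖logDeriv Q z‖ ≤
        ∑' i, ‖c₁ i‖ * Real.exp (-(2 * Real.pi * s * L₁ i)) := fun z hz => by
      rw [← (hexp₁ z (hz ▸ hs₁)).tsum_eq]
      refine tsum_of_norm_bounded hc₁.hasSum fun i => ?_
      rw [norm_mul, norm_exp_two_pi_I_mul, hz, mul_right_comm _ s]
    have hMlow : ∀ z : ℂ, z.im = -s → ‖logDeriv Q z‖ ≤
        ∑' i, ‖c₂ i‖ * Real.exp (-(2 * Real.pi * s * L₂ i)) := fun z hz => by
      rw [← (hexp₂' z (by linarith)).tsum_eq]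
      refine tsum_of_norm_bounded hc₂.hasSum fun i => ?_
      rw [norm_mul, norm_exp_two_pi_I_mul, hz, norm_neg]
      refine le_of_eq ?_
      congr 3; ring
    have hM : ∀ z : ℂ, |z.im| = s → ‖logDeriv Q z‖ ≤
        (∑' i, ‖c₁ i‖ * Real.exp (-(2 * Real.pi * s * L₁ i))) +
          ∑' i, ‖c₂ i‖ * Real.exp (-(2 * Real.pi * s * L₂ i)) := by
      intro z hz
      have h1 : 0 ≤ ∑' i, ‖c₁ i‖ * Real.exp (-(2 * Real.pi * s * L₁ i)) :=
        tsum_nonneg fun _ => by positivity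
      have h2 : 0 ≤ ∑' i, ‖c₂ i‖ * Real.exp (-(2 * Real.pi * s * L₂ i)) :=
        tsum_nonneg fun _ => by positivity
      rcases (abs_eq hs.le).1 hz with hz | hz
      · linarith [hMup z hz]
      · linarith [hMlow z hz]
    have hD : ∀ z : ℂ, |z.im| ≤ s → ‖deriv Q z‖ ≤
        (∑' w, ‖2 * Real.pi * I * (lam w : ℂ) * q w‖) * Real.exp (2 * Real.pi * (B * s)) := by
      intro z hz
      rw [hQdef, deriv_dirichletSum hb hq]
      refine tsum_of_norm_bounded
        ((summable_norm_freq_mul hb hq).hasSum.mul_right _) fun w => ?_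
      rw [norm_mul]
      gcongr
      exact norm_exp_le_of_abs_le (hb w) hz
    have htrace := two_pi_I_mul_tsum_eq hQ hhd ha haH hHs hs hC hsum hM hD
      (exists_vertical_line_bound hlam hb hq (hq0 w₁) s)
    have hval : cFourier (pointMeasure a) φ = (2 * Real.pi * I)⁻¹ *
        (-∫ x : ℝ, h (x + s * I) * logDeriv Q (x + s * I)) + (2 * Real.pi * I)⁻¹ *
        ∫ x : ℝ, h (x + (-s : ℝ) * I) * logDeriv Q (x + (-s : ℝ) * I) := by
      rw [cFourier, ← hh, heq, ← mul_add, neg_add_eq_sub, ← htrace, inv_mul_cancel_left₀ hp]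
    rw [hval]
    refine HasSum.sum ?_ ?_
    · refine (hup.neg.mul_left (2 * Real.pi * I)⁻¹).congr_fun fun i => ?_
      simp only [Function.comp_apply, Sum.elim_inl]
      ring
    · refine (hlow.mul_left (2 * Real.pi * I)⁻¹).congr_fun fun i => ?_
      simp only [Function.comp_apply, Sum.elim_inr]
      ring

/-- Different indices may give the same frequency, so the masses are first collected by `fiberSum`;
absolute summability with weights survives this by the triangle inequality. -/
theorem isAlmostPeriodic_and_exists_cFourier [Countable W] (hlam : Function.Injective lam)
    (hb : ∀ w, |lam w| ≤ B) (hq : Summable fun w => ‖q w‖) (hq0 : ∀ w, q w ≠ 0)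
    (ha : IsZeroMultiset a (dirichletSum lam q)) (haH : ∀ n, a n ∈ closedStrip H) :
    IsAlmostPeriodicMultiset a ∧ HasPolynomialGrowth (pointMeasure a) ∧
    ∃ b : ℝ → ℂ, CFourierIsPurePoint (pointMeasure a) b ∧
      (fun r : ℝ => Real.log (∑' γ : {γ : ℝ // |γ| < r}, ‖b γ‖)) =O[atTop] (fun r : ℝ => r) ∧
      Summable (fun γ : {γ : ℝ // 0 < |γ| ∧ |γ| < 1} => ‖b γ / ((γ : ℝ) : ℂ)‖) ∧
      (Finite W → ∀ K : Set ℝ, IsCompact K → (Function.support b ∩ K).Finite) := by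
  have : Nonempty W := by
    by_contra hW
    rw [not_nonempty_iff] at hW
    obtain ⟨z, hz⟩ := ha.exists_ne_zero
    exact hz (by simp [dirichletSum])
  obtain ⟨v⟩ := this
  have hap := isAlmostPeriodicMultiset_of_dirichletSum hlam hb hq (hq0 v) ha
  have hsum := summable_inv_one_add_re_sq haH
    (exists_card_le_of_dirichletSum hlam hb hq (hq0 v) ha (H + 1)) le_rfl
  refine ⟨hap, hasPolynomialGrowth_pointMeasure hap.1 hsum, ?_⟩
  have : Nonempty W := ⟨v⟩
  obtain ⟨J, hJ, γ, c, κ, hκ, hc, hc', hfin, hφ⟩ :=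
    exists_cFourier_hasSum hlam hb hq hq0 ha haH hsum
  have hw : Summable fun x => ‖fiberSum γ c x‖ * Real.exp (-(κ * |x|)) := by
    have h1 := summable_norm_fiberSum_mul (γ := γ) (c := c)
      (w := fun x => ((Real.exp (-(κ * |x|)) : ℝ) : ℂ))
      (by simpa only [norm_real, Real.norm_eq_abs, Real.abs_exp] using hc)
    simpa only [norm_real, Real.norm_eq_abs, Real.abs_exp] using h1
  -- The weight is `e^{-κ|x|} / x`, whose value at `x = 0` is `0` by the convention for division, so
  -- a mass at the origin does no harm.
  have hw' : Summable fun x : ℝ => ‖fiberSum γ c x / x‖ * Real.exp (-(κ * |x|)) := by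
    have h1 := summable_norm_fiberSum_mul (γ := γ) (c := c)
      (w := fun x => ((Real.exp (-(κ * |x|)) : ℝ) : ℂ) / x)
      (hc'.congr fun j => by
        rw [norm_div, norm_div, norm_real (Real.exp _), Real.norm_eq_abs, Real.abs_exp]; ring)
    refine h1.congr fun x => ?_
    rw [norm_div, norm_div, norm_real (Real.exp _), Real.norm_eq_abs, Real.abs_exp]; ring
  refine ⟨fiberSum γ c, ⟨(Set.countable_range γ).mono support_fiberSum_subset,
    fun r => (summable_norm_of_abs_lt hκ hw r).1, fun φ h1 h2 => ⟨(hφ φ h1 h2).1, ?_⟩⟩,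
    isBigO_log_tsum_norm hκ hw, summable_norm_div_of_abs_lt_one hκ hw',
    fun hW K hK => finite_support_fiberSum_inter (hfin hW) hK⟩
  simpa only [← fiberSum_mul] using hasSum_fiberSum (γ := γ) (hφ φ h1 h2).2

end Coefficients

end

noncomputable section

/-! ### Reduction to nonzero coefficients and distinct frequencies -/

section Representation

open Complex

/-- Zero coefficients are discarded: this makes the index set countable, and it lets the infimum of
the frequencies refer to terms that are really present. -/
lemma IsDirichletSeries.exists_eq_dirichletSum {Q : ℂ → ℂ} (h : IsDirichletSeries Q) :
    ∃ (W : Type) (_ : Countable W) (lam : W → ℝ) (q : W → ℂ) (B : ℝ), Function.Injective lam ∧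
      (∀ w, |lam w| ≤ B) ∧ (Summable fun w => ‖q w‖) ∧ (∀ w, q w ≠ 0) ∧
      Q = dirichletSum lam q := by
  obtain ⟨Ω, q, hΩ, hq, hQ⟩ := h
  obtain ⟨B, hB⟩ := hΩ.exists_norm_le
  have hsupp : (Function.support q).Countable := by
    have h1 := hq.countable_support
    rwa [show (Function.support fun w => ‖q w‖) = Function.support q by ext; simp] at h1
  refine ⟨Function.support q, hsupp.to_subtype, fun w => (w : Ω), fun w => q w, B,
    Subtype.val_injective.comp Subtype.val_injective, fun w => hB _ (w : Ω).2,
    hq.comp_injective Subtype.val_injective, fun w => w.2, funext fun z => ?_⟩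
  rw [← (hQ z).tsum_eq, dirichletSum]
  refine (tsum_subtype_eq_of_support_subset (s := Function.support q) fun w hw h0 => hw ?_).symm
  simp [h0]

/-- The given frequencies may repeat, so coefficients of equal frequency are added and those that
cancel are dropped. -/
lemma IsExponentialPolynomial.exists_eq_dirichletSum {P : ℂ → ℂ} (h : IsExponentialPolynomial P) :
    ∃ (W : Type) (_ : Finite W) (lam : W → ℝ) (q : W → ℂ) (B : ℝ), Function.Injective lam ∧
      (∀ w, |lam w| ≤ B) ∧ (Summable fun w => ‖q w‖) ∧ (∀ w, q w ≠ 0) ∧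
      P = dirichletSum lam q := by
  classical
  obtain ⟨N, q, w, hP⟩ := h
  set Ω : Set ℝ := Set.range w
  have hΩ : Ω.Finite := Set.finite_range w
  obtain ⟨B, hB⟩ := hΩ.isBounded.exists_norm_le
  set c : ℝ → ℂ := fun x => ∑ j with w j = x, q j
  have hfin : (Function.support c).Finite := by
    refine hΩ.subset fun x hx => ?_
    obtain ⟨j, hj, -⟩ := Finset.exists_ne_zero_of_sum_ne_zero hx
    exact ⟨j, (Finset.mem_filter.1 hj).2⟩
  have := hfin.to_subtype
  have hsub : ∀ x ∈ Function.support c, x ∈ Finset.univ.image w := fun x hx => by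
    obtain ⟨j, hj, -⟩ := Finset.exists_ne_zero_of_sum_ne_zero hx
    exact Finset.mem_image.2 ⟨j, Finset.mem_univ _, (Finset.mem_filter.1 hj).2⟩
  refine ⟨Function.support c, this, fun x => x, fun x => c x, B, Subtype.val_injective,
    fun x => hB _ ?_, Summable.of_finite, fun x => x.2, funext fun z => ?_⟩
  · simpa [Ω] using hsub x x.2
  · set f : ℝ → ℂ := fun x => c x * exp (2 * Real.pi * I * (x : ℂ) * z)
    have hf : Function.support f ⊆ Function.support c := fun x hx h0 => hx (by simp [f, h0])
    have h1 : dirichletSum (fun x : Function.support c => (x : ℝ)) (fun x => c x) z = ∑' x, f x :=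
      tsum_subtype_eq_of_support_subset hf
    rw [h1, tsum_eq_sum (s := Finset.univ.image w) fun x hx => by
      by_contra hne
      exact hx (hsub x (hf hne)), hP,
      ← Finset.sum_fiberwise_of_maps_to fun j _ => Finset.mem_image_of_mem w (Finset.mem_univ j)]
    refine Finset.sum_congr rfl fun x _ => ?_
    simp only [f, c, Finset.sum_mul]
    refine Finset.sum_congr rfl fun j hj => ?_
    rw [(Finset.mem_filter.1 hj).2]

end Representation

end

theorem theorem1 {ι : Type*} (H : ℝ) (a : ι → ℂ) (Q : ℂ → ℂ)
    (hQ : IsDirichletSeries Q) (haQ : IsZeroMultiset a Q) (haH : ∀ n, a n ∈ closedStrip H) :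
    IsAlmostPeriodicMultiset a ∧
    HasPolynomialGrowth (pointMeasure a) ∧
    ∃ b : ℝ → ℂ,
      CFourierIsPurePoint (pointMeasure a) b ∧
      (fun r : ℝ => Real.log (∑' γ : {γ : ℝ // |γ| < r}, ‖b γ‖)) =O[atTop] (fun r : ℝ => r) ∧
      Summable (fun γ : {γ : ℝ // 0 < |γ| ∧ |γ| < 1} => ‖b γ / ((γ : ℝ) : ℂ)‖) ∧
      ((∃ P : ℂ → ℂ, IsExponentialPolynomial P ∧ IsZeroMultiset a P) →
        ∀ K : Set ℝ, IsCompact K → (Function.support b ∩ K).Finite) := by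
  -- The masses are chosen before the exponential polynomial is given. If one exists, the whole
  -- argument is run with `P` in place of `Q`, since the conclusions involve only the multiset;
  -- otherwise the last claim is vacuous.
  by_cases hP : ∃ P : ℂ → ℂ, IsExponentialPolynomial P ∧ IsZeroMultiset a P
  · obtain ⟨P, hP, haP⟩ := hP
    obtain ⟨W, hW, lam, q, B, hlam, hb, hq, hq0, rfl⟩ := hP.exists_eq_dirichletSum
    obtain ⟨h1, h2, b, h3, h4, h5, h6⟩ :=
      isAlmostPeriodic_and_exists_cFourier hlam hb hq hq0 haP haH
    exact ⟨h1, h2, b, h3, h4, h5, fun _ => h6 hW⟩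
  · obtain ⟨W, hW, lam, q, B, hlam, hb, hq, hq0, rfl⟩ := hQ.exists_eq_dirichletSum
    obtain ⟨h1, h2, b, h3, h4, h5, -⟩ :=
      isAlmostPeriodic_and_exists_cFourier hlam hb hq hq0 haQ haH
    exact ⟨h1, h2, b, h3, h4, h5, fun h => absurd h hP⟩
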